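/- **Setting (combinatorial allocation bandits).** There are $N\ge1$ users, $K\ge1$ arms, dimension $d\ge1$ and horizon $T\ge1$; $\Pi$ is the set of all maps $\pi:[N]\to[K]$. Contexts $\phi_t(i,a)\in\mathbb R^d$ with $\|\phi_t(i,a)\|_2\le1$ are fixed in advance, and $\theta^*\in\mathbb R^d$ is an unknown parameter with $\|\theta^*\|_2\le D$, $D>0$. In round $t$ the learner chooses $\pi_t\in\Pi$, sets $x_t(i)=\phi_t(i,\pi_t(i))$, and observes, for each user $i$ (conditionally independently given the past and $\pi_t$), a feedback $y_t(i)$ drawn from a generalized linear model: its law has density $\exp\{y\,z-m(z)\}$ with respect to a fixed base measure on $\mathbb R$, where $z=x_t(i)^\top\theta^*$, $m:\mathbb R\to\mathbb R$ is twice differentiable, and the density is normalized for every $z\in\mathbb R$. Put $\mu=m'$ and assume: $\mu\ge0$; $\mu$ is Lipschitz with constant $L_\mu$; $\kappa_\mu=\inf\{\mu'(x^\top\theta):\|x\|_2\le1,\ \|\theta-\theta^*\|_2\le D+1\}>0$; and for every context $\phi_t(i,a)$ the feedback minus its mean $\mu(\phi_t(i,a)^\top\theta^*)$ is $\sigma$-sub-Gaussian,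 $\sigma>0$. Let $r:[0,\infty)\to[0,M]$ be concave, nondecreasing and Lipschitz with constant $L_r$, and $$f_t(\pi;\theta)=\sum_{a=1}^K r\Big(\sum_{i:\pi(i)=a}\mu(\phi_t(i,a)^\top\theta)\Big),\qquad \mathcal R_T^\alpha=\sum_{t=1}^T\Big(\alpha\max_{\pi\in\Pi}f_t(\pi;\theta^*)-f_t(\pi_t;\theta^*)\Big),\quad \alpha\in(0,1].$$ **Algorithm (CAB-TS with parameters $\lambda_0,a>0$).** In round $t$ let $\bar\theta_t$ minimize over $\theta\in\mathbb R^d$ $$\sum_{s<t}\sum_{i=1}^N\big[m(x_s(i)^\top\theta)-y_s(i)\,x_s(i)^\top\theta\big]+\tfrac{\kappa_\mu\lambda_0}{2}\|\theta\|_2^2 .$$ Let $H_1=L_\mu\lambda_0I$ and, for $t\ge2$, $H_t=\sum_{s<t}\sum_{i=1}^N\mu'(x_s(i)^\top\bar\theta_t)\big(x_s(i)x_s(i)^\top+\tfrac{\lambda_0}{N(t-1)}I\big)$. Given the past, draw $\tilde\epsilon_t(1),\dots,\tilde\epsilon_t(N)$ i.i.d. from $\mathcal N(0,a^2H_t^{-1})$,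 and choose $$\pi_t\in\arg\max_{\pi\in\Pi}\Big(f_t(\pi;\bar\theta_t)+\sum_{i=1}^N\phi_t(i,\pi(i))^\top\tilde\epsilon_t(i)\Big).$$ **Theorem.** For $\delta\in(0,1/T)$ let $\underline\lambda(\delta)=\frac{\sigma^2}{\kappa_\mu^2}\big(d\log(1+\frac{NT}{d})+2\log\frac1\delta\big)$, $$c_1=\frac{L_rL_\mu}{\kappa_\mu}\Big(\sigma\sqrt{d\log\big(1+\tfrac{NT}{d\lambda_0}\big)+2\log\tfrac1\delta}+\kappa_\mu D\sqrt{\lambda_0}\Big),\qquad c_2=c_1\sqrt{2\kappa_\mu^{-1}L_\mu N\log\tfrac{KN}{\delta}},$$ and run CAB-TS with $a=c_1\sqrt{L_\mu N}$ and some $\lambda_0\ge\underline\lambda(\delta)$. 1. If moreover $\delta<3/40$ (i.e. $0.15-2\delta>0$), then $\mathcal R_T^\alpha$ is integrable and $$\mathbb E[\mathcal R_T^\alpha]\le(c_1+c_2)\Big(1+\frac{2}{0.15-2\delta}\Big)\Big(\sqrt{2dNT\log\big(1+\tfrac{NT}{d\lambda_0}\big)}+\frac{2dN}{\sqrt{\lambda_0}}\log\big(1+\tfrac{NT}{d\lambda_0}\big)\Big)+4\delta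 MT .$$ 2. If $\lambda_0=\underline\lambda(\delta)$, then $\mathbb E[\mathcal R_T^\alpha]=\tilde O\big(\kappa_\mu^{-1}L_rL_\mu D\,(dN\sqrt T+dN^{3/2})\big)$ in the following sense: there is an absolute exponent $p$ such that for every $B$ there is a constant $C$ depending only on $B$ with $$\mathbb E[\mathcal R_T^\alpha]\le C\,\kappa_\mu^{-1}L_rL_\mu D\,\big(dN\sqrt T+dN^{3/2}\big)\Big(1+\log\frac{KNT}{\delta}\Big)^p$$ for all $N,K,d,T,\alpha$, all $\delta\in(0,1/T)$ and all instances with $\sigma\le B$, $L_\mu/\kappa_\mu\le B$, $1/D\le B$ and $M\le B\,\kappa_\mu^{-1}L_rL_\mu D$. -/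

import Mathlib

open MeasureTheory ProbabilityTheory

/-- Feature / parameter space `ℝ^d` with the Euclidean norm. -/
abbrev Feat (d : ℕ) : Type := EuclideanSpace ℝ (Fin d)

/-- Allocations of the `N` users to the `K` arms. -/
abbrev Alloc (N K : ℕ) : Type := Fin N → Fin K

/-- The exponential family in natural form: the law with density
`y ↦ exp (y z - m z)` with respect to the base measure `ν`, at natural parameter `z`. -/
noncomputable def glmLaw (ν : Measure ℝ) (m : ℝ → ℝ) (z : ℝ) : Measure ℝ :=
  ν.withDensity (fun y => ENNReal.ofReal (Real.exp (y * z - m z)))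

/-- `κ_μ`, the infimum of the derivative of `μ = m'` at `xᵀθ` over `‖x‖ ≤ 1`,
`‖θ - θ*‖ ≤ D + 1`. -/
noncomputable def kappaInf {d : ℕ} (m : ℝ → ℝ) (θs : Feat d) (D : ℝ) : ℝ :=
  sInf {v : ℝ | ∃ x θ : Feat d, ‖x‖ ≤ 1 ∧ ‖θ - θs‖ ≤ D + 1 ∧
    v = deriv (deriv m) (inner ℝ x θ)}

/-- An instance of combinatorial allocation bandits with `N` users, `K` arms, dimension `d` and
horizon `T`, together with the standing assumptions of the model.
Rounds are numbered `0, …, T - 1`. -/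
structure CAB (N K d T : ℕ) where
  /-- the contexts `φ_t(i, a)`, fixed in advance -/
  φ : ℕ → Fin N → Fin K → Feat d
  /-- the unknown parameter -/
  θs : Feat d
  /-- the bound on the norm of the unknown parameter -/
  D : ℝ
  /-- the sub-Gaussian parameter of the feedback -/
  σ : NNReal
  /-- base measure of the exponential family -/
  ν : Measure ℝ
  /-- log-partition function of the exponential family; the mean function is `μ = m'` -/
  m : ℝ → ℝ
  /-- a Lipschitz constant of the mean function -/
  Lμ : NNReal
  /-- the satisfaction function (used on `[0, ∞)` only) -/
  r : ℝ → ℝ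
  /-- a Lipschitz constant of `r` -/
  Lr : NNReal
  /-- an upper bound of `r` -/
  M : ℝ
  norm_φ_le : ∀ t < T, ∀ i a, ‖φ t i a‖ ≤ 1
  D_pos : 0 < D
  norm_θs_le : ‖θs‖ ≤ D
  σ_pos : 0 < σ
  isProbabilityMeasure_glmLaw : ∀ z, IsProbabilityMeasure (glmLaw ν m z)
  differentiable_m : Differentiable ℝ m
  differentiable_mean : Differentiable ℝ (deriv m)
  mean_nonneg : ∀ z, 0 ≤ deriv m z
  subGaussian : ∀ t < T, ∀ i a,
    HasSubgaussianMGF (fun y => y - deriv m (inner ℝ (φ t i a) θs)) (σ ^ 2)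
      (glmLaw ν m (inner ℝ (φ t i a) θs))
  lipschitz_mean : LipschitzWith Lμ (deriv m)
  kappa_pos : 0 < kappaInf m θs D
  r_nonneg : ∀ x, 0 ≤ x → 0 ≤ r x
  r_le : ∀ x, 0 ≤ x → r x ≤ M
  r_concave : ConcaveOn ℝ (Set.Ici 0) r
  r_mono : MonotoneOn r (Set.Ici 0)
  r_lipschitz : LipschitzOnWith Lr r (Set.Ici 0)

namespace CAB

variable {N K d T : ℕ}

/-- The mean function `μ = m'`. -/
noncomputable def mean (I : CAB N K d T) : ℝ → ℝ := deriv I.m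

/-- `κ_μ`. -/
noncomputable def kappa (I : CAB N K d T) : ℝ := kappaInf I.m I.θs I.D

/-- `f_t(π; θ) = ∑_a r (∑_{i ∈ π⁻¹(a)} μ (φ_t(i,a)ᵀ θ))`. -/
noncomputable def f (I : CAB N K d T) (t : ℕ) (π : Alloc N K) (θ : Feat d) : ℝ :=
  ∑ a : Fin K, I.r (∑ i with π i = a, I.mean (inner ℝ (I.φ t i a) θ))

/-- `h_t(π; ε) = ∑_i φ_t(i,π(i))ᵀ ε(i)`. -/
noncomputable def h (I : CAB N K d T) (t : ℕ) (π : Alloc N K) (ε : Fin N → Feat d) : ℝ :=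
  ∑ i : Fin N, inner ℝ (I.φ t i (π i)) (ε i)

/-- Regularized negative log-likelihood (up to an additive constant) of the data
`(φ_s(i, πs s i), ys s i)`, `s < t`, with ridge parameter `lam`. -/
noncomputable def regNLL (I : CAB N K d T) (t : ℕ) (πs : ℕ → Alloc N K) (ys : ℕ → Fin N → ℝ)
    (lam : ℝ) (θ : Feat d) : ℝ :=
  ∑ s ∈ Finset.range t, ∑ i : Fin N,
      (I.m (inner ℝ (I.φ s i (πs s i)) θ) - ys s i * inner ℝ (I.φ s i (πs s i)) θ)
    + lam / 2 * ‖θ‖ ^ 2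

/-- The matrix `H` used in round `t` (so after `t` completed rounds): `L_μ λ₀ I` if `t = 0`, and
otherwise `∑_{s<t} ∑_i μ'(x_s(i)ᵀ θ) (x_s(i) x_s(i)ᵀ + λ₀ / (N t) I)`, where `θ` is the current
estimate and `x_s(i) = φ_s(i, πs s i)`. -/
noncomputable def H (I : CAB N K d T) (lam0 : ℝ) (t : ℕ) (πs : ℕ → Alloc N K) (θ : Feat d) :
    Matrix (Fin d) (Fin d) ℝ :=
  if t = 0 then ((I.Lμ : ℝ) * lam0) • (1 : Matrix (Fin d) (Fin d) ℝ)
  else ∑ s ∈ Finset.range t, ∑ i : Fin N,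
    deriv I.mean (inner ℝ (I.φ s i (πs s i)) θ) •
      (Matrix.vecMulVec (I.φ s i (πs s i)) (I.φ s i (πs s i))
        + (lam0 / (N * t)) • (1 : Matrix (Fin d) (Fin d) ℝ))

/-- The `α`-approximate regret of a sequence of allocations. -/
noncomputable def regret (I : CAB N K d T) (α : ℝ) (πs : ℕ → Alloc N K) : ℝ :=
  ∑ t ∈ Finset.range T, (α * (⨆ ρ : Alloc N K, I.f t ρ I.θs) - I.f t (πs t) I.θs)

/-- The threshold `κ_μ⁻² σ² (d log (1 + N T / d) + 2 log (1 / δ))` for `λ₀`. -/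
noncomputable def lamMin (I : CAB N K d T) (δ : ℝ) : ℝ :=
  (I.σ : ℝ) ^ 2 / I.kappa ^ 2 * (d * Real.log (1 + N * T / d) + 2 * Real.log (1 / δ))

/-- `c₁`. -/
noncomputable def c₁ (I : CAB N K d T) (lam0 δ : ℝ) : ℝ :=
  I.Lr * I.Lμ / I.kappa *
    (I.σ * √(d * Real.log (1 + N * T / (d * lam0)) + 2 * Real.log (1 / δ))
      + I.kappa * I.D * √lam0)

/-- `c₂`. -/
noncomputable def c₂ (I : CAB N K d T) (lam0 δ : ℝ) : ℝ :=
  I.c₁ lam0 δ * √(2 * I.kappa⁻¹ * I.Lμ * N * Real.log (K * N / δ))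

/-- The exploration parameter `a = c₁ √(L_μ N)`. -/
noncomputable def expl (I : CAB N K d T) (lam0 δ : ℝ) : ℝ :=
  I.c₁ lam0 δ * √(I.Lμ * N)

end CAB

/-- The `σ`-algebra generated by the allocations and the feedback of the rounds `s < t`. -/
@[reducible] def history {Ω : Type*} {N K : ℕ} (y : ℕ → Ω → Fin N → ℝ) (π : ℕ → Ω → Alloc N K) (t : ℕ) :
    MeasurableSpace Ω :=
  ⨆ s : Fin t, MeasurableSpace.comap (y s) inferInstance ⊔
    MeasurableSpace.comap (π s) inferInstance

/-- The conditional law of `X` given the `σ`-algebra `m` is `Q`. -/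
def HasCondLaw {Ω S : Type*} [MeasurableSpace Ω] [MeasurableSpace S] (P : Measure Ω)
    (m : MeasurableSpace Ω) (X : Ω → S) (Q : Ω → Measure S) : Prop :=
  ∀ A : Set S, MeasurableSet A → P⟦X ⁻¹' A | m⟧ =ᵐ[P] fun ω => (Q ω).real A

/-- A run of CAB-TS with parameters `λ₀ = lam0` and `a`, on the probability space `(Ω, P)`, against
the instance `I`: the feedback `y`, the allocations `π`, the perturbations `ε` and the estimates
`θbar`, linked by the rules of the algorithm and of the feedback model. -/
structure CABTSRun {N K d T : ℕ} (I : CAB N K d T) (lam0 a : ℝ) {Ω : Type*} [MeasurableSpace Ω]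
    (P : Measure Ω) where
  y : ℕ → Ω → Fin N → ℝ
  π : ℕ → Ω → Alloc N K
  ε : ℕ → Ω → Fin N → Feat d
  θbar : ℕ → Ω → Feat d
  measurable_y : ∀ t < T, Measurable (y t)
  measurable_π : ∀ t < T, Measurable (π t)
  measurable_ε : ∀ t < T, Measurable (ε t)
  measurable_θbar : ∀ t < T, Measurable[history y π t] (θbar t)
  /-- the estimate is the ridge-regularized maximum likelihood estimate -/
  isMin_θbar : ∀ t < T, ∀ᵐ ω ∂P, ∀ θ : Feat d,
    I.regNLL t (fun s => π s ω) (fun s => y s ω) (I.kappa * lam0) (θbar t ω) ≤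
      I.regNLL t (fun s => π s ω) (fun s => y s ω) (I.kappa * lam0) θ
  /-- given the past, the perturbations of the users are i.i.d. `N(0, a² H_t⁻¹)` -/
  law_ε : ∀ t < T, HasCondLaw P (history y π t) (ε t) fun ω =>
    Measure.pi fun _ : Fin N =>
      multivariateGaussian 0 (a ^ 2 • (I.H lam0 t (fun s => π s ω) (θbar t ω))⁻¹)
  /-- the allocation maximizes the perturbed objective -/
  isMax_π : ∀ t < T, ∀ᵐ ω ∂P, ∀ ρ : Alloc N K,
    I.f t ρ (θbar t ω) + I.h t ρ (ε t ω) ≤ I.f t (π t ω) (θbar t ω) + I.h t (π t ω) (ε t ω)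
  /-- given the past and the allocation, the feedback of the users is independent and follows the
  generalized linear model -/
  law_y : ∀ t < T, HasCondLaw P (history y π t ⊔ MeasurableSpace.comap (π t) inferInstance) (y t)
    fun ω => Measure.pi fun i : Fin N => glmLaw I.ν I.m (inner ℝ (I.φ t i (π t ω i)) I.θs)

/-- The regret of a run, as a random variable. -/
noncomputable def CABTSRun.regret {N K d T : ℕ} {I : CAB N K d T} {lam0 a : ℝ} {Ω : Type*}
    [MeasurableSpace Ω] {P : Measure Ω} (R : CABTSRun I lam0 a P) (α : ℝ) (ω : Ω) : ℝ :=
  I.regret α (fun t => R.π t ω)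

/-!
Why the bounds hold.

*Confidence.* Write `V_t = λ₀ I + ∑_{s<t} ∑_i x_s(i) x_s(i)ᵀ` and let `S_t` be the score, the sum of
the past features weighted by the noise. Averaging the exponential supermartingale of the score over
a Gaussian direction bounds the exponential moment of `S_tᵀ V_t⁻¹ S_t`
(`CABTSRun.lintegral_exp_invQuad_score_le`). The first-order condition of the regularized maximum
likelihood estimate turns this into a bound on the `V_t`-norm of the estimation error
(`CAB.kappa_mul_sqrt_quad_le`), as long as the slopes of `μ` that occur are at least `κ_μ`. For this
it is enough that the error is at most `D + 1` *along the features observed so far*; the norm of the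
error itself need not be small in directions that have hardly been explored. If this good event
fails, then the score is so large (`CAB.mul_kappa_sq_le_invQuad_score`) that the condition on `λ₀`
makes the failure probability at most `4 δ / N` (`CABTSRun.measure_compl_good_le`). As a round costs
at most `N M` (`CAB.f_sub_f_le`), failures contribute at most `4 δ M T`.

*One round.* On the good event `κ_μ V_t ≤ H_t ≤ L_μ V_t`, so the perturbed score of an allocation has
a standard deviation between `c₁` times its bonus, the sum of the `V_t⁻¹`-norms of its contexts, and
`c₁ √(N L_μ / κ_μ)` times the root of the sum of the squares of these norms. The lower bound makes
the perturbation of an optimal allocation compensate the estimation error with probability at least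
`11 / 100`. Hence the shortfall of the estimated optimal value is at most a constant times the
expected positive part of the gain of the perturbed over the unperturbed optimal value
(`CAB.f_add_sub_iSup_le`), and this gain is at most the perturbation of the allocation that is
actually chosen (`CAB.gain_le_h`). The rest of the regret is again the perturbation of the chosen
allocation, because the gain has nonnegative expectation (`CAB.integral_gain_nonneg`). Finally the
perturbation of the chosen allocation is at most `c₂` times its bonus, up to Gaussian tails over all
users and arms (`CABTSRun.integrable_indicator_excess`).

*Summation.* The bonuses add up to the usual elliptic potential (`CAB.sum_bonus_le`). The two factors
`111 / 11` and `7 / 5` which the argument loses stay below `1 + 2 / 0.15`.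

*Rate.* If `δ > 1 / 20` then `T < 20`, and the regret is at most `T N M`. Otherwise the explicit
bound applies. A sub-Gaussian parameter dominates the variance, so `κ_μ ≤ σ²`
(`CAB.kappa_le_σ_sq`); hence `1 / λ₀` is bounded, all logarithms are comparable, and `c₁` is at most
of the order of `√λ₀`, which cancels the factor `1 / √λ₀` in the second part of the potential.
-/

/-! ### Conditional laws and disintegration -/

/-- A conditional law on a standard Borel space is almost surely a Markov kernel that is measurable
with respect to the conditioning `σ`-algebra, and this kernel disintegrates the joint law. -/
theorem HasCondLaw.exists_kernel {Ω S : Type*} {m : MeasurableSpace Ω} [mΩ : MeasurableSpace Ω]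
    [MeasurableSpace S]
    [StandardBorelSpace S] [Nonempty S] {P : Measure Ω} [IsProbabilityMeasure P]
    (hm : m ≤ mΩ) {X : Ω → S} (hX : Measurable X) {Q : Ω → Measure S}
    [∀ ω, IsProbabilityMeasure (Q ω)] (h : HasCondLaw P m X Q) :
    ∃ k : @Kernel Ω S m _, IsMarkovKernel k ∧ (∀ᵐ ω ∂P, k ω = Q ω) ∧
      @Measure.compProd Ω S m _ (P.trim hm) k =
        @Measure.map Ω (Ω × S) mΩ (@Prod.instMeasurableSpace Ω S m _) (fun ω => (ω, X ω)) P := by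
  have hid : @Measurable Ω Ω mΩ m id := fun s hs => hm s hs
  have hmap : @Measure.map Ω Ω mΩ m id P = P.trim hm := (trim_eq_map hm).symm
  let k : @Kernel Ω S m _ := @condDistrib Ω Ω S _ _ _ mΩ m X id P _
  refine ⟨k, inferInstanceAs (IsMarkovKernel (@condDistrib Ω Ω S _ _ _ mΩ m X id P _)), ?_, ?_⟩
  · let e : S → ℝ := embeddingReal S
    have he : MeasurableEmbedding e := measurableEmbedding_embeddingReal S
    have key : ∀ q : ℚ, ∀ᵐ ω ∂P, (k ω).real (e ⁻¹' Set.Iic (q : ℝ)) =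
        (Q ω).real (e ⁻¹' Set.Iic (q : ℝ)) := by
      intro q
      have hA : MeasurableSet (e ⁻¹' Set.Iic (q : ℝ)) := he.measurable measurableSet_Iic
      have h1 := @condDistrib_ae_eq_condExp Ω Ω S _ _ _ mΩ P _ id X m _ hid hX hA
      rw [MeasurableSpace.comap_id] at h1
      exact h1.trans (h _ hA)
    filter_upwards [ae_all_iff.2 key] with ω hω
    have : IsProbabilityMeasure (k ω) :=
      inferInstanceAs (IsProbabilityMeasure (@condDistrib Ω Ω S _ _ _ mΩ m X id P _ ω))
    have h2 : (k ω).map e = (Q ω).map e := by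
      have := Measure.isProbabilityMeasure_map (μ := k ω) he.measurable.aemeasurable
      have := Measure.isProbabilityMeasure_map (μ := Q ω) he.measurable.aemeasurable
      refine ext_of_generate_finite _ Real.borel_eq_generateFrom_Iic_rat ?_ ?_ (by simp)
      · exact Real.isPiSystem_Iic_rat
      · intro s hs
        obtain ⟨q, hq⟩ := Set.mem_iUnion.1 hs
        rw [Set.mem_singleton_iff] at hq
        subst hq
        rw [Measure.map_apply he.measurable measurableSet_Iic,
          Measure.map_apply he.measurable measurableSet_Iic]
        have := hω q
        rwa [measureReal_def, measureReal_def, ENNReal.toReal_eq_toReal_iff' (by finiteness)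
          (by finiteness)] at this
    rw [← he.comap_map (k ω), h2, he.comap_map]
  · have h3 := @compProd_map_condDistrib Ω Ω S _ _ _ mΩ P _ id X m hX.aemeasurable
    rw [hmap] at h3
    exact h3

theorem integrable_and_integral_map {A B : Type*} {mA : MeasurableSpace A} {mB : MeasurableSpace B}
    {μ : Measure A} {u : A → B} (hu : Measurable u) {g : B → ℝ} (hg : Measurable g) :
    (Integrable g (μ.map u) ↔ Integrable (fun a => g (u a)) μ) ∧
      ∫ b, g b ∂(μ.map u) = ∫ a, g (u a) ∂μ :=
  ⟨integrable_map_measure hg.aestronglyMeasurable hu.aemeasurable,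
    integral_map hu.aemeasurable hg.aestronglyMeasurable⟩

section
variable {Ω S : Type*} {m : MeasurableSpace Ω} [mΩ : MeasurableSpace Ω]
    [MeasurableSpace S]
    [StandardBorelSpace S] [Nonempty S] {P : Measure Ω} [IsProbabilityMeasure P]
    {X : Ω → S} {Q : Ω → Measure S}
    [∀ ω, IsProbabilityMeasure (Q ω)]

/-- Fubini for a conditional law, for nonnegative functions. -/
theorem HasCondLaw.lintegral_eq (h : HasCondLaw P m X Q) (hm : m ≤ mΩ) (hX : Measurable X)
    {g : Ω → S → ENNReal}
    (hg : @Measurable (Ω × S) ENNReal (@Prod.instMeasurableSpace Ω S m _) _ (Function.uncurry g)) :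
    ∫⁻ ω, g ω (X ω) ∂P = ∫⁻ ω, ∫⁻ e, g ω e ∂(Q ω) ∂P := by
  obtain ⟨k, hk, hkQ, hcomp⟩ := h.exists_kernel hm hX
  have hmX : @Measurable Ω (Ω × S) mΩ (@Prod.instMeasurableSpace Ω S m _) (fun ω => (ω, X ω)) :=
    Measurable.prodMk (measurable_id'' hm) hX
  have h1 := @lintegral_map Ω (Ω × S) mΩ (@Prod.instMeasurableSpace Ω S m _) P _ _ hg hmX
  simp only [Function.uncurry] at h1
  rw [← h1, ← hcomp]
  have h2 := @Measure.lintegral_compProd Ω S m _ (P.trim hm) k _ _ _ hg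
  simp only [Function.uncurry] at h2
  rw [h2, lintegral_trim hm]
  · refine lintegral_congr_ae ?_
    filter_upwards [hkQ] with ω hω
    simp [hω]
  · exact @Measurable.lintegral_kernel_prod_right Ω S m _ k _ _ hg

/-- Fubini for a conditional law, for integrable functions. -/
theorem HasCondLaw.integral_eq (h : HasCondLaw P m X Q) (hm : m ≤ mΩ) (hX : Measurable X)
    {g : Ω → S → ℝ}
    (hg : @Measurable (Ω × S) ℝ (@Prod.instMeasurableSpace Ω S m _) _ (Function.uncurry g))
    (hint : Integrable (fun ω => g ω (X ω)) P) :
    Integrable (fun ω => ∫ e, g ω e ∂(Q ω)) P ∧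
    (∀ᵐ ω ∂P, Integrable (g ω) (Q ω)) ∧
    ∫ ω, g ω (X ω) ∂P = ∫ ω, ∫ e, g ω e ∂(Q ω) ∂P := by
  obtain ⟨k, hk, hkQ, hcomp⟩ := h.exists_kernel hm hX
  have hmX : @Measurable Ω (Ω × S) mΩ (@Prod.instMeasurableSpace Ω S m _) (fun ω => (ω, X ω)) :=
    Measurable.prodMk (measurable_id'' hm) hX
  have hgs : @StronglyMeasurable (Ω × S) ℝ _ (@Prod.instMeasurableSpace Ω S m _)
    (Function.uncurry g) := hg.stronglyMeasurable
  have hi : @Integrable _ _ _ _ (@Prod.instMeasurableSpace Ω S m _) (Function.uncurry g)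
      (@Measure.compProd Ω S m _ (P.trim hm) k) := by
    rw [hcomp]
    exact (integrable_and_integral_map hmX hg).1.2 hint
  have h1 := (integrable_and_integral_map (μ := P) hmX hg).2
  have h2 := Measure.integral_compProd hi
  have h3 := ((Measure.integrable_compProd_iff hi.1).1 hi).2
  have h4 := ((Measure.integrable_compProd_iff hi.1).1 hi).1
  have hsm := hgs.integral_kernel_prod_right' (κ := k)
  have h5 : Integrable (fun ω => ∫ e, g ω e ∂(k ω)) P :=
    (integrable_of_integrable_trim hm h3).mono' (hsm.mono hm).aestronglyMeasurable
      (Filter.Eventually.of_forall fun ω => norm_integral_le_integral_norm _)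
  have hae : (fun ω => ∫ e, g ω e ∂(k ω)) =ᵐ[P] fun ω => ∫ e, g ω e ∂(Q ω) := by
    filter_upwards [hkQ] with ω hω
    rw [hω]
  refine ⟨h5.congr hae, ?_, ?_⟩
  · filter_upwards [hkQ, ae_of_ae_trim hm h4] with ω hω h6
    rwa [← hω]
  · simp only [Function.uncurry] at h1 h2
    rw [← h1, ← hcomp, h2, ← integral_congr_ae hae]
    exact (integral_trim hm hsm).symm
end

/-! ### Gaussian tails and linear statistics of Gaussian vectors -/

theorem gaussianReal_zero_one_Ici_one : (11 / 100 : ℝ) ≤ (gaussianReal 0 1).real (Set.Ici 1) := by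
  have h1 : (gaussianReal 0 1).real (Set.Icc 1 2) ≤ (gaussianReal 0 1).real (Set.Ici 1) :=
    measureReal_mono Set.Icc_subset_Ici_self
  refine le_trans ?_ h1
  rw [measureReal_def, gaussianReal_apply_eq_integral 0 one_ne_zero,
    ENNReal.toReal_ofReal (integral_nonneg fun x => gaussianPDFReal_nonneg _ _ _)]
  -- the tangent-line bound for `exp` at the midpoint `3 / 2` of the interval `[1, 2]`
  have hpt : ∀ x : ℝ, (√(2 * Real.pi))⁻¹ * Real.exp (-(9/8)) * (1 - (x ^ 2 / 2 - 9 / 8)) ≤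
      gaussianPDFReal 0 1 x := by
    intro x
    rw [gaussianPDFReal_def]
    simp only [NNReal.coe_one, mul_one, sub_zero]
    rw [mul_assoc]
    refine mul_le_mul_of_nonneg_left ?_ (by positivity)
    have : Real.exp (-x ^ 2 / 2) = Real.exp (-(9/8)) * Real.exp (-(x ^ 2 / 2 - 9 / 8)) := by
      rw [← Real.exp_add]; ring_nf
    rw [this]
    refine mul_le_mul_of_nonneg_left ?_ (Real.exp_pos _).le
    have := Real.add_one_le_exp (-(x ^ 2 / 2 - 9 / 8))
    linarith
  have hi : ∫ x in Set.Icc (1:ℝ) 2,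
      (√(2 * Real.pi))⁻¹ * Real.exp (-(9/8)) * (1 - (x ^ 2 / 2 - 9 / 8)) ≤
      ∫ x in Set.Icc (1:ℝ) 2, gaussianPDFReal 0 1 x := by
    refine setIntegral_mono ?_ (integrable_gaussianPDFReal 0 1).integrableOn hpt
    exact (Continuous.continuousOn (by fun_prop)).integrableOn_Icc
  refine le_trans ?_ hi
  rw [integral_Icc_eq_integral_Ioc, ← intervalIntegral.integral_of_le (by norm_num),
    intervalIntegral.integral_const_mul]
  have hint : ∫ x in (1:ℝ)..2, (1 - (x ^ 2 / 2 - 9 / 8)) = 23 / 24 := by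
    rw [intervalIntegral.integral_sub (by simp) (Continuous.intervalIntegrable (by fun_prop) _ _),
      intervalIntegral.integral_sub (Continuous.intervalIntegrable (by fun_prop) _ _) (by simp),
      intervalIntegral.integral_div, integral_pow]
    norm_num
  rw [hint]
  have hpi : √(2 * Real.pi) ≤ 251 / 100 := by
    rw [Real.sqrt_le_left (by norm_num)]
    have := Real.pi_lt_d2
    norm_num at this ⊢
    linarith
  have hexp : Real.exp (9/8) ≤ 32 / 10 := by
    have h8 : Real.exp (9/8) ^ 8 = Real.exp 1 ^ 9 := by
      rw [← Real.exp_nat_mul, ← Real.exp_nat_mul]; norm_num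
    have h9 : Real.exp 1 ^ 9 ≤ (32 / 10 : ℝ) ^ 8 :=
      le_trans (pow_le_pow_left₀ (Real.exp_pos _).le Real.exp_one_lt_d9.le 9) (by norm_num)
    rw [← h8] at h9
    exact le_of_pow_le_pow_left₀ (by norm_num) (by norm_num) h9
  have h2 : (100 / 251 : ℝ) ≤ (√(2 * Real.pi))⁻¹ := by
    rw [le_inv_comm₀ (by norm_num) (by positivity)]
    norm_num at hpi ⊢
    linarith
  have h3 : (10 / 32 : ℝ) ≤ Real.exp (-(9/8)) := by
    rw [Real.exp_neg, le_inv_comm₀ (by norm_num) (Real.exp_pos _)]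
    norm_num at hexp ⊢
    linarith
  have h4 : (100 / 251 : ℝ) * (10 / 32) ≤ (√(2 * Real.pi))⁻¹ * Real.exp (-(9/8)) :=
    mul_le_mul h2 h3 (by norm_num) (by positivity)
  linarith

/-- A centred Gaussian exceeds any threshold of at most one standard deviation with probability at
least `0.11`, also in the degenerate case. -/
theorem gaussianReal_real_Ici_ge {v : NNReal} {s : ℝ} (hs : s ^ 2 ≤ v) :
    (11 / 100 : ℝ) ≤ (gaussianReal 0 v).real (Set.Ici s) := by
  have h := gaussianReal_map_const_mul (μ := 0) (v := 1) (√(v : ℝ))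
  have hv : NNReal.mk (√(v : ℝ) ^ 2) (sq_nonneg _) * 1 = v := by
    ext; simp
  rw [mul_zero, hv] at h
  rw [← h, map_measureReal_apply (by fun_prop) measurableSet_Ici]
  refine gaussianReal_zero_one_Ici_one.trans (measureReal_mono ?_)
  intro x hx
  simp only [Set.mem_preimage, Set.mem_Ici] at hx ⊢
  calc s ≤ √(v : ℝ) := Real.le_sqrt_of_sq_le hs
    _ ≤ √(v : ℝ) * x := le_mul_of_one_le_right (Real.sqrt_nonneg _) hx

/-- The expected excess of a centred Gaussian of standard deviation at most `τ` over `τ u`. -/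
theorem integral_gaussianReal_excess_le {v : NNReal} {τ u : ℝ} (hτ : 0 ≤ τ) (hv : (v : ℝ) ≤ τ ^ 2)
    (hu : 0 < u) :
    ∫ x, max (|x| - τ * u) 0 ∂(gaussianReal 0 v) ≤ 2 * τ / u * Real.exp (-(u ^ 2 / 2)) := by
  rcases hτ.eq_or_lt with rfl | hτ
  · have : v = 0 := by
      have : (v : ℝ) ≤ 0 := by simpa using hv
      exact_mod_cast le_antisymm this v.2
    subst this
    simp [gaussianReal_zero_var]
  set b := u / τ with hb
  have hbτ : b * τ = u := by rw [hb]; field_simp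
  have hbpos : 0 < b := by positivity
  have hint : ∀ t : ℝ, Integrable (fun x => Real.exp (t * x)) (gaussianReal 0 v) :=
    fun t => integrable_exp_mul_gaussianReal t
  have hm : ∀ t : ℝ, ∫ x, Real.exp (t * x) ∂(gaussianReal 0 v) = Real.exp (v * t ^ 2 / 2) := by
    intro t
    have := congrFun (mgf_fun_id_gaussianReal (μ := 0) (v := v)) t
    simpa [mgf] using this
  have hpt : ∀ x : ℝ, max (|x| - τ * u) 0 ≤
      (1 / b * Real.exp (-(u ^ 2))) * (Real.exp (b * x) + Real.exp (-b * x)) := by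
    intro x
    have h1 : Real.exp (b * |x|) ≤ Real.exp (b * x) + Real.exp (-b * x) := by
      rcases abs_cases x with ⟨h, _⟩ | ⟨h, _⟩
      · rw [h]; linarith [Real.exp_pos (-b * x)]
      · rw [h]; rw [mul_neg, ← neg_mul]; linarith [Real.exp_pos (b * x)]
    refine le_trans ?_ (mul_le_mul_of_nonneg_left h1 (by positivity))
    rw [mul_assoc, ← Real.exp_add]
    refine max_le ?_ (by positivity)
    have h2 := Real.add_one_le_exp (-(u ^ 2) + b * |x|)
    have h3 : |x| - τ * u = 1 / b * (-(u ^ 2) + b * |x|) := by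
      rw [mul_add, ← mul_assoc, one_div, inv_mul_cancel₀ hbpos.ne', one_mul, hb]
      field_simp
      ring
    rw [h3]
    exact mul_le_mul_of_nonneg_left (by linarith) (by positivity)
  calc ∫ x, max (|x| - τ * u) 0 ∂(gaussianReal 0 v)
      ≤ ∫ x, (1 / b * Real.exp (-(u ^ 2))) * (Real.exp (b * x) + Real.exp (-b * x))
          ∂(gaussianReal 0 v) := by
        refine integral_mono_of_nonneg (Filter.Eventually.of_forall fun x => le_max_right _ _)
          (((hint _).add (hint _)).const_mul _) (Filter.Eventually.of_forall hpt)
    _ = (1 / b * Real.exp (-(u ^ 2))) * (2 * Real.exp (v * b ^ 2 / 2)) := by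
        rw [integral_const_mul, integral_add (hint _) (hint _), hm, hm]; ring_nf
    _ ≤ (1 / b * Real.exp (-(u ^ 2))) * (2 * Real.exp (u ^ 2 / 2)) := by
        have : v * b ^ 2 ≤ u ^ 2 := by
          rw [← hbτ, mul_pow, mul_comm (b ^ 2)]
          exact mul_le_mul_of_nonneg_right hv (sq_nonneg _)
        gcongr
    _ = 2 * τ / u * Real.exp (-(u ^ 2 / 2)) := by
        have : Real.exp (-(u ^ 2)) * Real.exp (u ^ 2 / 2) = Real.exp (-(u ^ 2 / 2)) := by
          rw [← Real.exp_add]; ring_nf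
        rw [← this, hb]
        field_simp

/-- A linear functional of independent centred Gaussian vectors with common covariance `Σ` is a
centred Gaussian, and its variance is the sum of the values of the quadratic form of `Σ`. -/
theorem map_sum_inner_pi_multivariateGaussian {N d : ℕ} {A : Matrix (Fin d) (Fin d) ℝ}
    (hA : A.PosSemidef) (w : Fin N → Feat d) :
    (Measure.pi fun _ : Fin N => multivariateGaussian (0 : Feat d) A).map
        (fun e => ∑ i, inner ℝ (w i) (e i)) =
      gaussianReal 0 (∑ i, (w i).ofLp ⬝ᵥ A.mulVec (w i)).toNNReal := by
  have hpos : 0 ≤ ∑ i, (w i).ofLp ⬝ᵥ A.mulVec (w i) :=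
    Finset.sum_nonneg fun i _ => by simpa using hA.dotProduct_mulVec_nonneg (w i).ofLp
  have hmeas : Measurable (fun e : Fin N → Feat d => ∑ i, inner ℝ (w i) (e i)) := by fun_prop
  have := Measure.isProbabilityMeasure_map (μ := Measure.pi fun _ : Fin N =>
    multivariateGaussian (0 : Feat d) A) hmeas.aemeasurable
  apply Measure.ext_of_charFun
  ext t
  rw [charFun_gaussianReal, charFun_apply, integral_map hmeas.aemeasurable (by fun_prop)]
  have h1 : ∀ e : Fin N → Feat d, Complex.exp ((inner ℝ (∑ i, inner ℝ (w i) (e i)) t : ℝ) * Complex.I)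
      = ∏ i, Complex.exp ((inner ℝ (e i) (t • w i) : ℝ) * Complex.I) := by
    intro e
    rw [← Complex.exp_sum, ← Finset.sum_mul, ← Complex.ofReal_sum]
    congr 3
    simp only [inner_smul_right, real_inner_comm (w _)]
    rw [← Finset.mul_sum]
    simp
  simp_rw [h1]
  rw [integral_fintype_prod_eq_prod (f := fun i (e : Feat d) =>
    Complex.exp ((inner ℝ e (t • w i) : ℝ) * Complex.I))]
  simp_rw [← charFun_apply, charFun_multivariateGaussian hA]
  rw [← Complex.exp_sum]
  congr 1
  rw [Real.coe_toNNReal _ hpos]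
  push_cast
  simp only [inner_zero_right, Complex.ofReal_zero, zero_mul, zero_sub, mul_zero, Finset.sum_neg_distrib,
    Finset.sum_mul, Finset.sum_div]
  congr 1
  refine Finset.sum_congr rfl fun i _ => ?_
  simp only [WithLp.ofLp_smul, Matrix.mulVec_smul, dotProduct_smul, smul_dotProduct, smul_eq_mul]
  push_cast
  ring

/-! ### Quadratic forms, determinants and the method of mixtures -/

theorem real_inner_eq_dotProduct {d : ℕ} (x y : Feat d) : inner ℝ x y = x.ofLp ⬝ᵥ y.ofLp := by
  rw [EuclideanSpace.inner_eq_star_dotProduct, dotProduct_comm]; simp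

/-- The squared norm `xᵀ V⁻¹ x` of `x` dual to the norm given by the positive definite matrix
`V`. -/
noncomputable def invQuad {d : ℕ} (V : Matrix (Fin d) (Fin d) ℝ) (x : Feat d) : ℝ :=
  x.ofLp ⬝ᵥ V⁻¹.mulVec x.ofLp

/-- The quadratic form `wᵀ V w`. -/
def quad {d : ℕ} (V : Matrix (Fin d) (Fin d) ℝ) (w : Feat d) : ℝ :=
  w.ofLp ⬝ᵥ V.mulVec w.ofLp

section invQuad
variable {d : ℕ} {V H : Matrix (Fin d) (Fin d) ℝ}

theorem Matrix.PosDef.invQuad_nonneg (hV : V.PosDef) (x : Feat d) : 0 ≤ invQuad V x := by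
  simpa [invQuad] using hV.inv.posSemidef.dotProduct_mulVec_nonneg x.ofLp

theorem Matrix.PosSemidef.quad_nonneg (hV : V.PosSemidef) (w : Feat d) : 0 ≤ quad V w := by
  simpa [quad] using hV.dotProduct_mulVec_nonneg w.ofLp

theorem Matrix.IsHermitian.dotProduct_mulVec_comm (hV : V.IsHermitian) (a b : Fin d → ℝ) :
    a ⬝ᵥ V.mulVec b = b ⬝ᵥ V.mulVec a := by
  have h : V.transpose = V := by
    rw [← Matrix.conjTranspose_eq_transpose_of_trivial]; exact hV
  rw [Matrix.dotProduct_mulVec, ← Matrix.mulVec_transpose, h, dotProduct_comm]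

/-- `xᵀ V⁻¹ x` is the maximum of `2 xᵀ w - wᵀ V w`, attained at `w = V⁻¹ x`. -/
theorem Matrix.PosDef.two_mul_inner_sub_quad_le (hV : V.PosDef) (x w : Feat d) :
    2 * inner ℝ x w - quad V w ≤ invQuad V x := by
  have hdet : IsUnit V.det := (Matrix.isUnit_iff_isUnit_det V).1 hV.isUnit
  set u : Feat d := WithLp.toLp 2 (V⁻¹.mulVec x.ofLp) with hu
  have hVu : V.mulVec u.ofLp = x.ofLp := by
    simp [hu, Matrix.mulVec_mulVec, Matrix.mul_nonsing_inv _ hdet]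
  have h := hV.posSemidef.quad_nonneg (w - u)
  have e1 : quad V (w - u) = quad V w - 2 * (x.ofLp ⬝ᵥ w.ofLp) + x.ofLp ⬝ᵥ u.ofLp := by
    simp only [quad, WithLp.ofLp_sub, Matrix.mulVec_sub, dotProduct_sub, sub_dotProduct]
    rw [hV.1.dotProduct_mulVec_comm u.ofLp w.ofLp, hVu, dotProduct_comm w.ofLp x.ofLp,
      dotProduct_comm u.ofLp x.ofLp]
    ring
  have e2 : invQuad V x = x.ofLp ⬝ᵥ u.ofLp := rfl
  rw [real_inner_eq_dotProduct, e2]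
  linarith

theorem Matrix.PosDef.exists_invQuad_eq (hV : V.PosDef) (x : Feat d) :
    ∃ w : Feat d, V.mulVec w.ofLp = x.ofLp ∧ inner ℝ x w = invQuad V x ∧ quad V w = invQuad V x := by
  have hdet : IsUnit V.det := (Matrix.isUnit_iff_isUnit_det V).1 hV.isUnit
  set u : Feat d := WithLp.toLp 2 (V⁻¹.mulVec x.ofLp) with hu
  have hVu : V.mulVec u.ofLp = x.ofLp := by
    simp [hu, Matrix.mulVec_mulVec, Matrix.mul_nonsing_inv _ hdet]
  refine ⟨u, hVu, ?_, ?_⟩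
  · rw [real_inner_eq_dotProduct]; rfl
  · rw [quad, hVu, dotProduct_comm]; rfl

theorem quad_smul (V : Matrix (Fin d) (Fin d) ℝ) (c : ℝ) (w : Feat d) :
    quad V (c • w) = c ^ 2 * quad V w := by
  simp only [quad, WithLp.ofLp_smul, Matrix.mulVec_smul, dotProduct_smul, smul_dotProduct, smul_eq_mul]
  ring

/-- Cauchy-Schwarz for the norm of `V` and its dual. -/
theorem Matrix.PosDef.inner_sq_le (hV : V.PosDef) (x w : Feat d) :
    inner ℝ x w ^ 2 ≤ invQuad V x * quad V w := by
  have h : ∀ s : ℝ, 0 ≤ quad V w * (s * s) + (-2 * inner ℝ x w) * s + invQuad V x := by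
    intro s
    have := hV.two_mul_inner_sub_quad_le x (s • w)
    rw [quad_smul, inner_smul_right] at this
    nlinarith
  have := discrim_le_zero h
  rw [discrim] at this
  nlinarith

theorem Matrix.PosDef.abs_inner_le (hV : V.PosDef) (x w : Feat d) :
    |inner ℝ x w| ≤ √(invQuad V x) * √(quad V w) := by
  rw [← Real.sqrt_mul (hV.invQuad_nonneg x)]
  exact Real.abs_le_sqrt (hV.inner_sq_le x w)

/-- Inversion reverses the Loewner order, up to a constant factor. -/
theorem invQuad_le_mul_invQuad (hV : V.PosDef) (hH : H.PosDef) {L : ℝ} (hL : 0 < L)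
    (h : ∀ w, quad H w ≤ L * quad V w) (x : Feat d) : invQuad V x ≤ L * invQuad H x := by
  obtain ⟨u, -, hu1, hu2⟩ := hV.exists_invQuad_eq x
  have h1 := hH.two_mul_inner_sub_quad_le x (L⁻¹ • u)
  rw [quad_smul, inner_smul_right, hu1] at h1
  have h2 := h u
  rw [hu2] at h2
  have h3 : L⁻¹ ^ 2 * quad H u ≤ L⁻¹ * invQuad V x := by
    calc L⁻¹ ^ 2 * quad H u ≤ L⁻¹ ^ 2 * (L * invQuad V x) := by gcongr
      _ = L⁻¹ * invQuad V x := by field_simp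
  have h4 : L⁻¹ * invQuad V x ≤ invQuad H x := by linarith
  rwa [inv_mul_le_iff₀ hL] at h4

theorem one_add_trace_le_det_one_add {n : ℕ} {A : Matrix (Fin n) (Fin n) ℝ} (hA : A.PosSemidef) :
    1 + A.trace ≤ (1 + A).det := by
  have h1 : (1 + A).det = ∏ i, (1 + hA.1.eigenvalues i) := by
    have h2 := Matrix.eval_charpoly A (-1)
    rw [hA.1.charpoly_eq, Polynomial.eval_prod] at h2
    have h3 : (Matrix.scalar (Fin n)) (-1 : ℝ) - A = -(1 + A) := by
      ext i j
      by_cases h : i = j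
      · subst h; simp; ring
      · simp [h]
    rw [h3, Matrix.det_neg] at h2
    have h4 : ∏ i, Polynomial.eval (-1 : ℝ) (Polynomial.X - Polynomial.C (hA.1.eigenvalues i : ℝ)) =
        (-1) ^ n * ∏ i, (1 + hA.1.eigenvalues i) := by
      have : ∀ i, Polynomial.eval (-1 : ℝ) (Polynomial.X - Polynomial.C (hA.1.eigenvalues i : ℝ))
          = (-1) * (1 + hA.1.eigenvalues i) := by
        intro i; simp; ring
      simp_rw [this]
      rw [Finset.prod_mul_distrib]; simp
    have h5 : ((-1 : ℝ) ^ n) * (1 + A).det = (-1) ^ n * ∏ i, (1 + hA.1.eigenvalues i) := by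
      rw [← h4]; simpa using h2.symm
    exact mul_left_cancel₀ (pow_ne_zero _ (by norm_num)) h5
  have h6 : A.trace = ∑ i, hA.1.eigenvalues i := by simpa using hA.1.trace_eq_sum_eigenvalues
  rw [h1, h6]
  have key : ∀ s : Finset (Fin n), 1 + ∑ i ∈ s, hA.1.eigenvalues i ≤ ∏ i ∈ s, (1 + hA.1.eigenvalues i) := by
    intro s
    induction s using Finset.induction_on with
    | empty => simp
    | insert a s ha ih =>
      rw [Finset.sum_insert ha, Finset.prod_insert ha]
      have h7 := hA.eigenvalues_nonneg a
      have h8 : 0 ≤ ∑ i ∈ s, hA.1.eigenvalues i := Finset.sum_nonneg fun i _ => hA.eigenvalues_nonneg i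
      nlinarith [mul_le_mul_of_nonneg_left ih (by linarith : 0 ≤ 1 + hA.1.eigenvalues a), mul_nonneg h7 h8]
  exact key Finset.univ

/-- Adding rank-one matrices multiplies the determinant by at least one plus the sum of the squared
dual norms. -/
theorem det_mul_one_add_le_det_add (hV : V.PosDef) {N : ℕ} (x : Fin N → Feat d) :
    V.det * (1 + ∑ i, invQuad V (x i)) ≤
      (V + ∑ i, Matrix.vecMulVec (x i).ofLp (x i).ofLp).det := by
  have hdet : IsUnit V.det := (Matrix.isUnit_iff_isUnit_det V).1 hV.isUnit
  let X : Matrix (Fin d) (Fin N) ℝ := Matrix.of fun k i => x i k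
  have h1 : ∑ i, Matrix.vecMulVec (x i).ofLp (x i).ofLp = X * X.transpose := by
    ext a b
    simp [X, Matrix.sum_apply, Matrix.vecMulVec_apply, Matrix.mul_apply]
  have h2 : (X.transpose * V⁻¹ * X).PosSemidef := by
    have := hV.inv.posSemidef.conjTranspose_mul_mul_same X
    rwa [Matrix.conjTranspose_eq_transpose_of_trivial] at this
  have h3 : (X.transpose * V⁻¹ * X).trace = ∑ i, invQuad V (x i) := by
    refine Finset.sum_congr rfl fun i _ => ?_
    rw [Matrix.diag_apply, Matrix.mul_assoc, Matrix.mul_apply_eq_vecMul]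
    simp only [invQuad, Matrix.mul_apply, dotProduct, Matrix.mulVec, Matrix.vecMul, X,
      Matrix.transpose_apply, Matrix.of_apply]
  rw [h1, Matrix.det_add_mul X X.transpose hdet, ← h3]
  exact mul_le_mul_of_nonneg_left (one_add_trace_le_det_one_add h2) hV.det_pos.le

/-- The inequality of arithmetic and geometric means in multiplicative form. -/
theorem prod_le_pow_sum_div (hd : 0 < d) (z : Fin d → ℝ) (hz : ∀ i, 0 ≤ z i) :
    ∏ i, z i ≤ ((∑ i, z i) / d) ^ d := by
  have hd' : (0 : ℝ) < d := by exact_mod_cast hd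
  have h := Real.geom_mean_le_arith_mean Finset.univ (fun _ : Fin d => (1 : ℝ)) z (by simp)
    (by simpa using hd) (fun i _ => hz i)
  simp only [Real.rpow_one, Finset.sum_const, Finset.card_univ, Fintype.card_fin, nsmul_eq_mul,
    mul_one, one_mul] at h
  have h0 : 0 ≤ ∏ i, z i := Finset.prod_nonneg fun i _ => hz i
  calc ∏ i, z i = ((∏ i, z i) ^ (d : ℝ)⁻¹) ^ d := (Real.rpow_inv_natCast_pow h0 hd.ne').symm
    _ ≤ _ := pow_le_pow_left₀ (Real.rpow_nonneg h0 _) h d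

theorem det_le_pow_trace_div (hd : 0 < d) (hV : V.PosSemidef) : V.det ≤ (V.trace / d) ^ d := by
  have h1 : V.det = ∏ i, hV.1.eigenvalues i := by simpa using hV.1.det_eq_prod_eigenvalues
  have h2 : V.trace = ∑ i, hV.1.eigenvalues i := by simpa using hV.1.trace_eq_sum_eigenvalues
  rw [h1, h2]
  exact prod_le_pow_sum_div hd _ hV.eigenvalues_nonneg

end invQuad

section mixture

theorem integral_exp_sub_sq_gaussianReal (b : ℝ) {e : ℝ} (he : 0 ≤ e) :
    ∫ x, Real.exp (b * x - e * x ^ 2 / 2) ∂(gaussianReal 0 1) =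
      (√(1 + e))⁻¹ * Real.exp (b ^ 2 / (2 * (1 + e))) := by
  have h1e : 0 < 1 + e := by linarith
  rw [integral_gaussianReal_eq_integral_smul one_ne_zero]
  let v : NNReal := ⟨(1 + e)⁻¹, by positivity⟩
  have hv : v ≠ 0 := by
    rw [← NNReal.coe_ne_zero]; exact (inv_pos.2 h1e).ne'
  have hpt : ∀ x : ℝ, gaussianPDFReal 0 1 x • Real.exp (b * x - e * x ^ 2 / 2) =
      ((√(1 + e))⁻¹ * Real.exp (b ^ 2 / (2 * (1 + e)))) * gaussianPDFReal (b / (1 + e)) v x := by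
    intro x
    have hvv : (v : ℝ) = (1 + e)⁻¹ := rfl
    rw [gaussianPDFReal_def, gaussianPDFReal_def, hvv]
    simp only [NNReal.coe_one, mul_one, sub_zero, smul_eq_mul]
    have h2 : √(2 * Real.pi * (1 + e)⁻¹) = √(2 * Real.pi) * (√(1 + e))⁻¹ := by
      rw [Real.sqrt_mul (by positivity), Real.sqrt_inv]
    have h3 : Real.exp (-x ^ 2 / 2) * Real.exp (b * x - e * x ^ 2 / 2) =
        Real.exp (b ^ 2 / (2 * (1 + e))) *
          Real.exp (-(x - b / (1 + e)) ^ 2 / (2 * (1 + e)⁻¹)) := by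
      rw [← Real.exp_add, ← Real.exp_add]
      congr 1
      field_simp
      ring
    have h4 : 0 < √(1 + e) := Real.sqrt_pos.2 h1e
    rw [h2, mul_assoc, h3, mul_inv, inv_inv]
    field_simp
  simp_rw [hpt]
  rw [integral_const_mul, integral_gaussianPDFReal_eq_one _ hv, mul_one]

variable {d : ℕ} {G : Matrix (Fin d) (Fin d) ℝ}

/-- The method of mixtures: averaging the exponential of a quadratic function over a standard
Gaussian direction. The average factorizes in an eigenbasis of `G`, and the resulting determinant
is bounded through the trace. -/
theorem exp_invQuad_le_lintegral_stdGaussian (hd : 0 < d) (hG : G.PosSemidef) {γ σ tr : ℝ} (hγ : 0 < γ)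
    (hσ : 0 < σ) (htr : G.trace ≤ tr) (S : Feat d) :
    ENNReal.ofReal (Real.exp (invQuad (γ • (1 : Matrix (Fin d) (Fin d) ℝ) + G) S / (2 * σ ^ 2)
        - d / 2 * Real.log (1 + tr / (d * γ)))) ≤
      ∫⁻ g : Feat d, ENNReal.ofReal (Real.exp (inner ℝ S g / (σ * √γ) - quad G g / (2 * γ)))
        ∂(stdGaussian (Feat d)) := by
  set b := hG.1.eigenvectorBasis with hb
  set e := hG.1.eigenvalues with he
  have he0 : ∀ i, 0 ≤ e i := hG.eigenvalues_nonneg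
  have hV : (γ • (1 : Matrix (Fin d) (Fin d) ℝ) + G).PosDef :=
    (Matrix.PosDef.one.smul hγ).add_posSemidef hG
  have hGb : ∀ i, G.mulVec (b i).ofLp = e i • (b i).ofLp := fun i => by
    simpa using hG.1.mulVec_eigenvectorBasis i
  have hsum : ∀ (x : Fin d → ℝ), G.mulVec (∑ i, x i • b i).ofLp = (∑ i, (e i * x i) • b i).ofLp := by
    intro x
    simp only [WithLp.ofLp_sum, WithLp.ofLp_smul, Matrix.mulVec_sum, Matrix.mulVec_smul, hGb, smul_smul]
    simp only [mul_comm]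
  -- the functional in coordinates
  have hinner : ∀ (x : Fin d → ℝ), inner ℝ S (∑ i, x i • b i) = ∑ i, inner ℝ S (b i) * x i := by
    intro x
    rw [inner_sum]
    exact Finset.sum_congr rfl fun i _ => by rw [inner_smul_right, mul_comm]
  have hbb : ∀ (x y : Fin d → ℝ), inner ℝ (∑ i, x i • b i) (∑ i, y i • b i) = ∑ i, x i * y i := by
    intro x y
    rw [b.orthonormal.inner_sum]
    simp
  have hquad : ∀ (x : Fin d → ℝ), quad G (∑ i, x i • b i) = ∑ i, e i * x i ^ 2 := by
    intro x
    rw [quad, hsum, ← real_inner_eq_dotProduct, hbb]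
    exact Finset.sum_congr rfl fun i _ => by ring
  have hinv : invQuad (γ • (1 : Matrix (Fin d) (Fin d) ℝ) + G) S =
      ∑ i, inner ℝ S (b i) ^ 2 / (γ + e i) := by
    obtain ⟨u, hu, hu1, -⟩ := hV.exists_invQuad_eq S
    have hu2 : ∀ i, (γ + e i) * inner ℝ u (b i) = inner ℝ S (b i) := by
      intro i
      rw [real_inner_eq_dotProduct S, ← hu, dotProduct_comm, hV.1.dotProduct_mulVec_comm,
        Matrix.add_mulVec, hGb, Matrix.smul_mulVec, Matrix.one_mulVec, ← add_smul,
        dotProduct_smul, ← real_inner_eq_dotProduct]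
      rfl
    rw [← hu1, ← b.sum_inner_mul_inner S u]
    refine Finset.sum_congr rfl fun i _ => ?_
    have h0 : 0 < γ + e i := by linarith [he0 i]
    rw [real_inner_comm u, ← hu2 i]
    field_simp
  have hint : ∀ i, Integrable (fun x : ℝ => Real.exp (inner ℝ S (b i) / (σ * √γ) * x - (e i / γ) * x ^ 2 / 2))
      (gaussianReal 0 1) := by
    intro i
    refine (integrable_exp_mul_gaussianReal (inner ℝ S (b i) / (σ * √γ))).mono' (by fun_prop)
      (Filter.Eventually.of_forall fun x => ?_)
    rw [Real.norm_eq_abs, abs_of_pos (Real.exp_pos _)]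
    refine Real.exp_le_exp.2 ?_
    have : 0 ≤ (e i / γ) * x ^ 2 / 2 := by have := he0 i; positivity
    linarith
  have hprod : ∀ x : Fin d → ℝ, Real.exp (inner ℝ S (∑ i, x i • b i) / (σ * √γ)
      - quad G (∑ i, x i • b i) / (2 * γ)) =
      ∏ i, Real.exp (inner ℝ S (b i) / (σ * √γ) * x i - (e i / γ) * x i ^ 2 / 2) := by
    intro x
    rw [← Real.exp_sum, hinner, hquad, Finset.sum_div, Finset.sum_div, ← Finset.sum_sub_distrib]
    congr 1
    refine Finset.sum_congr rfl fun i _ => ?_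
    field_simp
  rw [stdGaussian_eq_map_pi_orthonormalBasis b, lintegral_map (by unfold quad; fun_prop) (by fun_prop)]
  simp_rw [hprod]
  rw [← ofReal_integral_eq_lintegral_ofReal (Integrable.fintype_prod hint)
    (Filter.Eventually.of_forall fun x => Finset.prod_nonneg fun i _ => (Real.exp_pos _).le)]
  refine ENNReal.ofReal_le_ofReal ?_
  rw [integral_fintype_prod_eq_prod (f := fun i (x : ℝ) =>
    Real.exp (inner ℝ S (b i) / (σ * √γ) * x - (e i / γ) * x ^ 2 / 2))]
  have hei : ∀ i, 0 ≤ e i / γ := fun i => div_nonneg (he0 i) hγ.le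
  simp_rw [fun i => integral_exp_sub_sq_gaussianReal (inner ℝ S (b i) / (σ * √γ)) (hei i)]
  rw [Finset.prod_mul_distrib, ← Real.exp_sum]
  have h1 : ∑ i, (inner ℝ S (b i) / (σ * √γ)) ^ 2 / (2 * (1 + e i / γ)) =
      invQuad (γ • (1 : Matrix (Fin d) (Fin d) ℝ) + G) S / (2 * σ ^ 2) := by
    rw [hinv, Finset.sum_div]
    refine Finset.sum_congr rfl fun i _ => ?_
    have h0 : 0 < γ + e i := by linarith [he0 i]
    rw [div_pow, mul_pow, Real.sq_sqrt hγ.le]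
    field_simp
  rw [h1, sub_eq_add_neg, Real.exp_add, mul_comm]
  refine mul_le_mul_of_nonneg_right ?_ (Real.exp_pos _).le
  rw [Finset.prod_inv_distrib, Real.exp_neg]
  have hpos : 0 < ∏ i, √(1 + e i / γ) := Finset.prod_pos fun i _ => Real.sqrt_pos.2 (by linarith [hei i])
  refine inv_anti₀ hpos ?_
  rw [← Real.sqrt_prod _ (fun i _ => by linarith [hei i])]
  have hd' : (0 : ℝ) < d := by exact_mod_cast hd
  have htrace : G.trace = ∑ i, e i := by simpa using hG.1.trace_eq_sum_eigenvalues
  have htr0 : 0 ≤ G.trace := hG.trace_nonneg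
  have hbase : 0 < 1 + tr / (d * γ) := by
    have : 0 ≤ tr / (d * γ) := div_nonneg (htr0.trans htr) (by positivity)
    linarith
  have h2 : ∏ i, (1 + e i / γ) ≤ (1 + tr / (d * γ)) ^ d := by
    refine (prod_le_pow_sum_div hd _ fun i => by linarith [hei i]).trans ?_
    refine pow_le_pow_left₀ (div_nonneg (Finset.sum_nonneg fun i _ => by linarith [hei i]) hd'.le) ?_ d
    rw [Finset.sum_add_distrib, ← Finset.sum_div, ← htrace]
    simp only [Finset.sum_const, Finset.card_univ, Fintype.card_fin, nsmul_eq_mul, mul_one]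
    rw [add_div, div_self hd'.ne', div_div, mul_comm γ]
    gcongr
  refine (Real.sqrt_le_sqrt h2).trans (le_of_eq ?_)
  rw [Real.sqrt_eq_rpow, Real.rpow_def_of_pos (pow_pos hbase d), Real.log_pow]
  congr 1
  ring

end mixture

/-! ### The self-normalized bound for the score -/

namespace CAB
variable {N K d T : ℕ} (I : CAB N K d T)

/-- The feature `x_s(i) = φ_s(i, π_s(i))` of user `i` in round `s`. -/
def feat (s : ℕ) (πs : ℕ → Alloc N K) (i : Fin N) : Feat d := I.φ s i (πs s i)

/-- The Gram matrix `∑_{s<t} ∑_i x_s(i) x_s(i)ᵀ` of the features of the first `t` rounds. -/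
noncomputable def gram (t : ℕ) (πs : ℕ → Alloc N K) : Matrix (Fin d) (Fin d) ℝ :=
  ∑ s ∈ Finset.range t, ∑ i : Fin N,
    Matrix.vecMulVec (I.feat s πs i).ofLp (I.feat s πs i).ofLp

/-- The noise-weighted sum `∑_{s<t} ∑_i (y_s(i) - μ(x_s(i)ᵀ θ*)) x_s(i)` of the features. -/
noncomputable def score (t : ℕ) (πs : ℕ → Alloc N K) (ys : ℕ → Fin N → ℝ) : Feat d :=
  ∑ s ∈ Finset.range t, ∑ i : Fin N,
    (ys s i - I.mean (inner ℝ (I.feat s πs i) I.θs)) • I.feat s πs i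

theorem quad_vecMulVec (x w : Feat d) :
    quad (Matrix.vecMulVec x.ofLp x.ofLp) w = inner ℝ x w ^ 2 := by
  rw [quad, Matrix.vecMulVec_mulVec, real_inner_eq_dotProduct]
  rw [dotProduct_smul, dotProduct_comm w.ofLp, MulOpposite.smul_eq_mul_unop, MulOpposite.unop_op, sq]

theorem _root_.quad_add (A B : Matrix (Fin d) (Fin d) ℝ) (w : Feat d) :
    quad (A + B) w = quad A w + quad B w := by
  simp [quad, Matrix.add_mulVec]

theorem _root_.quad_smul_left (c : ℝ) (A : Matrix (Fin d) (Fin d) ℝ) (w : Feat d) :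
    quad (c • A) w = c * quad A w := by
  simp [quad, Matrix.smul_mulVec]

theorem _root_.quad_one (w : Feat d) : quad (1 : Matrix (Fin d) (Fin d) ℝ) w = ‖w‖ ^ 2 := by
  rw [quad, Matrix.one_mulVec, ← real_inner_eq_dotProduct, real_inner_self_eq_norm_sq]

theorem _root_.quad_sum {ι : Type*} (s : Finset ι) (A : ι → Matrix (Fin d) (Fin d) ℝ) (w : Feat d) :
    quad (∑ i ∈ s, A i) w = ∑ i ∈ s, quad (A i) w := by
  simp [quad, Matrix.sum_mulVec, dotProduct_sum]

theorem quad_gram (t : ℕ) (πs : ℕ → Alloc N K) (w : Feat d) :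
    quad (I.gram t πs) w =
      ∑ s ∈ Finset.range t, ∑ i : Fin N, inner ℝ (I.feat s πs i) w ^ 2 := by
  simp only [gram, quad_sum, quad_vecMulVec]

theorem posSemidef_gram (t : ℕ) (πs : ℕ → Alloc N K) : (I.gram t πs).PosSemidef := by
  refine Matrix.posSemidef_sum _ fun s _ => Matrix.posSemidef_sum _ fun i _ => ?_
  simpa using Matrix.posSemidef_vecMulVec_self_star (I.feat s πs i).ofLp

theorem posDef_smul_one_add_gram {γ : ℝ} (hγ : 0 < γ) (t : ℕ) (πs : ℕ → Alloc N K) :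
    (γ • (1 : Matrix (Fin d) (Fin d) ℝ) + I.gram t πs).PosDef :=
  (Matrix.PosDef.one.smul hγ).add_posSemidef (I.posSemidef_gram t πs)

theorem norm_feat_le {s : ℕ} (hs : s < T) (πs : ℕ → Alloc N K) (i : Fin N) :
    ‖I.feat s πs i‖ ≤ 1 := I.norm_φ_le s hs i _

theorem trace_gram_le {t : ℕ} (ht : t ≤ T) (πs : ℕ → Alloc N K) :
    (I.gram t πs).trace ≤ N * t := by
  rw [gram, Matrix.trace_sum]
  have : ∀ s ∈ Finset.range t, (∑ i : Fin N,
      Matrix.vecMulVec (I.feat s πs i).ofLp (I.feat s πs i).ofLp).trace ≤ N := by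
    intro s hs
    rw [Matrix.trace_sum]
    have h1 : ∀ i : Fin N, (Matrix.vecMulVec (I.feat s πs i).ofLp (I.feat s πs i).ofLp).trace ≤ 1 := by
      intro i
      rw [Matrix.trace_vecMulVec, ← real_inner_eq_dotProduct, real_inner_self_eq_norm_sq]
      exact pow_le_one₀ (norm_nonneg _) (I.norm_feat_le ((Finset.mem_range.1 hs).trans_le ht) πs i)
    simpa using Finset.sum_le_sum fun i (_ : i ∈ Finset.univ) => h1 i
  refine (Finset.sum_le_sum this).trans ?_
  simp [mul_comm]

/-- The compensated exponential moment of the feedback of a round, for an arbitrary weighting of the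
users; the feedback of the users is independent. -/
theorem lintegral_exp_pi_glmLaw_le {t : ℕ} (ht : t < T) (ρ : Alloc N K) (b : Fin N → ℝ) :
    ∫⁻ y : Fin N → ℝ, ENNReal.ofReal (Real.exp (∑ i,
        ((y i - I.mean (inner ℝ (I.φ t i (ρ i)) I.θs)) * b i - (I.σ : ℝ) ^ 2 / 2 * b i ^ 2)))
      ∂(Measure.pi fun i : Fin N => glmLaw I.ν I.m (inner ℝ (I.φ t i (ρ i)) I.θs)) ≤ 1 := by
  have hprob : ∀ i : Fin N, IsProbabilityMeasure (glmLaw I.ν I.m (inner ℝ (I.φ t i (ρ i)) I.θs)) :=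
    fun i => I.isProbabilityMeasure_glmLaw _
  have hsub := fun i : Fin N => I.subGaussian t ht i (ρ i)
  have heq : ∀ (i : Fin N) (y : ℝ),
      Real.exp ((y - I.mean (inner ℝ (I.φ t i (ρ i)) I.θs)) * b i - (I.σ : ℝ) ^ 2 / 2 * b i ^ 2) =
      Real.exp (b i * (y - deriv I.m (inner ℝ (I.φ t i (ρ i)) I.θs))) *
        Real.exp (-((I.σ : ℝ) ^ 2 / 2 * b i ^ 2)) := by
    intro i y
    rw [← Real.exp_add]; congr 1; rw [mean]; ring
  have hint : ∀ i : Fin N, Integrable (fun y : ℝ =>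
      Real.exp ((y - I.mean (inner ℝ (I.φ t i (ρ i)) I.θs)) * b i - (I.σ : ℝ) ^ 2 / 2 * b i ^ 2))
      (glmLaw I.ν I.m (inner ℝ (I.φ t i (ρ i)) I.θs)) := by
    intro i
    simp_rw [heq]
    exact ((hsub i).integrable_exp_mul (b i)).mul_const _
  simp_rw [Real.exp_sum]
  rw [← ofReal_integral_eq_lintegral_ofReal (Integrable.fintype_prod hint)
    (Filter.Eventually.of_forall fun x => Finset.prod_nonneg fun i _ => (Real.exp_pos _).le),
    integral_fintype_prod_eq_prod (f := fun i (y : ℝ) =>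
      Real.exp ((y - I.mean (inner ℝ (I.φ t i (ρ i)) I.θs)) * b i - (I.σ : ℝ) ^ 2 / 2 * b i ^ 2))]
  rw [← ENNReal.ofReal_one]
  refine ENNReal.ofReal_le_ofReal (Finset.prod_le_one (fun i _ => integral_nonneg fun y => (Real.exp_pos _).le)
    fun i _ => ?_)
  simp_rw [heq]
  rw [integral_mul_const]
  have h := (hsub i).mgf_le (b i)
  rw [mgf] at h
  refine (mul_le_mul_of_nonneg_right h (Real.exp_pos _).le).trans (le_of_eq ?_)
  rw [← Real.exp_add, Real.exp_eq_one_iff]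
  push_cast
  ring

end CAB

section history
variable {Ω : Type*} {N K : ℕ} {y : ℕ → Ω → Fin N → ℝ} {π : ℕ → Ω → Alloc N K}

theorem measurable_y_history {s t : ℕ} (h : s < t) : Measurable[history y π t] (y s) := by
  refine Measurable.mono (ma := MeasurableSpace.comap (y s) inferInstance)
    (comap_measurable (y s)) ?_ le_rfl
  exact le_trans le_sup_left (le_iSup (fun s : Fin t => MeasurableSpace.comap (y s) inferInstance ⊔
    MeasurableSpace.comap (π s) inferInstance) ⟨s, h⟩)

theorem measurable_π_history {s t : ℕ} (h : s < t) : Measurable[history y π t] (π s) := by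
  refine Measurable.mono (ma := MeasurableSpace.comap (π s) inferInstance)
    (comap_measurable (π s)) ?_ le_rfl
  exact le_trans le_sup_right (le_iSup (fun s : Fin t => MeasurableSpace.comap (y s) inferInstance ⊔
    MeasurableSpace.comap (π s) inferInstance) ⟨s, h⟩)

theorem history_le [mΩ : MeasurableSpace Ω] {t T : ℕ} (ht : t ≤ T) (hy : ∀ s < T, Measurable (y s))
    (hπ : ∀ s < T, Measurable (π s)) : history y π t ≤ mΩ :=
  iSup_le fun s => sup_le (hy s (s.2.trans_le ht)).comap_le (hπ s (s.2.trans_le ht)).comap_le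
end history

namespace CAB
variable {N K d T : ℕ} (I : CAB N K d T) {Ω : Type*} {m : MeasurableSpace Ω}
  {y : ℕ → Ω → Fin N → ℝ} {π : ℕ → Ω → Alloc N K}

theorem measurable_feat {s : ℕ} (h : Measurable[m] (π s)) (i : Fin N) :
    Measurable[m] (fun ω => I.feat s (fun s => π s ω) i) :=
  (measurable_of_finite fun ρ : Alloc N K => I.φ s i (ρ i)).comp h

theorem measurable_score {t : ℕ} (hπ : ∀ s < t, Measurable[m] (π s))
    (hy : ∀ s < t, Measurable[m] (y s)) :
    Measurable[m] (fun ω => I.score t (fun s => π s ω) (fun s => y s ω)) := by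
  refine Finset.measurable_sum _ fun s hs => Finset.measurable_sum _ fun i _ => ?_
  have h1 := I.measurable_feat (hπ s (Finset.mem_range.1 hs)) i
  have h2 := (measurable_pi_apply i).comp (hy s (Finset.mem_range.1 hs))
  have h3 : Measurable[m] fun ω => I.mean (inner ℝ (I.feat s (fun s => π s ω) i) I.θs) :=
    (measurable_of_finite fun ρ : Alloc N K => I.mean (inner ℝ (I.φ s i (ρ i)) I.θs)).comp
      (hπ s (Finset.mem_range.1 hs))
  exact (h2.sub h3).smul h1

theorem measurable_quad_gram {t : ℕ} (hπ : ∀ s < t, Measurable[m] (π s))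
    {E : Type*} [MeasurableSpace E] {u : E → Feat d} (hu : Measurable u) :
    @Measurable (Ω × E) ℝ (@Prod.instMeasurableSpace Ω E m _) _
      (fun p => quad (I.gram t (fun s => π s p.1)) (u p.2)) := by
  simp_rw [CAB.quad_gram]
  refine Finset.measurable_sum _ fun s hs => Finset.measurable_sum _ fun i _ => ?_
  have h1 := (I.measurable_feat (hπ s (Finset.mem_range.1 hs)) i)
  exact ((h1.comp measurable_fst).inner (hu.comp measurable_snd)).pow_const 2

end CAB

namespace CABTSRun
variable {N K d T : ℕ} {I : CAB N K d T} {lam0 a : ℝ} {Ω : Type*} [mΩ : MeasurableSpace Ω]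
  {P : Measure Ω} (R : CABTSRun I lam0 a P)

/-- The `σ`-algebra of the past in round `t`. -/
@[reducible] def past (t : ℕ) : MeasurableSpace Ω := history R.y R.π t

theorem past_le {t : ℕ} (ht : t ≤ T) : R.past t ≤ mΩ :=
  history_le ht R.measurable_y R.measurable_π

/-- The `σ`-algebra of the past in round `t`, together with the allocation of that round. -/
@[reducible] def pastChoice (t : ℕ) : MeasurableSpace Ω :=
  R.past t ⊔ MeasurableSpace.comap (R.π t) inferInstance

variable [IsProbabilityMeasure P]

/-- The exponential supermartingale of the score in a fixed direction. -/
theorem lintegral_exp_score_le (w : Feat d) {t : ℕ} (ht : t ≤ T) :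
    ∫⁻ ω, ENNReal.ofReal (Real.exp (
      inner ℝ (I.score t (fun s => R.π s ω) (fun s => R.y s ω)) w
        - (I.σ : ℝ) ^ 2 / 2 * quad (I.gram t (fun s => R.π s ω)) w)) ∂P ≤ 1 := by
  induction t with
  | zero => simp [CAB.score, CAB.gram, quad]
  | succ t ih =>
    have htT : t < T := ht
    have ih := ih htT.le
    have hm : R.pastChoice t ≤ mΩ := sup_le (R.past_le htT.le) (R.measurable_π t htT).comap_le
    have hπ : ∀ s < t + 1, Measurable[R.pastChoice t] (R.π s) := by
      intro s hs
      rcases Nat.lt_succ_iff_lt_or_eq.1 hs with h | rfl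
      · exact (measurable_π_history h).mono le_sup_left le_rfl
      · exact (comap_measurable (R.π s)).mono le_sup_right le_rfl
    have hy : ∀ s < t, Measurable[R.pastChoice t] (R.y s) := fun s hs =>
      (measurable_y_history hs).mono le_sup_left le_rfl
    have hprob : ∀ ω, IsProbabilityMeasure (Measure.pi fun i : Fin N =>
        glmLaw I.ν I.m (inner ℝ (I.φ t i (R.π t ω i)) I.θs)) := fun ω => by
      have := fun i : Fin N => I.isProbabilityMeasure_glmLaw (inner ℝ (I.φ t i (R.π t ω i)) I.θs)
      infer_instance
    let Φ : Ω → ℝ := fun ω => Real.exp (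
      inner ℝ (I.score t (fun s => R.π s ω) (fun s => R.y s ω)) w
        - (I.σ : ℝ) ^ 2 / 2 * quad (I.gram t (fun s => R.π s ω)) w)
    let g : Ω → (Fin N → ℝ) → ENNReal := fun ω y => ENNReal.ofReal (Φ ω) *
      ENNReal.ofReal (Real.exp (∑ i,
        ((y i - I.mean (inner ℝ (I.φ t i (R.π t ω i)) I.θs)) * inner ℝ (I.φ t i (R.π t ω i)) w
          - (I.σ : ℝ) ^ 2 / 2 * inner ℝ (I.φ t i (R.π t ω i)) w ^ 2)))
    have hΦ : Measurable[R.pastChoice t] Φ := by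
      have h1 := I.measurable_score (fun s hs => hπ s (hs.trans (Nat.lt_succ_self t))) hy
      have h2 := (I.measurable_quad_gram (fun s hs => hπ s (hs.trans (Nat.lt_succ_self t)))
        (u := fun _ : Unit => w) measurable_const).comp (measurable_id.prodMk (measurable_const (a := ())))
      exact Real.measurable_exp.comp ((h1.inner measurable_const).sub (h2.const_mul _))
    have hg : @Measurable (Ω × (Fin N → ℝ)) ENNReal (@Prod.instMeasurableSpace Ω _ (R.pastChoice t) _) _
        (Function.uncurry g) := by
      refine ((ENNReal.measurable_ofReal.comp hΦ).comp measurable_fst).mul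
        (ENNReal.measurable_ofReal.comp (Real.measurable_exp.comp
          (Finset.measurable_sum _ fun i _ => ?_)))
      have h3 : Measurable[R.pastChoice t] fun ω => I.mean (inner ℝ (I.φ t i (R.π t ω i)) I.θs) :=
        (measurable_of_finite fun ρ : Alloc N K => I.mean (inner ℝ (I.φ t i (ρ i)) I.θs)).comp
          (hπ t (Nat.lt_succ_self t))
      have h4 : Measurable[R.pastChoice t] fun ω => inner ℝ (I.φ t i (R.π t ω i)) w :=
        (measurable_of_finite fun ρ : Alloc N K => inner ℝ (I.φ t i (ρ i)) w).comp
          (hπ t (Nat.lt_succ_self t))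
      exact ((((measurable_pi_apply i).comp measurable_snd).sub (h3.comp measurable_fst)).mul
        (h4.comp measurable_fst)).sub (((h4.comp measurable_fst).pow_const 2).const_mul _)
    have hstep : ∀ ω, ENNReal.ofReal (Real.exp (
        inner ℝ (I.score (t + 1) (fun s => R.π s ω) (fun s => R.y s ω)) w
        - (I.σ : ℝ) ^ 2 / 2 * quad (I.gram (t + 1) (fun s => R.π s ω)) w)) = g ω (R.y t ω) := by
      intro ω
      simp only [g, Φ]
      rw [← ENNReal.ofReal_mul (Real.exp_pos _).le, ← Real.exp_add]
      congr 2
      rw [CAB.quad_gram, CAB.quad_gram, CAB.score, CAB.score]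
      simp only [Finset.sum_range_succ, inner_add_left, sum_inner, real_inner_smul_left, CAB.feat,
        Finset.sum_sub_distrib, ← Finset.mul_sum]
      ring
    simp_rw [hstep]
    rw [(R.law_y t htT).lintegral_eq hm (R.measurable_y t htT) hg]
    refine le_trans (lintegral_mono fun ω => ?_) ih
    simp only [g]
    rw [lintegral_const_mul _ (by fun_prop)]
    exact mul_le_of_le_one_right' (I.lintegral_exp_pi_glmLaw_le htT (R.π t ω)
      fun i => inner ℝ (I.φ t i (R.π t ω i)) w)

/-- The self-normalized bound: the squared dual norm of the score has an exponential moment that is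
controlled by the log-determinant of the Gram matrix. -/
theorem lintegral_exp_invQuad_score_le (hd : 0 < d) {γ : ℝ} (hγ : 0 < γ) {t : ℕ} (ht : t ≤ T) :
    ∫⁻ ω, ENNReal.ofReal (Real.exp (
      invQuad (γ • (1 : Matrix (Fin d) (Fin d) ℝ) + I.gram t (fun s => R.π s ω))
          (I.score t (fun s => R.π s ω) (fun s => R.y s ω)) / (2 * (I.σ : ℝ) ^ 2)
        - d / 2 * Real.log (1 + N * t / (d * γ)))) ∂P ≤ 1 := by
  have hσ : (0 : ℝ) < I.σ := I.σ_pos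
  have hπ : ∀ s < t, Measurable (R.π s) := fun s hs => R.measurable_π s (hs.trans_le ht)
  have hy : ∀ s < t, Measurable (R.y s) := fun s hs => R.measurable_y s (hs.trans_le ht)
  have h1 : ∀ ω, _ := fun ω => exp_invQuad_le_lintegral_stdGaussian hd
    (I.posSemidef_gram t fun s => R.π s ω) hγ hσ (I.trace_gram_le ht fun s => R.π s ω)
    (I.score t (fun s => R.π s ω) (fun s => R.y s ω))
  refine (lintegral_mono h1).trans ?_
  have h2 : ∀ (ω : Ω) (g : Feat d),
      inner ℝ (I.score t (fun s => R.π s ω) (fun s => R.y s ω)) g / ((I.σ : ℝ) * √γ)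
        - quad (I.gram t (fun s => R.π s ω)) g / (2 * γ) =
      inner ℝ (I.score t (fun s => R.π s ω) (fun s => R.y s ω)) (((I.σ : ℝ) * √γ)⁻¹ • g)
        - (I.σ : ℝ) ^ 2 / 2 * quad (I.gram t (fun s => R.π s ω)) (((I.σ : ℝ) * √γ)⁻¹ • g) := by
    intro ω g
    rw [quad_smul, inner_smul_right, inv_pow, mul_pow, Real.sq_sqrt hγ.le]
    field_simp
  simp_rw [h2]
  rw [lintegral_lintegral_swap]
  · calc _ ≤ ∫⁻ _ : Feat d, 1 ∂(stdGaussian (Feat d)) :=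
        lintegral_mono fun g => R.lintegral_exp_score_le _ ht
      _ = 1 := by simp
  · refine Measurable.aemeasurable ?_
    have h3 := I.measurable_score hπ hy
    have h4 := I.measurable_quad_gram hπ (u := fun g : Feat d => ((I.σ : ℝ) * √γ)⁻¹ • g) (by fun_prop)
    have h5 : Measurable fun p : Ω × Feat d =>
        inner ℝ (I.score t (fun s => R.π s p.1) (fun s => R.y s p.1)) (((I.σ : ℝ) * √γ)⁻¹ • p.2) :=
      (h3.comp measurable_fst).inner (measurable_snd.const_smul (((I.σ : ℝ) * √γ)⁻¹))
    have h6 := (h5.sub (h4.const_mul ((I.σ : ℝ) ^ 2 / 2))).exp.ennreal_ofReal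
    exact h6

end CABTSRun

/-! ### The mean function of the exponential family -/

namespace CAB
variable {N K d T : ℕ} (I : CAB N K d T)

theorem lintegral_exp_sub_eq_one (z : ℝ) :
    ∫⁻ y, ENNReal.ofReal (Real.exp (y * z - I.m z)) ∂I.ν = 1 := by
  have h := (I.isProbabilityMeasure_glmLaw z).measure_univ
  rwa [glmLaw, withDensity_apply _ MeasurableSet.univ, Measure.restrict_univ] at h

/-- The log-partition function is convex: this is Hölder's inequality, applied to the normalized
densities. -/
theorem convexOn_m : ConvexOn ℝ Set.univ I.m := by
  refine ⟨convex_univ, fun p _ q _ a b ha hb hab => ?_⟩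
  simp only [smul_eq_mul]
  set z := a * p + b * q with hz
  have hpt : ∀ y : ℝ, ENNReal.ofReal (Real.exp (I.m z - (a * I.m p + b * I.m q))) *
      ENNReal.ofReal (Real.exp (y * z - I.m z)) ≤
      ENNReal.ofReal a * ENNReal.ofReal (Real.exp (y * p - I.m p)) +
        ENNReal.ofReal b * ENNReal.ofReal (Real.exp (y * q - I.m q)) := by
    intro y
    rw [← ENNReal.ofReal_mul (Real.exp_pos _).le, ← ENNReal.ofReal_mul ha, ← ENNReal.ofReal_mul hb,
      ← ENNReal.ofReal_add (by positivity) (by positivity)]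
    refine ENNReal.ofReal_le_ofReal ?_
    have h := convexOn_exp.2 (Set.mem_univ (y * p - I.m p)) (Set.mem_univ (y * q - I.m q)) ha hb hab
    simp only [smul_eq_mul] at h
    rw [← Real.exp_add]
    refine le_trans (le_of_eq ?_) h
    congr 1
    rw [hz]; ring
  have h := lintegral_mono (μ := I.ν) hpt
  rw [lintegral_const_mul _ (by fun_prop), lintegral_add_left (by fun_prop),
    lintegral_const_mul _ (by fun_prop), lintegral_const_mul _ (by fun_prop),
    I.lintegral_exp_sub_eq_one, I.lintegral_exp_sub_eq_one, I.lintegral_exp_sub_eq_one, mul_one, mul_one,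
    mul_one, ← ENNReal.ofReal_add ha hb, hab, ENNReal.ofReal_le_ofReal_iff (by norm_num),
    Real.exp_le_one_iff] at h
  linarith

theorem monotone_mean : Monotone I.mean := by
  have h := I.convexOn_m.monotoneOn_deriv (fun x _ => I.differentiable_m x)
  exact monotoneOn_univ.1 h

theorem differentiable_mean' : Differentiable ℝ I.mean := I.differentiable_mean

theorem lipschitz_mean' : LipschitzWith I.Lμ I.mean := I.lipschitz_mean

theorem abs_mean_sub_le (x y : ℝ) : |I.mean x - I.mean y| ≤ I.Lμ * |x - y| := by
  simpa [Real.dist_eq] using I.lipschitz_mean'.dist_le_mul x y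

theorem abs_deriv_mean_le (z : ℝ) : |deriv I.mean z| ≤ I.Lμ := by
  simpa using norm_deriv_le_of_lipschitz I.lipschitz_mean' (x₀ := z)

theorem deriv_mean_le (z : ℝ) : deriv I.mean z ≤ I.Lμ := (abs_le.1 (I.abs_deriv_mean_le z)).2

theorem kappa_pos' : 0 < I.kappa := I.kappa_pos

/-- The infimum `κ_μ` bounds the slope of the mean function on the whole interval of radius
`‖θ*‖ + D + 1`, since every such point is of the form `xᵀθ`. -/
theorem kappa_le_deriv_mean (hd : 0 < d) {z : ℝ} (hz : |z| ≤ ‖I.θs‖ + (I.D + 1)) :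
    I.kappa ≤ deriv I.mean z := by
  have hq : 0 < I.D + 1 := by linarith [I.D_pos]
  have hbdd : BddBelow {v : ℝ | ∃ x θ : Feat d, ‖x‖ ≤ 1 ∧ ‖θ - I.θs‖ ≤ I.D + 1 ∧
      v = deriv (deriv I.m) (inner ℝ x θ)} := by
    refine ⟨-I.Lμ, ?_⟩
    rintro v ⟨x, θ, -, -, rfl⟩
    exact (abs_le.1 (I.abs_deriv_mean_le _)).1
  refine csInf_le hbdd ?_
  have : Nonempty (Fin d) := ⟨⟨0, hd⟩⟩
  obtain ⟨u, hu, huθ⟩ : ∃ u : Feat d, ‖u‖ = 1 ∧ ‖I.θs‖ • u = I.θs := by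
    rcases eq_or_ne I.θs 0 with h0 | h0
    · obtain ⟨u, hu⟩ := exists_norm_eq (Feat d) (zero_le_one' ℝ)
      exact ⟨u, hu, by simp [h0]⟩
    · refine ⟨‖I.θs‖⁻¹ • I.θs, ?_, ?_⟩
      · rw [norm_smul, norm_inv, norm_norm, inv_mul_cancel₀ (norm_ne_zero_iff.2 h0)]
      · rw [smul_smul, mul_inv_cancel₀ (norm_ne_zero_iff.2 h0), one_smul]
  set r := ‖I.θs‖ + (I.D + 1) with hr
  have hr0 : 0 < r := by positivity
  refine ⟨(z / r) • u, r • u, ?_, ?_, ?_⟩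
  · rw [norm_smul, hu, mul_one, Real.norm_eq_abs, abs_div, abs_of_pos hr0]
    exact div_le_one_of_le₀ hz hr0.le
  · have : r • u - I.θs = (I.D + 1) • u := by
      nth_rewrite 1 [← huθ]
      rw [← sub_smul]; congr 1; rw [hr]; ring
    rw [this, norm_smul, hu, mul_one, Real.norm_eq_abs, abs_of_pos hq]
  · rw [inner_smul_left, inner_smul_right, real_inner_self_eq_norm_sq, hu]
    simp only [conj_trivial, one_pow, mul_one]
    rw [div_mul_cancel₀ _ hr0.ne']
    rfl

theorem kappa_le_Lμ (hd : 0 < d) : I.kappa ≤ I.Lμ :=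
  (I.kappa_le_deriv_mean hd (z := 0) (by have := I.D_pos; simp; positivity)).trans (I.deriv_mean_le 0)

theorem Lμ_pos (hd : 0 < d) : (0 : ℝ) < I.Lμ := I.kappa_pos'.trans_le (I.kappa_le_Lμ hd)

theorem kappa_mul_sub_le (hd : 0 < d) {p q : ℝ} (hp : |p| ≤ ‖I.θs‖ + (I.D + 1))
    (hq : |q| ≤ ‖I.θs‖ + (I.D + 1)) (hpq : p ≤ q) :
    I.kappa * (q - p) ≤ I.mean q - I.mean p := by
  refine (convex_Icc (-(‖I.θs‖ + (I.D + 1))) (‖I.θs‖ + (I.D + 1))).mul_sub_le_image_sub_of_le_deriv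
    I.differentiable_mean'.continuous.continuousOn I.differentiable_mean'.differentiableOn
    (fun x hx => I.kappa_le_deriv_mean hd (abs_le.2 (Set.mem_Icc.1 (interior_subset hx)))) p (abs_le.1 hp) q (abs_le.1 hq) hpq

theorem kappa_mul_sq_le (hd : 0 < d) {p q : ℝ} (hp : |p| ≤ ‖I.θs‖ + (I.D + 1))
    (hq : |q| ≤ ‖I.θs‖ + (I.D + 1)) :
    I.kappa * (q - p) ^ 2 ≤ (I.mean q - I.mean p) * (q - p) := by
  rcases le_total p q with h | h
  · nlinarith [I.kappa_mul_sub_le hd hp hq h]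
  · nlinarith [I.kappa_mul_sub_le hd hq hp h]

/-- The variance of the feedback is at most its sub-Gaussian parameter, and it is at least `κ_μ`. -/
theorem kappa_le_σ_sq (hN : 0 < N) (hK : 0 < K) (hd : 0 < d) (hT : 0 < T) :
    I.kappa ≤ (I.σ : ℝ) ^ 2 := by
  let i : Fin N := ⟨0, hN⟩
  let k : Fin K := ⟨0, hK⟩
  set z : ℝ := inner ℝ (I.φ 0 i k) I.θs with hz
  have hzn : |z| ≤ ‖I.θs‖ :=
    (abs_real_inner_le_norm _ _).trans (mul_le_of_le_one_left (norm_nonneg _) (I.norm_φ_le 0 hT i k))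
  have hsub := I.subGaussian 0 hT i k
  have hprob := I.isProbabilityMeasure_glmLaw z
  have hmgf : mgf (fun y => y - deriv I.m z) (glmLaw I.ν I.m z) 1 =
      Real.exp (I.m (z + 1) - I.m z - I.mean z) := by
    have hi := hsub.integrable_exp_mul 1
    rw [mgf, integral_eq_lintegral_of_nonneg_ae (Filter.Eventually.of_forall fun y => (Real.exp_pos _).le)
      hi.aestronglyMeasurable, glmLaw, lintegral_withDensity_eq_lintegral_mul _ (by fun_prop) (by fun_prop)]
    have hpt : ∀ y : ℝ, ((fun y => ENNReal.ofReal (Real.exp (y * z - I.m z))) *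
        fun y => ENNReal.ofReal (Real.exp (1 * (y - deriv I.m z)))) y =
        ENNReal.ofReal (Real.exp (I.m (z + 1) - I.m z - I.mean z)) *
          ENNReal.ofReal (Real.exp (y * (z + 1) - I.m (z + 1))) := by
      intro y
      simp only [Pi.mul_apply]
      rw [← ENNReal.ofReal_mul (Real.exp_pos _).le, ← ENNReal.ofReal_mul (Real.exp_pos _).le,
        ← Real.exp_add, ← Real.exp_add]
      congr 2
      rw [mean]; ring
    rw [lintegral_congr hpt]
    rw [lintegral_const_mul _ (by fun_prop), I.lintegral_exp_sub_eq_one, mul_one,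
      ENNReal.toReal_ofReal (Real.exp_pos _).le]
  have h1 := hsub.mgf_le 1
  rw [hmgf, Real.exp_le_exp] at h1
  push_cast at h1
  -- the excess of `m` over its tangent at `z` has derivative at least `κ t`
  have hmono : MonotoneOn (fun t : ℝ => I.m (z + t) - t * I.mean z - I.kappa * t ^ 2 / 2) (Set.Icc 0 1) := by
    have hder : ∀ t : ℝ, HasDerivAt (fun t : ℝ => I.m (z + t) - t * I.mean z - I.kappa * t ^ 2 / 2)
        (I.mean (z + t) - I.mean z - I.kappa * t) t := by
      intro t
      have e1 : HasDerivAt (fun t : ℝ => I.m (z + t)) (I.mean (z + t)) t :=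
        (I.differentiable_m (z + t)).hasDerivAt.comp_const_add z t
      have e2 := (hasDerivAt_id t).mul_const (I.mean z)
      have e3 := (((hasDerivAt_id t).pow 2).const_mul I.kappa).div_const 2
      convert! (e1.sub e2).sub e3 using 1
      simp
      ring
    refine monotoneOn_of_deriv_nonneg (convex_Icc 0 1)
      (fun t _ => (hder t).continuousAt.continuousWithinAt)
      (fun t _ => (hder t).differentiableAt.differentiableWithinAt) fun t ht => ?_
    rw [interior_Icc] at ht
    rw [(hder t).deriv]
    have hD := I.D_pos
    have h2 := I.kappa_mul_sub_le hd (p := z) (q := z + t) (by linarith)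
      ((abs_add_le z t).trans (by rw [abs_of_pos ht.1]; linarith [ht.2])) (by linarith [ht.1])
    have h3 : z + t - z = t := by ring
    rw [h3] at h2
    linarith
  have h2 := hmono (Set.left_mem_Icc.2 zero_le_one) (Set.right_mem_Icc.2 zero_le_one) zero_le_one
  simp at h2
  linarith

end CAB

/-! ### Deterministic bounds for the maximum likelihood estimate -/

namespace CAB
variable {N K d T : ℕ} (I : CAB N K d T)

/-- The first-order condition of the ridge-regularized maximum likelihood estimate, in the
direction `w`, in terms of the estimation error `θ - θ*`. -/
theorem sum_mean_sub_mul_inner_eq {t : ℕ} {πs : ℕ → Alloc N K} {ys : ℕ → Fin N → ℝ} {lam : ℝ}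
    {θ : Feat d} (hmin : ∀ θ', I.regNLL t πs ys lam θ ≤ I.regNLL t πs ys lam θ') (w : Feat d) :
    ∑ s ∈ Finset.range t, ∑ i : Fin N,
        (I.mean (inner ℝ (I.feat s πs i) θ) - I.mean (inner ℝ (I.feat s πs i) I.θs)) *
          inner ℝ (I.feat s πs i) w + lam * inner ℝ (θ - I.θs) w =
      inner ℝ (I.score t πs ys) w - lam * inner ℝ I.θs w := by
  have hlin : ∀ x : Feat d, HasDerivAt (fun τ : ℝ => inner ℝ x (θ + τ • w)) (inner ℝ x w : ℝ) 0 := by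
    intro x
    simp_rw [inner_add_right, inner_smul_right]
    simpa using ((hasDerivAt_id (0 : ℝ)).mul_const (inner ℝ x w)).const_add (inner ℝ x θ)
  have hsq : HasDerivAt (fun τ : ℝ => ‖θ + τ • w‖ ^ 2) (2 * inner ℝ θ w : ℝ) 0 := by
    have h1 : HasDerivAt (fun τ : ℝ => θ + τ • w) w 0 := by
      simpa using ((hasDerivAt_id (0 : ℝ)).smul_const w).const_add θ
    simpa using h1.norm_sq
  have hder : HasDerivAt (fun τ : ℝ => I.regNLL t πs ys lam (θ + τ • w))
      (∑ s ∈ Finset.range t, ∑ i : Fin N,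
        (I.mean (inner ℝ (I.feat s πs i) θ) * inner ℝ (I.feat s πs i) w
          - ys s i * inner ℝ (I.feat s πs i) w) + lam / 2 * (2 * inner ℝ θ w)) 0 := by
    refine HasDerivAt.add (HasDerivAt.fun_sum fun s _ => HasDerivAt.fun_sum fun i _ =>
      HasDerivAt.sub ?_ ((hlin _).const_mul _)) (hsq.const_mul _)
    have hm : HasDerivAt I.m (I.mean (inner ℝ (I.feat s πs i) θ))
        (inner ℝ (I.feat s πs i) (θ + (0 : ℝ) • w)) := by
      rw [zero_smul, add_zero]; exact (I.differentiable_m _).hasDerivAt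
    exact hm.comp (0 : ℝ) (hlin _)
  have h0 : _ = (0 : ℝ) := IsLocalMin.hasDerivAt_eq_zero (Filter.Eventually.of_forall fun τ => by
    simpa using hmin (θ + τ • w)) hder
  have hs : inner ℝ (I.score t πs ys) w = ∑ s ∈ Finset.range t, ∑ i : Fin N,
      (ys s i - I.mean (inner ℝ (I.feat s πs i) I.θs)) * inner ℝ (I.feat s πs i) w := by
    simp [score, sum_inner, inner_smul_left]
  have hc : ∑ s ∈ Finset.range t, ∑ i : Fin N,
        (I.mean (inner ℝ (I.feat s πs i) θ) - I.mean (inner ℝ (I.feat s πs i) I.θs)) *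
          inner ℝ (I.feat s πs i) w =
      ∑ s ∈ Finset.range t, ∑ i : Fin N,
        (I.mean (inner ℝ (I.feat s πs i) θ) * inner ℝ (I.feat s πs i) w
          - ys s i * inner ℝ (I.feat s πs i) w) +
      ∑ s ∈ Finset.range t, ∑ i : Fin N,
      (ys s i - I.mean (inner ℝ (I.feat s πs i) I.θs)) * inner ℝ (I.feat s πs i) w := by
    simp_rw [← Finset.sum_add_distrib]
    exact Finset.sum_congr rfl fun s _ => Finset.sum_congr rfl fun i _ => by ring
  rw [hc, hs, inner_sub_left]
  linarith

theorem quad_smul_one_add_gram (γ : ℝ) (t : ℕ) (πs : ℕ → Alloc N K) (w : Feat d) :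
    quad (γ • 1 + I.gram t πs) w = γ * ‖w‖ ^ 2 +
      ∑ s ∈ Finset.range t, ∑ i : Fin N, inner ℝ (I.feat s πs i) w ^ 2 := by
  rw [quad_add, quad_smul_left, quad_one, quad_gram]

theorem abs_inner_feat_le {s : ℕ} (hs : s < T) (πs : ℕ → Alloc N K) (i : Fin N) (w : Feat d) :
    |inner ℝ (I.feat s πs i) w| ≤ ‖w‖ :=
  (abs_real_inner_le_norm _ _).trans
    (mul_le_of_le_one_left (norm_nonneg _) (I.norm_feat_le hs πs i))

/-- If the estimation error is at most `D + 1` along all observed features, then the slopes of the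
mean function that enter the first-order condition are at least `κ_μ`, and the error is controlled
by the score. -/
theorem kappa_mul_sqrt_quad_le (hd : 0 < d) {t : ℕ} (ht : t ≤ T) {πs : ℕ → Alloc N K}
    {ys : ℕ → Fin N → ℝ} {lam0 : ℝ} (hlam : 0 < lam0) {θ : Feat d}
    (hmin : ∀ θ', I.regNLL t πs ys (I.kappa * lam0) θ ≤ I.regNLL t πs ys (I.kappa * lam0) θ')
    (hgood : ∀ s < t, ∀ i, |inner ℝ (I.feat s πs i) (θ - I.θs)| ≤ I.D + 1) :
    I.kappa * √(quad (lam0 • 1 + I.gram t πs) (θ - I.θs)) ≤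
      √(invQuad (lam0 • 1 + I.gram t πs) (I.score t πs ys)) + I.kappa * (√lam0 * I.D) := by
  set V := lam0 • 1 + I.gram t πs with hVdef
  set Δ := θ - I.θs with hΔ
  have hV : V.PosDef := I.posDef_smul_one_add_gram hlam t πs
  have hκ := I.kappa_pos'
  have hD := I.D_pos
  have hfo := I.sum_mean_sub_mul_inner_eq hmin Δ
  have hterm : ∀ s ∈ Finset.range t, ∀ i ∈ (Finset.univ : Finset (Fin N)),
      I.kappa * inner ℝ (I.feat s πs i) Δ ^ 2 ≤
      (I.mean (inner ℝ (I.feat s πs i) θ) - I.mean (inner ℝ (I.feat s πs i) I.θs)) *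
          inner ℝ (I.feat s πs i) Δ := by
    intro s hs i _
    have hst := Finset.mem_range.1 hs
    have h1 := I.abs_inner_feat_le (hst.trans_le ht) πs i I.θs
    have h2 := hgood s hst i
    have e : (inner ℝ (I.feat s πs i) Δ : ℝ) =
        inner ℝ (I.feat s πs i) θ - inner ℝ (I.feat s πs i) I.θs := by
      rw [hΔ, inner_sub_right]
    have h3 : |(inner ℝ (I.feat s πs i) θ : ℝ)| ≤ ‖I.θs‖ + (I.D + 1) := by
      have : (inner ℝ (I.feat s πs i) θ : ℝ) =
        inner ℝ (I.feat s πs i) I.θs + inner ℝ (I.feat s πs i) Δ := by rw [e]; ring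
      rw [this]
      exact (abs_add_le _ _).trans (add_le_add h1 h2)
    have h4 := I.kappa_mul_sq_le hd (p := inner ℝ (I.feat s πs i) I.θs)
      (q := inner ℝ (I.feat s πs i) θ) (h1.trans (by linarith)) h3
    rwa [← e] at h4
  have hsum := Finset.sum_le_sum fun s hs => Finset.sum_le_sum (hterm s hs)
  simp_rw [← Finset.mul_sum] at hsum
  have hq := I.quad_smul_one_add_gram lam0 t πs Δ
  rw [← hVdef] at hq
  have hq0 : 0 ≤ quad V Δ := hV.posSemidef.quad_nonneg Δ
  have hcs : inner ℝ (I.score t πs ys) Δ ≤ √(invQuad V (I.score t πs ys)) * √(quad V Δ) :=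
    (le_abs_self _).trans (hV.abs_inner_le _ _)
  have hθ : -inner ℝ I.θs Δ ≤ I.D * ‖Δ‖ :=
    (neg_le_abs _).trans ((abs_real_inner_le_norm _ _).trans
      (mul_le_mul_of_nonneg_right I.norm_θs_le (norm_nonneg _)))
  have hn : √lam0 * ‖Δ‖ ≤ √(quad V Δ) := by
    refine Real.le_sqrt_of_sq_le ?_
    rw [mul_pow, Real.sq_sqrt hlam.le, hq]
    have : 0 ≤ ∑ s ∈ Finset.range t, ∑ i : Fin N, (inner ℝ (I.feat s πs i) Δ : ℝ) ^ 2 := by positivity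
    linarith
  rw [real_inner_self_eq_norm_sq] at hfo
  have key : I.kappa * quad V Δ ≤ (√(invQuad V (I.score t πs ys)) + I.kappa * (√lam0 * I.D)) *
      √(quad V Δ) := by
    have h5 : I.kappa * quad V Δ ≤ inner ℝ (I.score t πs ys) Δ + I.kappa * lam0 * (I.D * ‖Δ‖) := by
      rw [hq]
      have := mul_le_mul_of_nonneg_left hθ (mul_pos hκ hlam).le
      linarith
    have h6 : I.kappa * lam0 * (I.D * ‖Δ‖) ≤ I.kappa * (√lam0 * I.D) * √(quad V Δ) := by
      have : I.kappa * lam0 * (I.D * ‖Δ‖) = I.kappa * (√lam0 * I.D) * (√lam0 * ‖Δ‖) := by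
        nth_rewrite 1 [← Real.mul_self_sqrt hlam.le]; ring
      rw [this]
      exact mul_le_mul_of_nonneg_left hn (by positivity)
    linarith
  rcases (Real.sqrt_nonneg (quad V Δ)).eq_or_lt with h0 | h0
  · rw [← h0, mul_zero]; positivity
  · refine le_of_mul_le_mul_right ?_ h0
    rwa [mul_assoc, Real.mul_self_sqrt hq0]

theorem _root_.mul_sq_mul_le_of_sq_le_mul {κ lam a b q s W γ c : ℝ} (hκ : 0 ≤ κ) (hlam : 0 ≤ lam)
    (ha : q ^ 2 ≤ a) (hb : q ≤ b) (hq : 0 < q) (hγ : 0 < γ) (hc : 0 < c) (hcγ : c * (1 + γ) ≤ 4)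
    (hlow : κ * (a + lam * b ^ 2) ≤ q * s) (hcs : s ^ 2 ≤ W * (γ * b ^ 2 + a)) :
    c * κ ^ 2 * lam ≤ W := by
  have hb0 : 0 < b := by linarith
  have ha0 : 0 < a := lt_of_lt_of_le (by positivity) ha
  have hden : 0 < γ * b ^ 2 + a := by positivity
  have hbq : q ^ 2 ≤ b ^ 2 := pow_le_pow_left₀ hq.le hb 2
  -- the arithmetic-geometric mean inequality splits the square into the two lower bounds
  refine le_of_mul_le_mul_right ?_ (mul_pos (pow_pos hq 2) hden)
  have h6 : (κ * (a + lam * b ^ 2)) ^ 2 ≤ (q * s) ^ 2 :=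
    pow_le_pow_left₀ (by positivity) hlow 2
  have h7 : c * (q ^ 2 * (γ * b ^ 2 + a)) ≤ 4 * a * b ^ 2 := by
    have h8 : q ^ 2 * b ^ 2 ≤ a * b ^ 2 := by gcongr
    have h9 : q ^ 2 * a ≤ a * b ^ 2 := by
      rw [mul_comm]; exact mul_le_mul_of_nonneg_left hbq ha0.le
    have h10 : q ^ 2 * (γ * b ^ 2 + a) ≤ (1 + γ) * (a * b ^ 2) := by
      have := mul_le_mul_of_nonneg_left h8 hγ.le
      linarith
    calc c * (q ^ 2 * (γ * b ^ 2 + a)) ≤ c * ((1 + γ) * (a * b ^ 2)) := by gcongr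
      _ = c * (1 + γ) * (a * b ^ 2) := by ring
      _ ≤ 4 * (a * b ^ 2) := by gcongr
      _ = _ := by ring
  calc c * κ ^ 2 * lam * (q ^ 2 * (γ * b ^ 2 + a))
      = κ ^ 2 * lam * (c * (q ^ 2 * (γ * b ^ 2 + a))) := by ring
    _ ≤ κ ^ 2 * lam * (4 * a * b ^ 2) := by gcongr
    _ ≤ (κ * (a + lam * b ^ 2)) ^ 2 := by
        have : (κ * (a + lam * b ^ 2)) ^ 2 - κ ^ 2 * lam * (4 * a * b ^ 2) =
          (κ * (a - lam * b ^ 2)) ^ 2 := by ring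
        linarith [sq_nonneg (κ * (a - lam * b ^ 2))]
    _ ≤ (q * s) ^ 2 := h6
    _ = q ^ 2 * s ^ 2 := by ring
    _ ≤ q ^ 2 * (W * (γ * b ^ 2 + a)) := by gcongr
    _ = W * (q ^ 2 * (γ * b ^ 2 + a)) := by ring

set_option maxHeartbeats 400000 in
/-- If the estimation error exceeds `D + 1` along some observed feature, then the score is large.
Shrinking the error vector until its largest observed component is exactly `D + 1` keeps the
one-sided first-order condition, because the mean function is monotone, and puts all slopes back
into the range where they are at least `κ_μ`. -/
theorem mul_kappa_sq_le_invQuad_score (hd : 0 < d) {t : ℕ} (ht : t ≤ T) {πs : ℕ → Alloc N K}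
    {ys : ℕ → Fin N → ℝ} {lam0 : ℝ} (hlam : 0 < lam0) {θ : Feat d}
    (hmin : ∀ θ', I.regNLL t πs ys (I.kappa * lam0) θ ≤ I.regNLL t πs ys (I.kappa * lam0) θ')
    (hbad : ¬ ∀ s < t, ∀ i, |inner ℝ (I.feat s πs i) (θ - I.θs)| ≤ I.D + 1)
    {γ c : ℝ} (hγ : 0 < γ) (hc : 0 < c) (hcγ : c * (1 + γ) ≤ 4) :
    c * I.kappa ^ 2 * lam0 ≤ invQuad (γ • 1 + I.gram t πs) (I.score t πs ys) := by
  have hκ := I.kappa_pos'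
  have hD := I.D_pos
  set q := I.D + 1 with hqdef
  set Δ := θ - I.θs with hΔ
  push Not at hbad
  obtain ⟨s₁, hs₁, i₁, hlt⟩ := hbad
  obtain ⟨⟨s₀, i₀⟩, hp₀, hmax⟩ := Finset.exists_max_image (Finset.range t ×ˢ (Finset.univ : Finset (Fin N)))
    (fun p => |(inner ℝ (I.feat p.1 πs p.2) Δ : ℝ)|) ⟨(s₁, i₁), by simp [hs₁]⟩
  have hs₀ : s₀ < t := by simpa using hp₀
  set X := |(inner ℝ (I.feat s₀ πs i₀) Δ : ℝ)| with hX
  have hqX : q < X := hlt.trans_le (hmax (s₁, i₁) (by simp [hs₁]))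
  have hX0 : 0 < X := by linarith
  set τ := q / X with hτ
  have hτ0 : 0 < τ := by positivity
  have hτ1 : τ ≤ 1 := (div_le_one hX0).2 hqX.le
  have hfo := I.sum_mean_sub_mul_inner_eq hmin (τ • Δ)
  simp_rw [inner_smul_right] at hfo
  have hterm : ∀ s ∈ Finset.range t, ∀ i ∈ (Finset.univ : Finset (Fin N)),
      I.kappa * (τ * inner ℝ (I.feat s πs i) Δ) ^ 2 ≤
      (I.mean (inner ℝ (I.feat s πs i) θ) - I.mean (inner ℝ (I.feat s πs i) I.θs)) *
          (τ * inner ℝ (I.feat s πs i) Δ) := by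
    intro s hs i _
    have hst := Finset.mem_range.1 hs
    have h1 := I.abs_inner_feat_le (hst.trans_le ht) πs i I.θs
    have h2 : |(inner ℝ (I.feat s πs i) Δ : ℝ)| ≤ X := hmax (s, i) (by simp [hst])
    set b : ℝ := inner ℝ (I.feat s πs i) I.θs
    have e : (inner ℝ (I.feat s πs i) θ : ℝ) = b + inner ℝ (I.feat s πs i) Δ := by
      rw [hΔ, inner_sub_right]; ring
    rw [e]
    set z : ℝ := inner ℝ (I.feat s πs i) Δ
    have h3 : |τ * z| ≤ q := by
      rw [abs_mul, abs_of_pos hτ0, hτ, div_mul_eq_mul_div, div_le_iff₀ hX0]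
      exact mul_le_mul_of_nonneg_left h2 (by linarith)
    have h4 := I.kappa_mul_sq_le hd (p := b) (q := b + τ * z) (h1.trans (by linarith))
      ((abs_add_le _ _).trans (add_le_add h1 h3))
    rw [add_sub_cancel_left] at h4
    refine h4.trans ?_
    rcases le_total 0 z with hz | hz
    · have := I.monotone_mean (show b + τ * z ≤ b + z by
        linarith [mul_le_of_le_one_left hz hτ1])
      exact mul_le_mul_of_nonneg_right (by linarith) (by positivity)
    · have := I.monotone_mean (show b + z ≤ b + τ * z by
        linarith [mul_le_of_le_one_left (neg_nonneg.2 hz) hτ1])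
      exact mul_le_mul_of_nonpos_right (by linarith) (mul_nonpos_of_nonneg_of_nonpos hτ0.le hz)
  have hsum := Finset.sum_le_sum fun s hs => Finset.sum_le_sum (hterm s hs)
  simp_rw [← Finset.mul_sum] at hsum
  have hqd := I.quad_smul_one_add_gram γ t πs (τ • Δ)
  simp_rw [inner_smul_right] at hqd
  set a := ∑ s ∈ Finset.range t, ∑ i : Fin N, (τ * inner ℝ (I.feat s πs i) Δ : ℝ) ^ 2 with ha
  set b := ‖τ • Δ‖ with hb
  have hbτ : b = τ * ‖Δ‖ := by rw [hb, norm_smul, Real.norm_eq_abs, abs_of_pos hτ0]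
  have hτX : τ * X = q := by rw [hτ]; field_simp
  have haq : q ^ 2 ≤ a := by
    have h1 : (τ * inner ℝ (I.feat s₀ πs i₀) Δ : ℝ) ^ 2 = q ^ 2 := by
      rw [mul_pow, ← sq_abs (inner ℝ (I.feat s₀ πs i₀) Δ : ℝ), ← hX, ← mul_pow, hτX]
    rw [← h1, ha]
    refine le_trans ?_ (Finset.single_le_sum (f := fun s => ∑ i : Fin N, (τ * inner ℝ (I.feat s πs i) Δ : ℝ) ^ 2)
      (fun s _ => by positivity) (Finset.mem_range.2 hs₀))
    exact Finset.single_le_sum (f := fun i => (τ * inner ℝ (I.feat s₀ πs i) Δ : ℝ) ^ 2)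
      (fun i _ => by positivity) (Finset.mem_univ i₀)
  have hbq : q ≤ b := by
    rw [hbτ, ← hτX]
    exact mul_le_mul_of_nonneg_left (I.abs_inner_feat_le (hs₀.trans_le ht) πs i₀ Δ) hτ0.le
  have hq1 : 1 ≤ q := by linarith
  have hb0 : 0 < b := by linarith
  rw [real_inner_self_eq_norm_sq] at hfo
  have hθ : -(τ * inner ℝ I.θs Δ) ≤ I.D * b := by
    have : -inner ℝ I.θs Δ ≤ I.D * ‖Δ‖ :=
      (neg_le_abs _).trans ((abs_real_inner_le_norm _ _).trans
        (mul_le_mul_of_nonneg_right I.norm_θs_le (norm_nonneg _)))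
    rw [hbτ]
    have := mul_le_mul_of_nonneg_left this hτ0.le
    linarith
  have hΔb : b ^ 2 ≤ τ * ‖Δ‖ ^ 2 := by
    rw [hbτ, mul_pow]
    rw [sq τ]
    exact mul_le_mul_of_nonneg_right (mul_le_of_le_one_left hτ0.le hτ1) (by positivity)
  set S : ℝ := inner ℝ (I.score t πs ys) Δ
  have hlow : I.kappa * (a + lam0 * b ^ 2) ≤ q * (τ * S) := by
    have h1 : I.kappa * a + I.kappa * lam0 * (b ^ 2 - I.D * b) ≤ τ * S := by
      have h2 := mul_le_mul_of_nonneg_left hθ (mul_pos hκ hlam).le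
      have h3 := mul_le_mul_of_nonneg_left hΔb (mul_pos hκ hlam).le
      linarith
    have h4 : a ≤ q * a := le_mul_of_one_le_left ((sq_nonneg q).trans haq) hq1
    have h5 : b ^ 2 ≤ q * (b ^ 2 - I.D * b) := by
      have : q * (b ^ 2 - I.D * b) - b ^ 2 = I.D * b * (b - q) := by rw [hqdef]; ring
      have : 0 ≤ I.D * b * (b - q) := mul_nonneg (by positivity) (by linarith)
      linarith
    calc I.kappa * (a + lam0 * b ^ 2) = I.kappa * a + I.kappa * lam0 * b ^ 2 := by ring
      _ ≤ I.kappa * (q * a) + I.kappa * lam0 * (q * (b ^ 2 - I.D * b)) := by gcongr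
      _ = q * (I.kappa * a + I.kappa * lam0 * (b ^ 2 - I.D * b)) := by ring
      _ ≤ q * (τ * S) := by gcongr
  have hV : (γ • (1 : Matrix (Fin d) (Fin d) ℝ) + I.gram t πs).PosDef := I.posDef_smul_one_add_gram hγ t πs
  have hcs := hV.inner_sq_le (I.score t πs ys) (τ • Δ)
  rw [inner_smul_right, hqd] at hcs
  exact mul_sq_mul_le_of_sq_le_mul hκ.le hlam.le haq hbq (by linarith) hγ hc hcγ hlow hcs

end CAB

/-! ### The good event and the excess of the score -/

namespace CAB
variable {N K d T : ℕ} (I : CAB N K d T)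

theorem one_le_one_add_mul_div (a b c : ℕ) {γ : ℝ} (hγ : 0 < γ) :
    (1 : ℝ) ≤ 1 + a * b / (c * γ) := by
  have : (0 : ℝ) ≤ a * b / (c * γ) := by positivity
  linarith

theorem lamMin_pos (hT : 0 < T) {δ : ℝ} (hδ : 0 < δ) (hδT : δ < 1 / T) : 0 < I.lamMin δ := by
  have hT1 : (1 : ℝ) ≤ T := by exact_mod_cast hT
  have h1 : δ < 1 := hδT.trans_le (by rw [div_le_one (by linarith)]; exact hT1)
  have h2 : 0 < Real.log (1 / δ) := Real.log_pos (by rw [lt_div_iff₀ hδ]; linarith)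
  have h3 : 0 ≤ Real.log (1 + N * T / d) := Real.log_nonneg (by
    have : (0 : ℝ) ≤ N * T / d := by positivity
    linarith)
  have := I.kappa_pos'
  have hσ : (0 : ℝ) < I.σ := I.σ_pos
  unfold lamMin
  positivity

theorem measurableSet_abs_inner_feat_le {Ω : Type*} {m : MeasurableSpace Ω} {π : ℕ → Ω → Alloc N K}
    {t : ℕ} (hπ : ∀ s < t, Measurable[m] (π s)) {θ : Ω → Feat d} (hθ : Measurable[m] θ) :
    MeasurableSet[m] {ω | ∀ s < t, ∀ i,
      |(inner ℝ (I.feat s (fun s => π s ω) i) (θ ω - I.θs) : ℝ)| ≤ I.D + 1} := by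
  have : {ω | ∀ s < t, ∀ i, |(inner ℝ (I.feat s (fun s => π s ω) i) (θ ω - I.θs) : ℝ)| ≤ I.D + 1} =
      ⋂ s : Fin t, ⋂ i : Fin N,
      {ω | |(inner ℝ (I.feat s (fun s => π s ω) i) (θ ω - I.θs) : ℝ)| ≤ I.D + 1} := by
    ext ω
    simp only [Set.mem_ofPred_eq, Set.mem_iInter]
    exact ⟨fun h s i => h s s.2 i, fun h s hs i => h ⟨s, hs⟩ i⟩
  rw [this]
  refine MeasurableSet.iInter fun s => MeasurableSet.iInter fun i => ?_
  exact measurableSet_le (((I.measurable_feat (hπ s s.2) i).inner (hθ.sub_const _)).abs)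
    measurable_const

end CAB

theorem exp_neg_mul_log_sub_le {n : ℝ} (hn : 0 < n) {d : ℕ} (hd : 0 < d) {y : ℝ} (hy : 2 ≤ y)
    (hny : n ≤ d * y) :
    Real.exp (-(d * (Real.log (1 + y) - Real.log 3 / 2))) ≤ 4 / n := by
  have hd' : (0 : ℝ) < d := by exact_mod_cast hd
  have h1 : Real.log (1 + y / 4) ≤ Real.log (1 + y) - Real.log 3 / 2 := by
    have h2 : Real.log (3 * (1 + y / 4) ^ 2) ≤ Real.log ((1 + y) ^ 2) :=
      Real.log_le_log (by positivity) (by nlinarith)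
    rw [Real.log_mul (by norm_num) (by positivity), Real.log_pow, Real.log_pow] at h2
    push_cast at h2
    linarith
  have h3 : n / 4 ≤ (1 + y / 4) ^ d :=
    le_trans (by linarith) (one_add_mul_le_pow (by linarith : (-2 : ℝ) ≤ y / 4) d)
  calc Real.exp (-(d * (Real.log (1 + y) - Real.log 3 / 2)))
      ≤ Real.exp (-(d * Real.log (1 + y / 4))) := by gcongr
    _ = ((1 + y / 4) ^ d)⁻¹ := by
        rw [Real.exp_neg, mul_comm, Real.exp_mul, Real.exp_log (by positivity), Real.rpow_natCast]
    _ ≤ (n / 4)⁻¹ := by gcongr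
    _ = 4 / n := by rw [inv_div]

theorem exp_neg_half_mul_log_le {n : ℝ} (hn : 0 < n) {d : ℕ} (hd : 0 < d) {y : ℝ}
    (hn2 : n ≤ 2 * d) (hny : n ≤ d * y) :
    Real.exp (-(d / 2 * Real.log (1 + y))) ≤ 6 / n := by
  have hd' : (0 : ℝ) < d := by exact_mod_cast hd
  have h1 : n / d / 3 ≤ Real.log (1 + y) := by
    have hz : n / d ≤ 2 := by rw [div_le_iff₀ hd']; exact hn2
    have hzy : n / d ≤ y := by rw [div_le_iff₀ hd']; linarith
    have hz0 : 0 < n / d := by positivity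
    have h2 := Real.one_sub_inv_le_log_of_pos (show 0 < 1 + n / d by linarith)
    have h3 : Real.log (1 + n / d) ≤ Real.log (1 + y) := Real.log_le_log (by linarith) (by linarith)
    have h4 : n / d / 3 ≤ 1 - (1 + n / d)⁻¹ := by
      have : 1 - (1 + n / d)⁻¹ = n / d / (1 + n / d) := by field_simp; ring
      rw [this]
      gcongr; linarith
    linarith
  have h2 : n / 6 ≤ d / 2 * Real.log (1 + y) := by
    have := mul_le_mul_of_nonneg_left h1 (by positivity : (0 : ℝ) ≤ d / 2)
    have e : (d : ℝ) / 2 * (n / d / 3) = n / 6 := by field_simp; norm_num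
    linarith
  calc Real.exp (-(d / 2 * Real.log (1 + y))) ≤ Real.exp (-(n / 6)) := by gcongr
    _ = (Real.exp (n / 6))⁻¹ := Real.exp_neg _
    _ ≤ (n / 6)⁻¹ := by
        gcongr
        linarith [Real.add_one_le_exp (n / 6)]
    _ = 6 / n := by rw [inv_div]

namespace CABTSRun
variable {N K d T : ℕ} {I : CAB N K d T} {lam0 a : ℝ} {Ω : Type*} [mΩ : MeasurableSpace Ω]
  {P : Measure Ω} (R : CABTSRun I lam0 a P)

/-- The Gram matrix of the past of round `t`, regularized by `γ`. -/
noncomputable def V (γ : ℝ) (t : ℕ) (ω : Ω) : Matrix (Fin d) (Fin d) ℝ :=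
  γ • 1 + I.gram t fun s => R.π s ω

/-- The score of the past of round `t`. -/
noncomputable def S (t : ℕ) (ω : Ω) : Feat d :=
  I.score t (fun s => R.π s ω) (fun s => R.y s ω)

/-- The event that the estimation error of round `t` is at most `D + 1` along all features observed
so far. -/
def good (t : ℕ) : Set Ω :=
  {ω | ∀ s < t, ∀ i, |(inner ℝ (I.feat s (fun s => R.π s ω) i) (R.θbar t ω - I.θs) : ℝ)| ≤ I.D + 1}

theorem posDef_V {γ : ℝ} (hγ : 0 < γ) (t : ℕ) (ω : Ω) : (R.V γ t ω).PosDef :=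
  I.posDef_smul_one_add_gram hγ t _

theorem measurableSet_good {t : ℕ} (ht : t < T) : MeasurableSet[R.past t] (R.good t) :=
  I.measurableSet_abs_inner_feat_le (fun _ hs => measurable_π_history hs) (R.measurable_θbar t ht)

theorem measurable_S {t : ℕ} (ht : t ≤ T) : Measurable (R.S t) :=
  I.measurable_score (fun s hs => R.measurable_π s (hs.trans_le ht))
    (fun s hs => R.measurable_y s (hs.trans_le ht))

variable [IsProbabilityMeasure P]

theorem measure_le_invQuad_le (hd : 0 < d) {γ c E : ℝ} (hγ : 0 < γ) {t : ℕ} (ht : t ≤ T)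
    (hE : E ≤ c / (2 * (I.σ : ℝ) ^ 2) - d / 2 * Real.log (1 + N * t / (d * γ))) {B : Set Ω}
    (hBm : MeasurableSet B)
    (hB : ∀ᵐ ω ∂P, ω ∈ B → c ≤ invQuad (R.V γ t ω) (R.S t ω)) :
    P B ≤ ENNReal.ofReal (Real.exp (-E)) := by
  have hσ : (0 : ℝ) < I.σ := I.σ_pos
  have h1 := R.lintegral_exp_invQuad_score_le hd hγ ht
  have h2 : ∫⁻ ω, B.indicator (fun _ => ENNReal.ofReal (Real.exp E)) ω ∂P ≤ 1 := by
    refine le_trans (lintegral_mono_ae ?_) h1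
    filter_upwards [hB] with ω hω
    by_cases h : ω ∈ B
    · rw [Set.indicator_of_mem h]
      refine ENNReal.ofReal_le_ofReal (Real.exp_le_exp.2 (hE.trans ?_))
      have := hω h
      unfold V S at this
      gcongr
    · rw [Set.indicator_of_notMem h]; exact zero_le
  have h3 : ENNReal.ofReal (Real.exp E) * P B ≤ 1 :=
    (lintegral_indicator_const hBm _).symm.trans_le h2
  rw [Real.exp_neg, ENNReal.ofReal_inv_of_pos (Real.exp_pos _), ← one_div,
    ENNReal.le_div_iff_mul_le (by simp [Real.exp_pos]) (by simp), mul_comm]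
  exact h3

/-- The observed features see an estimation error of more than `D + 1` with small probability only.
If `N t ≤ 2 d` the score is compared with the Gram matrix regularized by `1`, otherwise with the one
regularized by `1 / 3`. -/
theorem measure_compl_good_le (hN : 0 < N) (hd : 0 < d) {δ : ℝ} (hδ : 0 < δ) (hδT : δ < 1 / T)
    (hδ' : δ < 3 / 40) (hlam : I.lamMin δ ≤ lam0) {t : ℕ} (ht : t < T) {a' : ℝ}
    (R : CABTSRun I lam0 a' P) : P (R.good t)ᶜ ≤ ENNReal.ofReal (4 * δ / N) := by
  rcases Nat.eq_zero_or_pos t with rfl | ht0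
  · have : (R.good 0)ᶜ = ∅ := by
      rw [Set.compl_empty_iff, Set.eq_univ_iff_forall]
      exact fun ω s hs => absurd hs (Nat.not_lt_zero s)
    simp [this]
  have hN' : (0 : ℝ) < N := by exact_mod_cast hN
  have hd' : (0 : ℝ) < d := by exact_mod_cast hd
  have ht1 : (1 : ℝ) ≤ t := by exact_mod_cast ht0
  have htT : (t : ℝ) ≤ T := by exact_mod_cast ht.le
  have hσ : (0 : ℝ) < I.σ := I.σ_pos
  have hκ := I.kappa_pos'
  have hlam0 : 0 < lam0 := (I.lamMin_pos (Nat.zero_lt_of_lt ht) hδ hδT).trans_le hlam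
  have hBm : MeasurableSet (R.good t)ᶜ := (R.past_le ht.le _ (R.measurableSet_good ht)).compl
  set y : ℝ := N * T / d with hy
  set x : ℝ := N * t / d with hx
  have hx0 : 0 < x := by positivity
  have hxy : x ≤ y := by rw [hx, hy]; gcongr
  have hNy : (N : ℝ) ≤ d * y := by
    rw [hy, mul_div_cancel₀ _ hd'.ne']
    exact le_mul_of_one_le_right hN'.le (ht1.trans htT)
  have hlδ : Real.log (1 / δ) = -Real.log δ := by rw [one_div, Real.log_inv]
  have hlogxy : Real.log (1 + x) ≤ Real.log (1 + y) := Real.log_le_log (by linarith) (by linarith)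
  have hlamσ : d * Real.log (1 + y) - 2 * Real.log δ ≤ I.kappa ^ 2 * lam0 / (I.σ : ℝ) ^ 2 := by
    rw [le_div_iff₀ (by positivity)]
    have h1 := mul_le_mul_of_nonneg_left hlam (by positivity : 0 ≤ I.kappa ^ 2)
    refine le_trans (le_of_eq ?_) h1
    rw [CAB.lamMin, hlδ, ← hy]
    field_simp
    ring
  have hbad : ∀ {γ c : ℝ}, 0 < γ → 0 < c → c * (1 + γ) ≤ 4 →
      ∀ᵐ ω ∂P, ω ∈ (R.good t)ᶜ → c * I.kappa ^ 2 * lam0 ≤ invQuad (R.V γ t ω) (R.S t ω) := by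
    intro γ c hγ hc hcγ
    filter_upwards [R.isMin_θbar t ht] with ω hω hgood
    exact I.mul_kappa_sq_le_invQuad_score hd ht.le hlam0 hω hgood hγ hc hcγ
  rcases le_or_gt x 2 with hx2 | hx2
  · have hE : (d : ℝ) / 2 * Real.log (1 + y) - 2 * Real.log δ ≤
        2 * I.kappa ^ 2 * lam0 / (2 * (I.σ : ℝ) ^ 2) - d / 2 * Real.log (1 + N * t / (d * 1)) := by
      rw [mul_one, ← hx]
      have e : 2 * I.kappa ^ 2 * lam0 / (2 * (I.σ : ℝ) ^ 2) = I.kappa ^ 2 * lam0 / (I.σ : ℝ) ^ 2 := by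
        field_simp
      rw [e]
      have := mul_le_mul_of_nonneg_left hlogxy (by positivity : (0 : ℝ) ≤ d / 2)
      linarith
    refine (R.measure_le_invQuad_le hd one_pos ht.le hE hBm
      (hbad one_pos two_pos (by norm_num))).trans (ENNReal.ofReal_le_ofReal ?_)
    have e : Real.exp (-((d : ℝ) / 2 * Real.log (1 + y) - 2 * Real.log δ)) =
        Real.exp (-((d : ℝ) / 2 * Real.log (1 + y))) * δ ^ 2 := by
      rw [← Real.exp_log (pow_pos hδ 2), ← Real.exp_add, Real.log_pow]; congr 1; push_cast; ring
    rw [e]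
    have h2 : (N : ℝ) ≤ 2 * d := by
      rw [hx, div_le_iff₀ hd'] at hx2
      exact (le_mul_of_one_le_right hN'.le ht1).trans hx2
    calc _ ≤ 6 / N * δ ^ 2 :=
          mul_le_mul_of_nonneg_right (exp_neg_half_mul_log_le hN' hd h2 hNy) (by positivity)
      _ = 6 * δ * δ / N := by ring
      _ ≤ 4 * δ / N := by
        gcongr
        nlinarith
  · have hE : (d : ℝ) * (Real.log (1 + y) - Real.log 3 / 2) - 3 * Real.log δ ≤
        3 * I.kappa ^ 2 * lam0 / (2 * (I.σ : ℝ) ^ 2) - d / 2 * Real.log (1 + N * t / (d * (1 / 3))) := by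
      have e : 3 * I.kappa ^ 2 * lam0 / (2 * (I.σ : ℝ) ^ 2) =
          3 / 2 * (I.kappa ^ 2 * lam0 / (I.σ : ℝ) ^ 2) := by
        field_simp
      have e2 : (N : ℝ) * t / (d * (1 / 3)) = 3 * x := by rw [hx]; field_simp
      have h3 : Real.log (1 + 3 * x) ≤ Real.log 3 + Real.log (1 + y) := by
        rw [← Real.log_mul (by norm_num) (by linarith)]
        exact Real.log_le_log (by linarith) (by linarith)
      rw [e, e2]
      have := mul_le_mul_of_nonneg_left h3 (by positivity : (0 : ℝ) ≤ d / 2)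
      linarith
    refine (R.measure_le_invQuad_le hd (by norm_num) ht.le hE hBm
      (hbad (by norm_num) three_pos (by norm_num))).trans (ENNReal.ofReal_le_ofReal ?_)
    have e : Real.exp (-((d : ℝ) * (Real.log (1 + y) - Real.log 3 / 2) - 3 * Real.log δ)) =
        Real.exp (-((d : ℝ) * (Real.log (1 + y) - Real.log 3 / 2))) * δ ^ 3 := by
      rw [← Real.exp_log (pow_pos hδ 3), ← Real.exp_add, Real.log_pow]; congr 1; push_cast; ring
    rw [e]
    calc _ ≤ 4 / N * δ ^ 3 :=
          mul_le_mul_of_nonneg_right (exp_neg_mul_log_sub_le hN' hd (by linarith) hNy) (by positivity)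
      _ = 4 * (δ * δ ^ 2) / N := by ring
      _ ≤ 4 * (δ * 1) / N := by
        gcongr
        exact pow_le_one₀ hδ.le (by linarith)
      _ = _ := by ring

/-- The expected excess of the dual norm of the score over its typical size `β`. -/
theorem lintegral_sqrt_invQuad_sub_le (hd : 0 < d) {γ δ β : ℝ} (hγ : 0 < γ) (hδ : 0 < δ)
    (hδ' : δ < 3 / 40) {t : ℕ} (ht : t ≤ T)
    (hβ : β = I.σ * √(d * Real.log (1 + N * T / (d * γ)) + 2 * Real.log (1 / δ))) :
    ∫⁻ ω, ENNReal.ofReal (√(invQuad (R.V γ t ω) (R.S t ω)) - β) ∂P ≤ ENNReal.ofReal (β * δ) := by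
  have hσ : (0 : ℝ) < I.σ := I.σ_pos
  have hlog : 1 ≤ 2 * Real.log (1 / δ) := by
    have h1 := Real.one_sub_inv_le_log_of_pos (one_div_pos.2 hδ)
    rw [one_div, inv_inv] at h1
    rw [one_div]
    linarith
  have hℓ : 0 ≤ Real.log (1 + N * T / (d * γ)) := Real.log_nonneg (CAB.one_le_one_add_mul_div _ _ _ hγ)
  have hℓ' : Real.log (1 + N * t / (d * γ)) ≤ Real.log (1 + N * T / (d * γ)) := by
    refine Real.log_le_log (by linarith [CAB.one_le_one_add_mul_div N t d hγ]) ?_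
    gcongr
  have hβ2 : β ^ 2 = (I.σ : ℝ) ^ 2 * (d * Real.log (1 + N * T / (d * γ)) + 2 * Real.log (1 / δ)) := by
    rw [hβ, mul_pow, Real.sq_sqrt (by positivity)]
  have hσβ : (I.σ : ℝ) ^ 2 ≤ β ^ 2 := by
    rw [hβ2]
    refine le_mul_of_one_le_right (by positivity) ?_
    have : 0 ≤ d * Real.log (1 + N * T / (d * γ)) := by positivity
    linarith
  have hβ0 : 0 < β := by
    have h1 : 0 ≤ β := by rw [hβ]; positivity
    have h2 : 0 < β ^ 2 := lt_of_lt_of_le (by positivity) hσβ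
    exact lt_of_le_of_ne h1 fun h => by rw [← h] at h2; simp at h2
  have hpt : ∀ ω, ENNReal.ofReal (√(invQuad (R.V γ t ω) (R.S t ω)) - β) ≤
      ENNReal.ofReal (β * δ) * ENNReal.ofReal (Real.exp (
        invQuad (R.V γ t ω) (R.S t ω) / (2 * (I.σ : ℝ) ^ 2) - d / 2 * Real.log (1 + N * t / (d * γ)))) := by
    intro ω
    set W := invQuad (R.V γ t ω) (R.S t ω)
    have hW : 0 ≤ W := (R.posDef_V hγ t ω).invQuad_nonneg _
    rw [← ENNReal.ofReal_mul (by positivity)]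
    refine ENNReal.ofReal_le_ofReal ?_
    have h1 : √W - β ≤ (W - β ^ 2) / (2 * β) := by
      rw [le_div_iff₀ (by positivity)]
      nlinarith [Real.sq_sqrt hW, sq_nonneg (√W - β)]
    set u := (W - β ^ 2) / (2 * (I.σ : ℝ) ^ 2) with hu
    have h2 : (W - β ^ 2) / (2 * β) = (I.σ : ℝ) ^ 2 / β * u := by rw [hu]; field_simp
    have h3 : u ≤ Real.exp u := by linarith [Real.add_one_le_exp u]
    have h4 : (I.σ : ℝ) ^ 2 / β ≤ β := by rw [div_le_iff₀ hβ0, ← sq]; exact hσβ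
    have h5 : Real.exp u ≤ δ * Real.exp (W / (2 * (I.σ : ℝ) ^ 2) - d / 2 * Real.log (1 + N * t / (d * γ))) := by
      nth_rewrite 1 [← Real.exp_log hδ]
      rw [← Real.exp_add, Real.exp_le_exp]
      have e : u = W / (2 * (I.σ : ℝ) ^ 2) - d / 2 * Real.log (1 + N * T / (d * γ)) - Real.log (1 / δ) := by
        rw [hu, hβ2]; field_simp; ring
      have h6 : Real.log (1 / δ) = -Real.log δ := by rw [one_div, Real.log_inv]
      rw [e, h6]
      have := mul_le_mul_of_nonneg_left hℓ' (by positivity : (0 : ℝ) ≤ d / 2)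
      linarith
    calc √W - β ≤ (I.σ : ℝ) ^ 2 / β * u := h1.trans h2.le
      _ ≤ (I.σ : ℝ) ^ 2 / β * Real.exp u := by gcongr
      _ ≤ β * (δ * Real.exp (W / (2 * (I.σ : ℝ) ^ 2) - d / 2 * Real.log (1 + N * t / (d * γ)))) := by gcongr
      _ = _ := by ring
  refine (lintegral_mono hpt).trans ?_
  rw [lintegral_const_mul' _ _ ENNReal.ofReal_ne_top]
  exact mul_le_of_le_one_right' (R.lintegral_exp_invQuad_score_le hd hγ ht)

end CABTSRun

/-! ### The exploration covariance and the law of the perturbations -/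

namespace CAB
variable {N K d T : ℕ} (I : CAB N K d T)

theorem gram_congr {t : ℕ} {πs πs' : ℕ → Alloc N K} (h : ∀ s < t, πs s = πs' s) :
    I.gram t πs = I.gram t πs' :=
  Finset.sum_congr rfl fun s hs => Finset.sum_congr rfl fun i _ => by
    simp only [feat, h s (Finset.mem_range.1 hs)]

/-- The Gram matrix takes only finitely many values, so every function of it is measurable with
respect to the past. -/
theorem measurable_comp_gram (hK : 0 < K) {Ω β : Type*} {m : MeasurableSpace Ω} [MeasurableSpace β]
    {π : ℕ → Ω → Alloc N K} {t : ℕ} (hπ : ∀ s < t, Measurable[m] (π s))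
    (F : Matrix (Fin d) (Fin d) ℝ → β) :
    Measurable[m] fun ω => F (I.gram t fun s => π s ω) := by
  let ext : (Fin t → Alloc N K) → ℕ → Alloc N K := fun q s =>
    if h : s < t then q ⟨s, h⟩ else fun _ => ⟨0, hK⟩
  have h1 : (fun ω => F (I.gram t fun s => π s ω)) =
      (fun q : Fin t → Alloc N K => F (I.gram t (ext q))) ∘ fun ω (s : Fin t) => π s ω := by
    funext ω
    refine congrArg F (I.gram_congr fun s hs => ?_)
    simp [ext, hs]
  rw [h1]
  exact (measurable_of_finite _).comp (measurable_pi_lambda _ fun s => hπ s s.2)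

theorem measurable_invQuad_gram (hK : 0 < K) {Ω : Type*} {m : MeasurableSpace Ω}
    {π : ℕ → Ω → Alloc N K} {t : ℕ} (hπ : ∀ s < t, Measurable[m] (π s)) (γ : ℝ) {x : Ω → Feat d}
    (hx : Measurable[m] x) :
    Measurable[m] fun ω => invQuad (γ • 1 + I.gram t fun s => π s ω) (x ω) := by
  simp only [invQuad, dotProduct, Matrix.mulVec]
  have hxc : ∀ j, Measurable[m] fun ω => (x ω).ofLp j := fun j =>
    (EuclideanSpace.proj (𝕜 := ℝ) j).continuous.measurable.comp hx
  refine Finset.measurable_sum _ fun j _ => (hxc j).mul (Finset.measurable_sum _ fun k _ => ?_)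
  exact (I.measurable_comp_gram hK hπ fun G => ((γ • 1 + G)⁻¹ : Matrix (Fin d) (Fin d) ℝ) j k).mul (hxc k)

theorem quad_H {lam0 : ℝ} {t : ℕ} (ht : t ≠ 0) (πs : ℕ → Alloc N K) (θ w : Feat d) :
    quad (I.H lam0 t πs θ) w = ∑ s ∈ Finset.range t, ∑ i : Fin N,
      deriv I.mean (inner ℝ (I.feat s πs i) θ) *
        (inner ℝ (I.feat s πs i) w ^ 2 + lam0 / (N * t) * ‖w‖ ^ 2) := by
  rw [H, if_neg ht, quad_sum]
  refine Finset.sum_congr rfl fun s _ => ?_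
  rw [quad_sum]
  refine Finset.sum_congr rfl fun i _ => ?_
  rw [quad_smul_left, quad_add, quad_smul_left, quad_one]
  exact congrArg (fun z => _ * (z + _)) (quad_vecMulVec (I.feat s πs i) w)

theorem quad_smul_one_add_gram_eq_sum (hN : 0 < N) {lam0 : ℝ} {t : ℕ} (ht : t ≠ 0)
    (πs : ℕ → Alloc N K) (w : Feat d) :
    quad (lam0 • 1 + I.gram t πs) w = ∑ s ∈ Finset.range t, ∑ i : Fin N,
        (inner ℝ (I.feat s πs i) w ^ 2 + lam0 / (N * t) * ‖w‖ ^ 2) := by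
  rw [quad_smul_one_add_gram]
  simp only [Finset.sum_add_distrib, Finset.sum_const, Finset.card_univ, Fintype.card_fin,
    Finset.card_range, nsmul_eq_mul]
  have h1 : (N : ℝ) ≠ 0 := by exact_mod_cast hN.ne'
  have h2 : (t : ℝ) ≠ 0 := by exact_mod_cast ht
  field_simp
  ring

theorem quad_H_le (hN : 0 < N) {lam0 : ℝ} (hlam : 0 < lam0) (t : ℕ)
    (πs : ℕ → Alloc N K) (θ w : Feat d) :
    quad (I.H lam0 t πs θ) w ≤ I.Lμ * quad (lam0 • 1 + I.gram t πs) w := by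
  rcases eq_or_ne t 0 with rfl | ht
  · simp [H, gram, quad_smul_left, quad_one, mul_assoc]
  · rw [I.quad_H ht, I.quad_smul_one_add_gram_eq_sum hN ht]
    simp_rw [Finset.mul_sum]
    refine Finset.sum_le_sum fun s _ => Finset.sum_le_sum fun i _ => ?_
    exact mul_le_mul_of_nonneg_right (I.deriv_mean_le _) (by positivity)

theorem kappa_mul_quad_le_quad_H (hN : 0 < N) (hd : 0 < d) {lam0 : ℝ} (hlam : 0 < lam0) {t : ℕ}
    (ht : t ≤ T) {πs : ℕ → Alloc N K} {θ : Feat d}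
    (hgood : ∀ s < t, ∀ i, |inner ℝ (I.feat s πs i) (θ - I.θs)| ≤ I.D + 1) (w : Feat d) :
    I.kappa * quad (lam0 • 1 + I.gram t πs) w ≤ quad (I.H lam0 t πs θ) w := by
  rcases eq_or_ne t 0 with rfl | ht0
  · simp only [H, gram, quad_smul_left, quad_one, Finset.range_zero, Finset.sum_empty, add_zero,
      if_true, mul_assoc]
    have := I.kappa_le_Lμ hd
    gcongr
  · rw [I.quad_H ht0, I.quad_smul_one_add_gram_eq_sum hN ht0]
    simp_rw [Finset.mul_sum]
    refine Finset.sum_le_sum fun s hs => Finset.sum_le_sum fun i _ => ?_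
    refine mul_le_mul_of_nonneg_right (I.kappa_le_deriv_mean hd ?_) (by positivity)
    have hst := Finset.mem_range.1 hs
    have e : (inner ℝ (I.feat s πs i) θ : ℝ) =
        inner ℝ (I.feat s πs i) I.θs + inner ℝ (I.feat s πs i) (θ - I.θs) := by
      rw [inner_sub_right]; ring
    rw [e]
    exact (abs_add_le _ _).trans
      (add_le_add (I.abs_inner_feat_le (hst.trans_le ht) πs i I.θs) (hgood s hst i))

theorem isHermitian_H (lam0 : ℝ) (t : ℕ) (πs : ℕ → Alloc N K) (θ : Feat d) :
    (I.H lam0 t πs θ).IsHermitian := by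
  have h1 : ∀ c : ℝ, (c • (1 : Matrix (Fin d) (Fin d) ℝ)).IsHermitian := fun c =>
    Matrix.isHermitian_one.smul (IsSelfAdjoint.all c)
  rw [H]
  split_ifs
  · exact h1 _
  · rw [Matrix.IsHermitian, Matrix.conjTranspose_sum]
    refine Finset.sum_congr rfl fun s _ => ?_
    rw [Matrix.conjTranspose_sum]
    refine Finset.sum_congr rfl fun i _ => ?_
    refine Matrix.IsHermitian.smul (Matrix.IsHermitian.add ?_ (h1 _)) (IsSelfAdjoint.all _)
    simpa using (Matrix.posSemidef_vecMulVec_self_star (I.φ s i (πs s i)).ofLp).1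

theorem posDef_H (hN : 0 < N) (hd : 0 < d) {lam0 : ℝ} (hlam : 0 < lam0) {t : ℕ}
    (ht : t ≤ T) {πs : ℕ → Alloc N K} {θ : Feat d}
    (hgood : ∀ s < t, ∀ i, |inner ℝ (I.feat s πs i) (θ - I.θs)| ≤ I.D + 1) :
    (I.H lam0 t πs θ).PosDef := by
  refine Matrix.PosDef.of_dotProduct_mulVec_pos (I.isHermitian_H lam0 t πs θ) fun x hx => ?_
  have h1 := I.kappa_mul_quad_le_quad_H hN hd hlam ht hgood (WithLp.toLp 2 x)
  have h2 := (I.posDef_smul_one_add_gram hlam t πs).dotProduct_mulVec_pos hx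
  simp only [star_trivial] at h2 ⊢
  exact (mul_pos I.kappa_pos' h2).trans_le h1

/-- On the good event the exploration covariance, up to the factor `κ_μ / L_μ`, is at least the
inverse of the regularized Gram matrix. -/
theorem invQuad_le_Lμ_mul_invQuad_H (hN : 0 < N) (hd : 0 < d) {lam0 : ℝ} (hlam : 0 < lam0) {t : ℕ}
    (ht : t ≤ T) {πs : ℕ → Alloc N K} {θ : Feat d}
    (hgood : ∀ s < t, ∀ i, |inner ℝ (I.feat s πs i) (θ - I.θs)| ≤ I.D + 1) (x : Feat d) :
    invQuad (lam0 • 1 + I.gram t πs) x ≤ I.Lμ * invQuad (I.H lam0 t πs θ) x :=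
  invQuad_le_mul_invQuad (I.posDef_smul_one_add_gram hlam t πs) (I.posDef_H hN hd hlam ht hgood)
    (I.Lμ_pos hd) (I.quad_H_le hN hlam t πs θ) x

theorem invQuad_H_le_kappa_inv_mul_invQuad (hN : 0 < N) (hd : 0 < d) {lam0 : ℝ} (hlam : 0 < lam0)
    {t : ℕ} (ht : t ≤ T) {πs : ℕ → Alloc N K} {θ : Feat d}
    (hgood : ∀ s < t, ∀ i, |inner ℝ (I.feat s πs i) (θ - I.θs)| ≤ I.D + 1) (x : Feat d) :
    invQuad (I.H lam0 t πs θ) x ≤ I.kappa⁻¹ * invQuad (lam0 • 1 + I.gram t πs) x := by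
  refine invQuad_le_mul_invQuad (I.posDef_H hN hd hlam ht hgood) (I.posDef_smul_one_add_gram hlam t πs)
    (inv_pos.2 I.kappa_pos') (fun w => ?_) x
  rw [inv_mul_eq_div, le_div_iff₀ I.kappa_pos', mul_comm]
  exact I.kappa_mul_quad_le_quad_H hN hd hlam ht hgood w

end CAB

section Perturbation
variable {N d : ℕ} {H : Matrix (Fin d) (Fin d) ℝ}

/-- A linear statistic of i.i.d. Gaussian perturbations with covariance `c H⁻¹`. -/
theorem map_sum_inner_pi_gaussian_inv (hH : H.PosDef) {c : ℝ} (hc : 0 ≤ c) (w : Fin N → Feat d) :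
    (Measure.pi fun _ : Fin N => multivariateGaussian 0 (c • H⁻¹)).map
      (fun e => ∑ i, inner ℝ (w i) (e i)) = gaussianReal 0 (c * ∑ i, invQuad H (w i)).toNNReal := by
  rw [map_sum_inner_pi_multivariateGaussian (hH.inv.posSemidef.smul hc) w, Finset.mul_sum]
  congr 2
  refine Finset.sum_congr rfl fun i _ => ?_
  rw [invQuad, Matrix.smul_mulVec, dotProduct_smul, smul_eq_mul]

theorem map_inner_pi_gaussian_inv (hH : H.PosDef) {c : ℝ} (hc : 0 ≤ c) (i : Fin N) (x : Feat d) :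
    (Measure.pi fun _ : Fin N => multivariateGaussian 0 (c • H⁻¹)).map
      (fun e => inner ℝ x (e i)) = gaussianReal 0 (c * invQuad H x).toNNReal := by
  have h := map_sum_inner_pi_gaussian_inv hH hc (N := N) (fun j => if j = i then x else 0)
  have e1 : ∀ e : Fin N → Feat d, ∑ j, inner ℝ ((if j = i then x else 0 : Feat d)) (e j) =
      (inner ℝ x (e i) : ℝ) := by
    intro e
    rw [Finset.sum_eq_single i (fun j _ hj => by simp [hj]) (by simp)]
    simp
  have e2 : ∑ j, invQuad H (if j = i then x else 0) = invQuad H x := by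
    rw [Finset.sum_eq_single i (fun j _ hj => by simp [hj, invQuad]) (by simp)]
    simp
  simp_rw [e1, e2] at h
  exact h

theorem integral_sum_inner_pi_gaussian_inv (hH : H.PosDef) {c : ℝ} (hc : 0 ≤ c) (w : Fin N → Feat d) :
    ∫ e, ∑ i, inner ℝ (w i) (e i) ∂(Measure.pi fun _ : Fin N => multivariateGaussian 0 (c • H⁻¹)) = 0 := by
  have hm : Measurable fun e : Fin N → Feat d => ∑ i, (inner ℝ (w i) (e i) : ℝ) := by fun_prop
  have h := integral_map hm.aemeasurable (μ := Measure.pi fun _ : Fin N => multivariateGaussian 0 (c • H⁻¹))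
    (f := fun x : ℝ => x) (by fun_prop)
  rw [map_sum_inner_pi_gaussian_inv hH hc, integral_id_gaussianReal] at h
  exact h.symm

theorem integrable_inner_pi_gaussian_inv (hH : H.PosDef) {c : ℝ} (hc : 0 ≤ c) (i : Fin N) (x : Feat d) :
    Integrable (fun e : Fin N → Feat d => (inner ℝ x (e i) : ℝ))
      (Measure.pi fun _ : Fin N => multivariateGaussian 0 (c • H⁻¹)) := by
  have hm : Measurable fun e : Fin N → Feat d => (inner ℝ x (e i) : ℝ) := by fun_prop
  have h := (integrable_map_measure (μ := Measure.pi fun _ : Fin N => multivariateGaussian 0 (c • H⁻¹))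
    (f := fun e : Fin N → Feat d => (inner ℝ x (e i) : ℝ)) (g := fun x : ℝ => x) (by fun_prop) hm.aemeasurable).1
  refine h ?_
  rw [map_inner_pi_gaussian_inv hH hc]
  exact (memLp_id_gaussianReal 1).integrable le_rfl

theorem integral_inner_excess_le (hH : H.PosDef) {c : ℝ} (hc : 0 ≤ c) (i : Fin N) (x : Feat d)
    {τ u : ℝ} (hτ : 0 ≤ τ) (hv : c * invQuad H x ≤ τ ^ 2) (hu : 0 < u) :
    ∫ e : Fin N → Feat d, max (|inner ℝ x (e i)| - τ * u) 0
      ∂(Measure.pi fun _ : Fin N => multivariateGaussian 0 (c • H⁻¹)) ≤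
      2 * τ / u * Real.exp (-(u ^ 2 / 2)) := by
  have hm : Measurable fun e : Fin N → Feat d => (inner ℝ x (e i) : ℝ) := by fun_prop
  have h := integral_map hm.aemeasurable (μ := Measure.pi fun _ : Fin N => multivariateGaussian 0 (c • H⁻¹))
    (f := fun x : ℝ => max (|x| - τ * u) 0) (by fun_prop)
  rw [map_inner_pi_gaussian_inv hH hc] at h
  rw [← h]
  refine integral_gaussianReal_excess_le hτ ?_ hu
  rw [Real.coe_toNNReal _ (mul_nonneg hc (hH.invQuad_nonneg x))]
  exact hv

/-- Anti-concentration of the perturbation. -/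
theorem pi_gaussian_inv_real_ge (hH : H.PosDef) {c : ℝ} (hc : 0 ≤ c) (w : Fin N → Feat d) {s : ℝ}
    (hs : s ^ 2 ≤ c * ∑ i, invQuad H (w i)) :
    11 / 100 ≤ (Measure.pi fun _ : Fin N => multivariateGaussian 0 (c • H⁻¹)).real
      {e | s ≤ ∑ i, inner ℝ (w i) (e i)} := by
  have hm : Measurable fun e : Fin N → Feat d => ∑ i, (inner ℝ (w i) (e i) : ℝ) := by fun_prop
  have h := map_measureReal_apply (μ := Measure.pi fun _ : Fin N => multivariateGaussian 0 (c • H⁻¹))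
    hm (measurableSet_Ici (a := s))
  rw [map_sum_inner_pi_gaussian_inv hH hc] at h
  refine (gaussianReal_real_Ici_ge ?_).trans h.le
  exact hs.trans (Real.le_coe_toNNReal _)

end Perturbation

/-! ### The elliptic potential -/

namespace CAB
variable {N K d T : ℕ} (I : CAB N K d T)

/-- The sum of the exploration bonuses `‖x_t(i)‖` of round `t`, in the norm dual to the regularized
Gram matrix of the past. -/
noncomputable def bonus (γ : ℝ) (t : ℕ) (πs : ℕ → Alloc N K) (ρ : Alloc N K) : ℝ :=
  ∑ i, √(invQuad (γ • 1 + I.gram t πs) (I.φ t i (ρ i)))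

theorem bonus_nonneg (γ : ℝ) (t : ℕ) (πs : ℕ → Alloc N K) (ρ : Alloc N K) : 0 ≤ I.bonus γ t πs ρ :=
  Finset.sum_nonneg fun _ _ => Real.sqrt_nonneg _

theorem invQuad_le_norm_sq_div {γ : ℝ} (hγ : 0 < γ) (t : ℕ) (πs : ℕ → Alloc N K) (x : Feat d) :
    invQuad (γ • 1 + I.gram t πs) x ≤ ‖x‖ ^ 2 / γ := by
  obtain ⟨w, -, h1, h2⟩ := (I.posDef_smul_one_add_gram hγ t πs).exists_invQuad_eq x
  have h3 : γ * ‖w‖ ^ 2 ≤ quad (γ • 1 + I.gram t πs) w := by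
    rw [quad_smul_one_add_gram]
    have : 0 ≤ ∑ s ∈ Finset.range t, ∑ i : Fin N, (inner ℝ (I.feat s πs i) w : ℝ) ^ 2 := by positivity
    linarith
  have h4 : inner ℝ x w ≤ ‖x‖ * ‖w‖ := real_inner_le_norm x w
  rw [le_div_iff₀ hγ]
  have h5 : 2 * γ * (‖x‖ * ‖w‖) ≤ ‖x‖ ^ 2 + γ ^ 2 * ‖w‖ ^ 2 := by nlinarith [sq_nonneg (‖x‖ - γ * ‖w‖)]
  nlinarith

theorem sqrt_invQuad_φ_le {γ : ℝ} (hγ : 0 < γ) {t : ℕ} (ht : t < T) (πs : ℕ → Alloc N K) (i : Fin N)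
    (k : Fin K) : √(invQuad (γ • 1 + I.gram t πs) (I.φ t i k)) ≤ 1 / √γ := by
  rw [← Real.sqrt_one, ← Real.sqrt_div zero_le_one]
  refine Real.sqrt_le_sqrt ((I.invQuad_le_norm_sq_div hγ t πs _).trans ?_)
  gcongr
  exact pow_le_one₀ (norm_nonneg _) (I.norm_φ_le t ht i k)

theorem bonus_le {γ : ℝ} (hγ : 0 < γ) {t : ℕ} (ht : t < T) (πs : ℕ → Alloc N K) (ρ : Alloc N K) :
    I.bonus γ t πs ρ ≤ N / √γ := by
  refine (Finset.sum_le_sum fun i _ => I.sqrt_invQuad_φ_le hγ ht πs i (ρ i)).trans (le_of_eq ?_)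
  simp [div_eq_mul_inv]

theorem bonus_sq_le {γ : ℝ} (hγ : 0 < γ) (t : ℕ) (πs : ℕ → Alloc N K) (ρ : Alloc N K) :
    I.bonus γ t πs ρ ^ 2 ≤ N * ∑ i, invQuad (γ • 1 + I.gram t πs) (I.φ t i (ρ i)) := by
  have h2 := sq_sum_le_card_mul_sum_sq (s := Finset.univ)
    (f := fun i => √(invQuad (γ • 1 + I.gram t πs) (I.φ t i (ρ i))))
  have h3 : ∀ i, √(invQuad (γ • 1 + I.gram t πs) (I.φ t i (ρ i))) ^ 2 =
      invQuad (γ • 1 + I.gram t πs) (I.φ t i (ρ i)) := fun i =>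
    Real.sq_sqrt ((I.posDef_smul_one_add_gram hγ t πs).invQuad_nonneg _)
  simp only [h3, Finset.card_univ, Fintype.card_fin] at h2
  exact h2

/-- Each round multiplies the determinant of the regularized Gram matrix by at least one plus the
sum of the squared bonuses of the round. -/
theorem sum_log_le (hd : 0 < d) {γ : ℝ} (hγ : 0 < γ) (πs : ℕ → Alloc N K) :
    ∑ t ∈ Finset.range T,
      Real.log (1 + ∑ i, invQuad (γ • 1 + I.gram t πs) (I.φ t i (πs t i))) ≤
      d * Real.log (1 + N * T / (d * γ)) := by
  have hd' : (0 : ℝ) < d := by exact_mod_cast hd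
  have hstep : ∀ t, Real.log (1 + ∑ i, invQuad (γ • 1 + I.gram t πs) (I.φ t i (πs t i))) ≤
      Real.log (γ • 1 + I.gram (t + 1) πs).det - Real.log (γ • 1 + I.gram t πs).det := by
    intro t
    have hV := I.posDef_smul_one_add_gram hγ t πs
    have h1 := det_mul_one_add_le_det_add hV fun i => I.feat t πs i
    have e : I.gram (t + 1) πs = I.gram t πs + ∑ i : Fin N,
        Matrix.vecMulVec (I.feat t πs i).ofLp (I.feat t πs i).ofLp := Finset.sum_range_succ _ _
    rw [e, ← add_assoc]
    have hpos : 0 < 1 + ∑ i, invQuad (γ • 1 + I.gram t πs) (I.φ t i (πs t i)) := by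
      have : 0 ≤ ∑ i, invQuad (γ • 1 + I.gram t πs) (I.φ t i (πs t i)) :=
        Finset.sum_nonneg fun i _ => hV.invQuad_nonneg _
      linarith
    have h2 := Real.log_le_log (mul_pos hV.det_pos hpos) h1
    rw [Real.log_mul hV.det_pos.ne' hpos.ne'] at h2
    linarith
  refine (Finset.sum_le_sum fun t _ => hstep t).trans ?_
  rw [Finset.sum_range_sub fun t => Real.log (γ • (1 : Matrix (Fin d) (Fin d) ℝ) + I.gram t πs).det]
  have h0 : (γ • (1 : Matrix (Fin d) (Fin d) ℝ) + I.gram 0 πs).det = γ ^ d := by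
    simp [gram]
  have hV := I.posDef_smul_one_add_gram hγ T πs
  have h1 := det_le_pow_trace_div hd hV.posSemidef
  have h2 : (γ • (1 : Matrix (Fin d) (Fin d) ℝ) + I.gram T πs).trace ≤ γ * d + N * T := by
    rw [Matrix.trace_add, Matrix.trace_smul, Matrix.trace_one, Fintype.card_fin, smul_eq_mul]
    linarith [I.trace_gram_le le_rfl πs]
  have h3 : (γ • (1 : Matrix (Fin d) (Fin d) ℝ) + I.gram T πs).trace / d ≤ γ * (1 + N * T / (d * γ)) := by
    rw [div_le_iff₀ hd']
    refine h2.trans (le_of_eq ?_)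
    field_simp
  have h4 : (γ • (1 : Matrix (Fin d) (Fin d) ℝ) + I.gram T πs).det ≤
      (γ * (1 + N * T / (d * γ))) ^ d :=
    h1.trans (pow_le_pow_left₀ (div_nonneg hV.posSemidef.trace_nonneg hd'.le) h3 d)
  have h5 := Real.log_le_log hV.det_pos h4
  have h6 := one_le_one_add_mul_div N T d hγ
  rw [Real.log_pow, Real.log_mul hγ.ne' (by linarith)] at h5
  rw [h0, Real.log_pow]
  linarith

/-- The elliptic potential bound. A round whose squared bonuses add up to more than one is counted
with the crude bound `N / √γ`; there are few of them. -/
theorem sum_bonus_le (hd : 0 < d) {γ : ℝ} (hγ : 0 < γ) (πs : ℕ → Alloc N K) :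
    ∑ t ∈ Finset.range T, I.bonus γ t πs (πs t) ≤
      √(2 * d * N * T * Real.log (1 + N * T / (d * γ)))
        + 2 * d * N / √γ * Real.log (1 + N * T / (d * γ)) := by
  set ℓ := Real.log (1 + N * T / (d * γ)) with hℓ
  let u : ℕ → ℝ := fun t => ∑ i, invQuad (γ • 1 + I.gram t πs) (I.φ t i (πs t i))
  have hu : ∀ t, 0 ≤ u t := fun t => Finset.sum_nonneg fun i _ =>
    (I.posDef_smul_one_add_gram hγ t πs).invQuad_nonneg _
  have hlog : ∀ t, 0 ≤ Real.log (1 + u t) := fun t => Real.log_nonneg (by linarith [hu t])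
  have hsum : ∑ t ∈ Finset.range T, Real.log (1 + u t) ≤ d * ℓ := I.sum_log_le hd hγ πs
  have hs0 : 0 < √γ := Real.sqrt_pos.2 hγ
  have hround : ∀ t ∈ Finset.range T, I.bonus γ t πs (πs t) ≤
      √(2 * N * Real.log (1 + u t)) + 2 * N / √γ * Real.log (1 + u t) := by
    intro t ht
    rcases le_or_gt (u t) 1 with h | h
    · have h1 : I.bonus γ t πs (πs t) ≤ √(2 * N * Real.log (1 + u t)) := by
        refine Real.le_sqrt_of_sq_le ?_
        refine (I.bonus_sq_le hγ t πs (πs t)).trans ?_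
        have h4 := Real.one_sub_inv_le_log_of_pos (show 0 < 1 + u t by linarith [hu t])
        have h5 : u t ≤ 2 * Real.log (1 + u t) := by
          have e : 1 - (1 + u t)⁻¹ = u t / (1 + u t) := by
            have := hu t
            field_simp; ring
          have : u t / 2 ≤ u t / (1 + u t) :=
            div_le_div_of_nonneg_left (hu t) (by linarith [hu t]) (by linarith)
          linarith
        calc (N : ℝ) * u t ≤ N * (2 * Real.log (1 + u t)) := by gcongr
          _ = _ := by ring
      have h2 : 0 ≤ 2 * N / √γ * Real.log (1 + u t) := mul_nonneg (by positivity) (hlog t)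
      linarith
    · have h1 := I.bonus_le hγ (Finset.mem_range.1 ht) πs (πs t)
      have h2 : 1 / 2 ≤ Real.log (1 + u t) := by
        have h4 := Real.one_sub_inv_le_log_of_pos (show 0 < 1 + u t by linarith [hu t])
        have : (1 + u t)⁻¹ ≤ 2⁻¹ := inv_anti₀ (by norm_num) (by linarith)
        linarith
      have h3 : (N : ℝ) / √γ = 2 * N / √γ * (1 / 2) := by ring
      have h4 : 2 * N / √γ * (1 / 2) ≤ 2 * N / √γ * Real.log (1 + u t) := by gcongr
      have h5 := Real.sqrt_nonneg (2 * N * Real.log (1 + u t))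
      linarith
  refine (Finset.sum_le_sum hround).trans ?_
  rw [Finset.sum_add_distrib, ← Finset.mul_sum]
  refine add_le_add ?_ ?_
  · refine Real.le_sqrt_of_sq_le ?_
    have h2 := sq_sum_le_card_mul_sum_sq (s := Finset.range T)
      (f := fun t => √(2 * N * Real.log (1 + u t)))
    have h3 : ∀ t, √(2 * N * Real.log (1 + u t)) ^ 2 = 2 * N * Real.log (1 + u t) := fun t =>
      Real.sq_sqrt (mul_nonneg (by positivity) (hlog t))
    simp only [h3, Finset.card_range, ← Finset.mul_sum] at h2
    refine h2.trans ?_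
    calc (T : ℝ) * (2 * N * ∑ t ∈ Finset.range T, Real.log (1 + u t)) ≤ T * (2 * N * (d * ℓ)) := by gcongr
      _ = _ := by ring
  · calc 2 * N / √γ * ∑ t ∈ Finset.range T, Real.log (1 + u t) ≤ 2 * N / √γ * (d * ℓ) := by gcongr
      _ = _ := by ring

theorem log_one_add_le_mul_log {d : ℕ} (hd : 0 < d) {z : ℝ} (hz : 0 ≤ z) :
    Real.log (1 + z) ≤ d * Real.log (1 + z / d) := by
  have hd' : (0 : ℝ) < d := by exact_mod_cast hd
  rw [← Real.log_pow]
  refine Real.log_le_log (by linarith) ?_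
  have h : (-2 : ℝ) ≤ z / d := by have : 0 ≤ z / d := by positivity
                                  linarith
  refine le_trans (le_of_eq ?_) (one_add_mul_le_pow h d)
  field_simp

/-- The regret rate is at least the crude bound on the bonuses of a single round. -/
theorem div_sqrt_le_potential {N d T : ℕ} (hd : 0 < d) (hT : 0 < T) {γ : ℝ} (hγ : 0 < γ) :
    N / √γ ≤ √(2 * d * N * T * Real.log (1 + N * T / (d * γ)))
        + 2 * d * N / √γ * Real.log (1 + N * T / (d * γ)) := by
  have hd' : (0 : ℝ) < d := by exact_mod_cast hd
  have hT' : (1 : ℝ) ≤ T := by exact_mod_cast hT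
  have hs0 : 0 < √γ := Real.sqrt_pos.2 hγ
  set ℓ := Real.log (1 + N * T / (d * γ)) with hℓ
  have hℓ0 : 0 ≤ ℓ := Real.log_nonneg (one_le_one_add_mul_div N T d hγ)
  set s : ℝ := N * T / γ with hs
  have hsn : 0 ≤ s := by positivity
  have h1 : Real.log (1 + s) ≤ d * ℓ := by
    have := log_one_add_le_mul_log hd hsn
    rwa [hs, div_div, mul_comm γ] at this
  have h2 := Real.one_sub_inv_le_log_of_pos (show 0 < 1 + s by linarith)
  rcases le_or_gt s 1 with h | h
  · have h3 : s / 2 ≤ d * ℓ := by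
      have e : 1 - (1 + s)⁻¹ = s / (1 + s) := by field_simp; ring
      have : s / 2 ≤ s / (1 + s) := div_le_div_of_nonneg_left hsn (by linarith) (by linarith)
      linarith
    have h4 : N / √γ ≤ √(2 * d * N * T * ℓ) := by
      refine Real.le_sqrt_of_sq_le ?_
      rw [div_pow, Real.sq_sqrt hγ.le]
      calc (N : ℝ) ^ 2 / γ = (N * 1) * (N * 1) / γ := by ring
        _ ≤ (N * T) * (N * T) / γ := by gcongr
        _ = 2 * N * T * (s / 2) := by rw [hs]; ring
        _ ≤ 2 * N * T * (d * ℓ) := by gcongr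
        _ = _ := by ring
    have : 0 ≤ 2 * d * N / √γ * ℓ := by positivity
    linarith
  · have h3 : 1 / 2 ≤ d * ℓ := by
      have : (1 + s)⁻¹ ≤ 2⁻¹ := inv_anti₀ (by norm_num) (by linarith)
      linarith
    have h4 : N / √γ ≤ 2 * d * N / √γ * ℓ := by
      calc (N : ℝ) / √γ = 2 * N / √γ * (1 / 2) := by ring
        _ ≤ 2 * N / √γ * (d * ℓ) := by gcongr
        _ = _ := by ring
    have := Real.sqrt_nonneg (2 * d * N * T * ℓ)
    linarith

end CAB

/-! ### The objective and the gain of the perturbed problem -/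

namespace CAB
variable {N K d T : ℕ} (I : CAB N K d T)

theorem load_nonneg (t : ℕ) (π : Alloc N K) (θ : Feat d) (a : Fin K) :
    0 ≤ ∑ i with π i = a, I.mean (inner ℝ (I.φ t i a) θ) :=
  Finset.sum_nonneg fun _ _ => I.mean_nonneg _

theorem M_nonneg : 0 ≤ I.M := (I.r_nonneg 0 le_rfl).trans (I.r_le 0 le_rfl)

theorem f_nonneg (t : ℕ) (π : Alloc N K) (θ : Feat d) : 0 ≤ I.f t π θ :=
  Finset.sum_nonneg fun a _ => I.r_nonneg _ (I.load_nonneg t π θ a)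

theorem f_le (t : ℕ) (π : Alloc N K) (θ : Feat d) : I.f t π θ ≤ K * I.M := by
  refine (Finset.sum_le_sum fun a _ => I.r_le _ (I.load_nonneg t π θ a)).trans (le_of_eq ?_)
  simp

theorem abs_f_le (t : ℕ) (π : Alloc N K) (θ : Feat d) : |I.f t π θ| ≤ K * I.M := by
  rw [abs_of_nonneg (I.f_nonneg t π θ)]; exact I.f_le t π θ

/-- At most `N` arms are in use, and an arm that is not in use contributes the least possible
satisfaction `r 0`. -/
theorem f_sub_f_le (t : ℕ) (ρ π : Alloc N K) (θ : Feat d) : I.f t ρ θ - I.f t π θ ≤ N * I.M := by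
  classical
  rw [f, f, ← Finset.sum_sub_distrib]
  have h : ∀ a ∈ Finset.univ, I.r (∑ i with ρ i = a, I.mean (inner ℝ (I.φ t i a) θ)) -
      I.r (∑ i with π i = a, I.mean (inner ℝ (I.φ t i a) θ)) ≤
      if a ∈ Finset.univ.image ρ then I.M else 0 := by
    intro a _
    have h0 := I.r_mono (Set.mem_Ici.2 le_rfl) (Set.mem_Ici.2 (I.load_nonneg t π θ a)) (I.load_nonneg t π θ a)
    split_ifs with ha
    · linarith [I.r_nonneg 0 le_rfl, I.r_le _ (I.load_nonneg t ρ θ a)]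
    · have : (Finset.univ.filter fun i => ρ i = a) = ∅ := by
        rw [Finset.filter_eq_empty_iff]
        intro i _ hi
        exact ha (Finset.mem_image.2 ⟨i, Finset.mem_univ i, hi⟩)
      rw [this, Finset.sum_empty]
      linarith
  refine (Finset.sum_le_sum h).trans ?_
  rw [Finset.sum_ite_mem, Finset.univ_inter, Finset.sum_const, nsmul_eq_mul]
  refine mul_le_mul_of_nonneg_right ?_ I.M_nonneg
  exact_mod_cast Finset.card_image_le.trans (le_of_eq (by simp))

/-- The objective is Lipschitz in the predicted scores of the chosen contexts. -/
theorem abs_f_sub_f_le (t : ℕ) (ρ : Alloc N K) (θ θ' : Feat d) :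
    |I.f t ρ θ - I.f t ρ θ'| ≤ I.Lr * I.Lμ * ∑ i, |inner ℝ (I.φ t i (ρ i)) (θ - θ')| := by
  have harm : ∀ a ∈ (Finset.univ : Finset (Fin K)),
      |I.r (∑ i with ρ i = a, I.mean (inner ℝ (I.φ t i a) θ)) -
        I.r (∑ i with ρ i = a, I.mean (inner ℝ (I.φ t i a) θ'))| ≤
      ∑ i with ρ i = a, I.Lr * I.Lμ * |inner ℝ (I.φ t i (ρ i)) (θ - θ')| := by
    intro a _
    have h1 := I.r_lipschitz.dist_le_mul _ (Set.mem_Ici.2 (I.load_nonneg t ρ θ a)) _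
      (Set.mem_Ici.2 (I.load_nonneg t ρ θ' a))
    rw [Real.dist_eq, Real.dist_eq, ← Finset.sum_sub_distrib] at h1
    refine h1.trans ?_
    rw [← Finset.mul_sum, mul_assoc, Finset.mul_sum]
    refine mul_le_mul_of_nonneg_left ((Finset.abs_sum_le_sum_abs _ _).trans
      (Finset.sum_le_sum fun i hi => ?_)) I.Lr.2
    rw [(Finset.mem_filter.1 hi).2, inner_sub_right]
    exact I.abs_mean_sub_le _ _
  rw [f, f, ← Finset.sum_sub_distrib]
  refine (Finset.abs_sum_le_sum_abs _ _).trans ((Finset.sum_le_sum harm).trans ?_)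
  rw [Finset.sum_fiberwise, ← Finset.mul_sum]

theorem measurable_f (t : ℕ) (ρ : Alloc N K) : Measurable fun θ => I.f t ρ θ := by
  refine (LipschitzWith.of_dist_le_mul
    (K := I.Lr * I.Lμ * ∑ i, ‖I.φ t i (ρ i)‖₊) fun θ θ' => ?_).continuous.measurable
  rw [Real.dist_eq, dist_eq_norm]
  refine (I.abs_f_sub_f_le t ρ θ θ').trans ?_
  push_cast
  rw [mul_assoc _ _ ‖θ - θ'‖, Finset.sum_mul]
  exact mul_le_mul_of_nonneg_left (Finset.sum_le_sum fun i _ =>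
    abs_real_inner_le_norm _ _) (by positivity : (0 : ℝ) ≤ I.Lr * I.Lμ)

theorem abs_f_sub_f_le_bonus {lam0 : ℝ} (hlam : 0 < lam0) (t : ℕ) (πs : ℕ → Alloc N K)
    (ρ : Alloc N K) (θ θ' : Feat d) :
    |I.f t ρ θ - I.f t ρ θ'| ≤
      I.Lr * I.Lμ * √(quad (lam0 • 1 + I.gram t πs) (θ - θ')) * I.bonus lam0 t πs ρ := by
  refine (I.abs_f_sub_f_le t ρ θ θ').trans ?_
  rw [mul_assoc _ _ (I.bonus lam0 t πs ρ), bonus,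
    Finset.mul_sum (Finset.univ) _ (√_)]
  refine mul_le_mul_of_nonneg_left (Finset.sum_le_sum fun i _ => ?_)
    (by positivity : (0 : ℝ) ≤ I.Lr * I.Lμ)
  rw [mul_comm]
  exact (I.posDef_smul_one_add_gram hlam t πs).abs_inner_le _ _

theorem abs_h_le (t : ℕ) (π : Alloc N K) (e : Fin N → Feat d) :
    |I.h t π e| ≤ ∑ i, |inner ℝ (I.φ t i (π i)) (e i)| := Finset.abs_sum_le_sum_abs _ _

theorem sum_abs_inner_le (t : ℕ) (π : Alloc N K) (e : Fin N → Feat d) :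
    ∑ i, |(inner ℝ (I.φ t i (π i)) (e i) : ℝ)| ≤ ∑ i, ∑ k, |(inner ℝ (I.φ t i k) (e i) : ℝ)| :=
  Finset.sum_le_sum fun i _ => Finset.single_le_sum
    (f := fun k => |(inner ℝ (I.φ t i k) (e i) : ℝ)|) (fun _ _ => abs_nonneg _) (Finset.mem_univ (π i))

/-- The value of the perturbed problem at `θ` in excess of the value of the unperturbed one. -/
noncomputable def gain (t : ℕ) (θ : Feat d) (e : Fin N → Feat d) : ℝ :=
  (⨆ ρ : Alloc N K, (I.f t ρ θ + I.h t ρ e)) - ⨆ ρ : Alloc N K, I.f t ρ θ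

theorem f_le_iSup (t : ℕ) (ρ : Alloc N K) (θ : Feat d) : I.f t ρ θ ≤ ⨆ ρ : Alloc N K, I.f t ρ θ :=
  le_ciSup (f := fun ρ : Alloc N K => I.f t ρ θ) (Set.finite_range _).bddAbove ρ

theorem f_add_h_sub_le_gain (t : ℕ) (ρ : Alloc N K) (θ : Feat d) (e : Fin N → Feat d) :
    I.f t ρ θ + I.h t ρ e - (⨆ ρ : Alloc N K, I.f t ρ θ) ≤ I.gain t θ e :=
  sub_le_sub_right (le_ciSup (f := fun ρ : Alloc N K => I.f t ρ θ + I.h t ρ e)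
    (Set.finite_range _).bddAbove ρ) _

theorem measurable_gain (t : ℕ) : Measurable fun p : Feat d × (Fin N → Feat d) => I.gain t p.1 p.2 := by
  have hh : ∀ ρ : Alloc N K, Measurable fun e : Fin N → Feat d => I.h t ρ e := fun ρ => by
    unfold h; fun_prop
  refine Measurable.sub (Measurable.iSup fun ρ => ?_) (Measurable.iSup fun ρ => ?_)
  · exact ((I.measurable_f t ρ).comp measurable_fst).add ((hh ρ).comp measurable_snd)
  · exact (I.measurable_f t ρ).comp measurable_fst

theorem exists_iSup_f_eq (hK : 0 < K) (t : ℕ) (θ : Feat d) :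
    ∃ ρ : Alloc N K, I.f t ρ θ = ⨆ ρ : Alloc N K, I.f t ρ θ := by
  have : Nonempty (Alloc N K) := ⟨fun _ => ⟨0, hK⟩⟩
  exact exists_eq_ciSup_of_finite

theorem gain_le_h (hK : 0 < K) (t : ℕ) {π : Alloc N K} {θ : Feat d} {e : Fin N → Feat d}
    (hmax : ∀ ρ : Alloc N K, I.f t ρ θ + I.h t ρ e ≤ I.f t π θ + I.h t π e) :
    I.gain t θ e ≤ I.f t π θ + I.h t π e - ⨆ ρ : Alloc N K, I.f t ρ θ := by
  have : Nonempty (Alloc N K) := ⟨fun _ => ⟨0, hK⟩⟩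
  exact sub_le_sub_right (ciSup_le hmax) _

theorem abs_gain_le (hK : 0 < K) (t : ℕ) (θ : Feat d) (e : Fin N → Feat d) :
    |I.gain t θ e| ≤ ∑ i, ∑ k, |(inner ℝ (I.φ t i k) (e i) : ℝ)| := by
  have : Nonempty (Alloc N K) := ⟨fun _ => ⟨0, hK⟩⟩
  have hh : ∀ ρ, |I.h t ρ e| ≤ ∑ i, ∑ k, |(inner ℝ (I.φ t i k) (e i) : ℝ)| := fun ρ =>
    (I.abs_h_le t ρ e).trans (I.sum_abs_inner_le t ρ e)
  rw [abs_le]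
  constructor
  · obtain ⟨ρ, hρ⟩ := I.exists_iSup_f_eq hK t θ
    have h1 := I.f_add_h_sub_le_gain t ρ θ e
    linarith [(abs_le.1 (hh ρ)).1]
  · rw [gain, sub_le_iff_le_add]
    refine ciSup_le fun ρ => ?_
    linarith [(abs_le.1 (hh ρ)).2, I.f_le_iSup t ρ θ]

section Conditional
variable {H : Matrix (Fin d) (Fin d) ℝ}

theorem integrable_sum_abs_inner (t : ℕ) (hH : H.PosDef) {c : ℝ} (hc : 0 ≤ c) :
    Integrable (fun e : Fin N → Feat d => ∑ i, ∑ k, |(inner ℝ (I.φ t i k) (e i) : ℝ)|)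
      (Measure.pi fun _ : Fin N => multivariateGaussian 0 (c • H⁻¹)) :=
  integrable_finsetSum _ fun i _ => integrable_finsetSum _ fun k _ =>
    (integrable_inner_pi_gaussian_inv hH hc i (I.φ t i k)).abs

theorem integrable_gain (hK : 0 < K) (t : ℕ) (θ : Feat d) (hH : H.PosDef) {c : ℝ} (hc : 0 ≤ c) :
    Integrable (I.gain t θ) (Measure.pi fun _ : Fin N => multivariateGaussian 0 (c • H⁻¹)) := by
  refine (I.integrable_sum_abs_inner t hH hc).mono'
    ((I.measurable_gain t).comp measurable_prodMk_left).aestronglyMeasurable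
    (Filter.Eventually.of_forall fun e => ?_)
  exact I.abs_gain_le hK t θ e

/-- The perturbation does not decrease the optimal value on average: the perturbed value of an
unperturbed optimum is unbiased. -/
theorem integral_gain_nonneg (hK : 0 < K) (t : ℕ) (θ : Feat d) (hH : H.PosDef) {c : ℝ} (hc : 0 ≤ c) :
    0 ≤ ∫ e, I.gain t θ e ∂(Measure.pi fun _ : Fin N => multivariateGaussian 0 (c • H⁻¹)) := by
  obtain ⟨ρ, hρ⟩ := I.exists_iSup_f_eq hK t θ
  have h0 : ∫ e, I.h t ρ e ∂(Measure.pi fun _ : Fin N => multivariateGaussian 0 (c • H⁻¹)) = 0 :=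
    integral_sum_inner_pi_gaussian_inv hH hc fun i => I.φ t i (ρ i)
  rw [← h0]
  refine integral_mono (integrable_finsetSum _ fun i _ =>
    integrable_inner_pi_gaussian_inv hH hc i (I.φ t i (ρ i))) (I.integrable_gain hK t θ hH hc) fun e => ?_
  have h1 := I.f_add_h_sub_le_gain t ρ θ e
  linarith

/-- Optimism: the perturbed value of `ρ` exceeds its unperturbed value by `s` with probability at
least `11 / 100`, so the shortfall of the estimated optimal value is paid for by the expected
positive part of the gain. -/
theorem f_add_sub_iSup_le (hK : 0 < K) (t : ℕ) (θ : Feat d) (hH : H.PosDef) {c : ℝ} (hc : 0 ≤ c)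
    (ρ : Alloc N K) {s : ℝ} (hs : s ^ 2 ≤ c * ∑ i, invQuad H (I.φ t i (ρ i))) :
    I.f t ρ θ + s - (⨆ ρ : Alloc N K, I.f t ρ θ) ≤
      100 / 11 * ∫ e, max (I.gain t θ e) 0
        ∂(Measure.pi fun _ : Fin N => multivariateGaussian 0 (c • H⁻¹)) := by
  set Q := Measure.pi fun _ : Fin N => multivariateGaussian (0 : Feat d) (c • H⁻¹) with hQ
  set A := I.f t ρ θ + s - (⨆ ρ : Alloc N K, I.f t ρ θ) with hA
  have hU0 : 0 ≤ ∫ e, max (I.gain t θ e) 0 ∂Q := integral_nonneg fun e => le_max_right _ _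
  rcases le_or_gt A 0 with h | h
  · exact h.trans (by positivity)
  · have hint : Integrable (fun e => max (I.gain t θ e) 0) Q := (I.integrable_gain hK t θ hH hc).pos_part
    have hE : MeasurableSet {e : Fin N → Feat d | s ≤ ∑ i, inner ℝ (I.φ t i (ρ i)) (e i)} :=
      measurableSet_le measurable_const (by fun_prop)
    have h1 := pi_gaussian_inv_real_ge hH hc (fun i => I.φ t i (ρ i)) hs
    have h2 : ∫ e, {e : Fin N → Feat d | s ≤ ∑ i, inner ℝ (I.φ t i (ρ i)) (e i)}.indicator
        (fun _ => A) e ∂Q ≤ ∫ e, max (I.gain t θ e) 0 ∂Q := by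
      refine integral_mono ((integrable_const A).indicator hE) hint fun e => ?_
      by_cases he : s ≤ ∑ i, inner ℝ (I.φ t i (ρ i)) (e i)
      · rw [Set.indicator_of_mem (by exact he)]
        refine le_trans ?_ (le_max_left _ _)
        have h3 := I.f_add_h_sub_le_gain t ρ θ e
        have h4 : s ≤ I.h t ρ e := he
        linarith
      · rw [Set.indicator_of_notMem (by exact he)]
        exact le_max_right _ _
    rw [integral_indicator_const _ hE, smul_eq_mul] at h2
    have h3 : 11 / 100 * A ≤ ∫ e, max (I.gain t θ e) 0 ∂Q := (mul_le_mul_of_nonneg_right h1 h.le).trans h2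
    linarith

end Conditional

end CAB

/-! ### The excess of the perturbations over the bonuses -/

section
variable {Ω S : Type*} {m : MeasurableSpace Ω} [mΩ : MeasurableSpace Ω]
    [MeasurableSpace S]
    [StandardBorelSpace S] [Nonempty S] {P : Measure Ω} [IsProbabilityMeasure P]
    {X : Ω → S} {Q : Ω → Measure S}
    [∀ ω, IsProbabilityMeasure (Q ω)]

/-- A uniform bound on the conditional expectations of a nonnegative function bounds its
expectation. -/
theorem HasCondLaw.integral_le (h : HasCondLaw P m X Q) (hm : m ≤ mΩ) (hX : Measurable X)
    {g : Ω → S → ℝ}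
    (hg : @Measurable (Ω × S) ℝ (@Prod.instMeasurableSpace Ω S m _) _ (Function.uncurry g))
    (h0 : ∀ ω e, 0 ≤ g ω e) (hint : ∀ ω, Integrable (g ω) (Q ω)) {B : ℝ} (hB0 : 0 ≤ B)
    (hB : ∀ ω, ∫ e, g ω e ∂(Q ω) ≤ B) :
    Integrable (fun ω => g ω (X ω)) P ∧ ∫ ω, g ω (X ω) ∂P ≤ B := by
  have hmX : @Measurable Ω (Ω × S) mΩ (@Prod.instMeasurableSpace Ω S m _) (fun ω => (ω, X ω)) :=
    Measurable.prodMk (measurable_id'' hm) hX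
  have hmeas : Measurable fun ω => g ω (X ω) := hg.comp hmX
  have hl : ∫⁻ ω, ENNReal.ofReal (g ω (X ω)) ∂P ≤ ENNReal.ofReal B := by
    rw [h.lintegral_eq hm hX (g := fun ω e => ENNReal.ofReal (g ω e)) (ENNReal.measurable_ofReal.comp hg)]
    calc ∫⁻ ω, ∫⁻ e, ENNReal.ofReal (g ω e) ∂(Q ω) ∂P ≤ ∫⁻ _, ENNReal.ofReal B ∂P := by
          refine lintegral_mono fun ω => ?_
          rw [← ofReal_integral_eq_lintegral_ofReal (hint ω) (Filter.Eventually.of_forall (h0 ω))]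
          exact ENNReal.ofReal_le_ofReal (hB ω)
      _ = ENNReal.ofReal B := by simp
  have hnn : 0 ≤ᵐ[P] fun ω => g ω (X ω) := Filter.Eventually.of_forall fun ω => h0 ω _
  refine ⟨⟨hmeas.aestronglyMeasurable, ?_⟩, ?_⟩
  · rw [hasFiniteIntegral_iff_ofReal hnn]
    exact hl.trans_lt ENNReal.ofReal_lt_top
  · rw [integral_eq_lintegral_of_nonneg_ae hnn hmeas.aestronglyMeasurable]
    exact ENNReal.toReal_le_of_le_ofReal hB0 hl
end

theorem measurable_uncurry_indicator {A B : Type*} [MeasurableSpace A] [MeasurableSpace B]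
    {G : Set A} (hG : MeasurableSet G) {F : A → B → ℝ} (hF : Measurable fun p : A × B => F p.1 p.2) :
    Measurable fun p : A × B => G.indicator (fun x => F x p.2) p.1 := by
  have e : (fun p : A × B => G.indicator (fun x => F x p.2) p.1) =
      (Prod.fst ⁻¹' G).indicator fun p : A × B => F p.1 p.2 := by
    funext p
    by_cases h : p.1 ∈ G
    · rw [Set.indicator_of_mem h, Set.indicator_of_mem (by exact h)]
    · rw [Set.indicator_of_notMem h, Set.indicator_of_notMem (by exact h)]
  rw [e]
  exact hF.indicator (measurable_fst hG)

namespace CAB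
variable {N K d T : ℕ} (I : CAB N K d T)

theorem measurable_indicator_gain {Ω : Type*} {m : MeasurableSpace Ω} {G : Set Ω}
    (hG : MeasurableSet[m] G) {θ : Ω → Feat d} (hθ : Measurable[m] θ) (t : ℕ) :
    @Measurable (Ω × (Fin N → Feat d)) ℝ (@Prod.instMeasurableSpace Ω _ m _) _
      (fun p => G.indicator (fun ω => I.gain t (θ ω) p.2) p.1) := by
  have h2 : Measurable fun p : Ω × (Fin N → Feat d) => (θ p.1, p.2) :=
    (hθ.comp measurable_fst).prodMk measurable_snd
  have h1 : Measurable ((fun q : Feat d × (Fin N → Feat d) => I.gain t q.1 q.2) ∘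
      fun p : Ω × (Fin N → Feat d) => (θ p.1, p.2)) := (I.measurable_gain t).comp h2
  exact measurable_uncurry_indicator hG (F := fun ω e => I.gain t (θ ω) e) h1

/-- The part of the perturbed scores that exceeds `c` times the bonuses, over all users and arms. -/
noncomputable def excess (γ c : ℝ) (t : ℕ) (πs : ℕ → Alloc N K) (e : Fin N → Feat d) : ℝ :=
  ∑ i, ∑ k, max (|inner ℝ (I.φ t i k) (e i)| - c * √(invQuad (γ • 1 + I.gram t πs) (I.φ t i k))) 0

theorem excess_nonneg (γ c : ℝ) (t : ℕ) (πs : ℕ → Alloc N K) (e : Fin N → Feat d) :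
    0 ≤ I.excess γ c t πs e :=
  Finset.sum_nonneg fun _ _ => Finset.sum_nonneg fun _ _ => le_max_right _ _

theorem sum_abs_inner_le_bonus_add_excess (γ c : ℝ) (t : ℕ) (πs : ℕ → Alloc N K) (ρ : Alloc N K)
    (e : Fin N → Feat d) :
    ∑ i, |(inner ℝ (I.φ t i (ρ i)) (e i) : ℝ)| ≤ c * I.bonus γ t πs ρ + I.excess γ c t πs e := by
  rw [bonus, excess, Finset.mul_sum, ← Finset.sum_add_distrib]
  refine Finset.sum_le_sum fun i _ => ?_
  have h1 := Finset.single_le_sum (f := fun k => max (|(inner ℝ (I.φ t i k) (e i) : ℝ)|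
    - c * √(invQuad (γ • 1 + I.gram t πs) (I.φ t i k))) 0) (fun _ _ => le_max_right _ _)
    (Finset.mem_univ (ρ i))
  beta_reduce at h1
  linarith [le_max_left (|(inner ℝ (I.φ t i (ρ i)) (e i) : ℝ)|
    - c * √(invQuad (γ • 1 + I.gram t πs) (I.φ t i (ρ i)))) 0]

theorem sum_sum_abs_inner_le_excess_add {γ c : ℝ} (hγ : 0 < γ) (hc : 0 ≤ c) {t : ℕ} (ht : t < T)
    (πs : ℕ → Alloc N K) (e : Fin N → Feat d) :
    ∑ i, ∑ k, |(inner ℝ (I.φ t i k) (e i) : ℝ)| ≤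
      I.excess γ c t πs e + N * (K * (c * (1 / √γ))) := by
  have hsum : (N * (K * (c * (1 / √γ))) : ℝ) = ∑ _i : Fin N, ∑ _k : Fin K, c * (1 / √γ) := by simp
  rw [hsum, CAB.excess, ← Finset.sum_add_distrib]
  refine Finset.sum_le_sum fun i _ => ?_
  rw [← Finset.sum_add_distrib]
  refine Finset.sum_le_sum fun k _ => ?_
  have h1 := mul_le_mul_of_nonneg_left (I.sqrt_invQuad_φ_le hγ ht πs i k) hc
  linarith [le_max_left (|(inner ℝ (I.φ t i k) (e i) : ℝ)| -
    c * √(invQuad (γ • 1 + I.gram t πs) (I.φ t i k))) 0]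

theorem measurable_indicator_excess (hK : 0 < K) {Ω : Type*} {m : MeasurableSpace Ω}
    {π : ℕ → Ω → Alloc N K} {t : ℕ} (hπ : ∀ s < t, Measurable[m] (π s)) {G : Set Ω}
    (hG : MeasurableSet[m] G) (γ c : ℝ) :
    @Measurable (Ω × (Fin N → Feat d)) ℝ (@Prod.instMeasurableSpace Ω _ m _) _
      (fun p => G.indicator (fun ω => I.excess γ c t (fun s => π s ω) p.2) p.1) := by
  have h1 : Measurable fun p : Ω × (Fin N → Feat d) => I.excess γ c t (fun s => π s p.1) p.2 := by
    refine Finset.measurable_sum _ fun i _ => Finset.measurable_sum _ fun k _ => ?_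
    have h2 := (I.measurable_invQuad_gram hK hπ γ (measurable_const (a := I.φ t i k))).sqrt
    have h3 : Measurable fun p : Ω × (Fin N → Feat d) => |(inner ℝ (I.φ t i k) (p.2 i) : ℝ)| := by
      fun_prop
    exact (h3.sub ((h2.comp measurable_fst).const_mul c)).max measurable_const
  exact measurable_uncurry_indicator hG (F := fun ω e => I.excess γ c t (fun s => π s ω) e) h1

end CAB

namespace CABTSRun
variable {N K d T : ℕ} {I : CAB N K d T} {lam0 a : ℝ} {Ω : Type*} [mΩ : MeasurableSpace Ω]
  {P : Measure Ω} (R : CABTSRun I lam0 a P)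

/-- The conditional law of the perturbations of round `t` given the past. -/
noncomputable abbrev law (t : ℕ) (ω : Ω) : Measure (Fin N → Feat d) :=
  Measure.pi fun _ : Fin N =>
    multivariateGaussian 0 (a ^ 2 • (I.H lam0 t (fun s => R.π s ω) (R.θbar t ω))⁻¹)

theorem posDef_H (hN : 0 < N) (hd : 0 < d) (hlam : 0 < lam0) {t : ℕ} (ht : t < T) {ω : Ω}
    (hω : ω ∈ R.good t) : (I.H lam0 t (fun s => R.π s ω) (R.θbar t ω)).PosDef :=
  I.posDef_H hN hd hlam ht.le hω

theorem integrable_excess (hN : 0 < N) (hd : 0 < d) (hlam : 0 < lam0) {t : ℕ} (ht : t < T) (c : ℝ)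
    {ω : Ω} (hω : ω ∈ R.good t) :
    Integrable (I.excess lam0 c t fun s => R.π s ω) (R.law t ω) := by
  have := fun i : Fin N => (isGaussian_multivariateGaussian (μ := (0 : Feat d))
    (S := a ^ 2 • (I.H lam0 t (fun s => R.π s ω) (R.θbar t ω))⁻¹))
  exact integrable_finsetSum _ fun i _ => integrable_finsetSum _ fun k _ =>
    ((integrable_inner_pi_gaussian_inv (R.posDef_H hN hd hlam ht hω) (sq_nonneg a) i
      (I.φ t i k)).abs.sub (integrable_const _)).pos_part

theorem integral_excess_le (hN : 0 < N) (hd : 0 < d) (hlam : 0 < lam0) {t : ℕ} (ht : t < T)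
    {τ u : ℝ} (hτ : 0 ≤ τ) (hu : 0 < u) (ha : a ^ 2 * I.kappa⁻¹ ≤ τ ^ 2) {ω : Ω}
    (hω : ω ∈ R.good t) :
    ∫ e, I.excess lam0 (τ * u) t (fun s => R.π s ω) e ∂(R.law t ω) ≤
      N * (K * (2 * (τ * (1 / √lam0)) / u * Real.exp (-(u ^ 2 / 2)))) := by
  have hH := R.posDef_H hN hd hlam ht hω
  have hint : ∀ (i : Fin N) (k : Fin K), Integrable (fun e : Fin N → Feat d =>
      max (|inner ℝ (I.φ t i k) (e i)| -
        τ * u * √(invQuad (lam0 • 1 + I.gram t fun s => R.π s ω) (I.φ t i k))) 0) (R.law t ω) :=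
    fun i k => ((integrable_inner_pi_gaussian_inv hH (sq_nonneg a) i
      (I.φ t i k)).abs.sub (integrable_const _)).pos_part
  have hle : ∀ (i : Fin N) (k : Fin K), ∫ e : Fin N → Feat d,
      max (|inner ℝ (I.φ t i k) (e i)| -
        τ * u * √(invQuad (lam0 • 1 + I.gram t fun s => R.π s ω) (I.φ t i k))) 0 ∂(R.law t ω) ≤
      2 * (τ * (1 / √lam0)) / u * Real.exp (-(u ^ 2 / 2)) := by
    intro i k
    set b := √(invQuad (lam0 • 1 + I.gram t fun s => R.π s ω) (I.φ t i k)) with hb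
    have hb2 : b ^ 2 = invQuad (lam0 • 1 + I.gram t fun s => R.π s ω) (I.φ t i k) :=
      Real.sq_sqrt ((I.posDef_smul_one_add_gram hlam t _).invQuad_nonneg _)
    have h1 : a ^ 2 * invQuad (I.H lam0 t (fun s => R.π s ω) (R.θbar t ω)) (I.φ t i k) ≤ (τ * b) ^ 2 := by
      have h2 := I.invQuad_H_le_kappa_inv_mul_invQuad hN hd hlam ht.le hω (I.φ t i k)
      calc _ ≤ a ^ 2 * (I.kappa⁻¹ * b ^ 2) := by rw [hb2]; gcongr
        _ = a ^ 2 * I.kappa⁻¹ * b ^ 2 := by ring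
        _ ≤ τ ^ 2 * b ^ 2 := by gcongr
        _ = (τ * b) ^ 2 := by ring
    have h3 := integral_inner_excess_le hH (sq_nonneg a) i (I.φ t i k)
      (mul_nonneg hτ (Real.sqrt_nonneg _)) h1 hu
    rw [show τ * u * b = τ * b * u by ring]
    refine h3.trans ?_
    have := I.sqrt_invQuad_φ_le hlam ht (fun s => R.π s ω) i k
    gcongr
  unfold CAB.excess
  rw [integral_finsetSum _ fun i _ => integrable_finsetSum _ fun k _ => hint i k]
  calc _ ≤ ∑ i : Fin N, (K * (2 * (τ * (1 / √lam0)) / u * Real.exp (-(u ^ 2 / 2))) : ℝ) := by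
        refine Finset.sum_le_sum fun i _ => ?_
        rw [integral_finsetSum _ fun k _ => hint i k]
        refine (Finset.sum_le_sum fun k _ => hle i k).trans (le_of_eq ?_)
        simp
    _ = _ := by simp

variable [IsProbabilityMeasure P]

theorem integrable_indicator_excess (hN : 0 < N) (hK : 0 < K) (hd : 0 < d) (hlam : 0 < lam0) {t : ℕ}
    (ht : t < T) {τ u : ℝ} (hτ : 0 ≤ τ) (hu : 0 < u) (ha : a ^ 2 * I.kappa⁻¹ ≤ τ ^ 2) :
    Integrable ((R.good t).indicator fun ω => I.excess lam0 (τ * u) t (fun s => R.π s ω) (R.ε t ω)) P ∧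
    ∫ ω, (R.good t).indicator (fun ω => I.excess lam0 (τ * u) t (fun s => R.π s ω) (R.ε t ω)) ω ∂P ≤
      N * (K * (2 * (τ * (1 / √lam0)) / u * Real.exp (-(u ^ 2 / 2)))) := by
  classical
  have h := (R.law_ε t ht).integral_le (R.past_le ht.le) (R.measurable_ε t ht)
    (g := fun ω e => (R.good t).indicator (fun ω => I.excess lam0 (τ * u) t (fun s => R.π s ω) e) ω)
    (I.measurable_indicator_excess hK (fun _ hs => measurable_π_history hs)
      (R.measurableSet_good ht) lam0 (τ * u))
    (fun ω e => Set.indicator_nonneg (fun _ _ => I.excess_nonneg _ _ _ _ _) _)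
    (fun ω => ?_) (B := N * (K * (2 * (τ * (1 / √lam0)) / u * Real.exp (-(u ^ 2 / 2)))))
    (by positivity) (fun ω => ?_)
  · exact h
  · by_cases hω : ω ∈ R.good t
    · simp only [Set.indicator_of_mem hω]
      exact R.integrable_excess hN hd hlam ht _ hω
    · simp only [Set.indicator_of_notMem hω]
      exact integrable_zero _ _ _
  · by_cases hω : ω ∈ R.good t
    · simp only [Set.indicator_of_mem hω]
      exact R.integral_excess_le hN hd hlam ht hτ hu ha hω
    · simp only [Set.indicator_of_notMem hω, integral_zero]
      positivity

end CABTSRun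

/-! ### Optimism on the good event -/

namespace CAB
variable {N K d T : ℕ} (I : CAB N K d T)

theorem c₁_nonneg {lam0 δ : ℝ} : 0 ≤ I.c₁ lam0 δ := by
  have := I.kappa_pos'
  have := I.D_pos
  unfold c₁
  positivity

theorem c₂_nonneg {lam0 δ : ℝ} : 0 ≤ I.c₂ lam0 δ :=
  mul_nonneg I.c₁_nonneg (Real.sqrt_nonneg _)

end CAB

namespace CABTSRun
variable {N K d T : ℕ} {I : CAB N K d T} {lam0 a : ℝ} {Ω : Type*} [mΩ : MeasurableSpace Ω]
  {P : Measure Ω} (R : CABTSRun I lam0 a P)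

/-- The amount by which the dual norm of the score exceeds `β`, in units of the objective. -/
noncomputable def scoreExcess (β : ℝ) (t : ℕ) (ω : Ω) : ℝ :=
  I.Lr * I.Lμ / I.kappa * max (√(invQuad (R.V lam0 t ω) (R.S t ω)) - β) 0

theorem scoreExcess_nonneg (β : ℝ) (t : ℕ) (ω : Ω) : 0 ≤ R.scoreExcess β t ω := by
  have := I.kappa_pos'
  exact mul_nonneg (by positivity) (le_max_right _ _)

theorem measurable_scoreExcess (hK : 0 < K) (β : ℝ) {t : ℕ} (ht : t ≤ T) :
    Measurable (R.scoreExcess β t) := by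
  have h := I.measurable_invQuad_gram hK (fun s hs => R.measurable_π s (hs.trans_le ht)) lam0
    (R.measurable_S ht)
  exact ((h.sqrt.sub_const β).max measurable_const).const_mul _

/-- On the good event the objective is estimated up to the bonus. -/
theorem abs_f_sub_f_le_of_good (hd : 0 < d) (hlam : 0 < lam0) {t : ℕ} (ht : t < T) {ω : Ω}
    (hmin : ∀ θ : Feat d,
      I.regNLL t (fun s => R.π s ω) (fun s => R.y s ω) (I.kappa * lam0) (R.θbar t ω) ≤
      I.regNLL t (fun s => R.π s ω) (fun s => R.y s ω) (I.kappa * lam0) θ)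
    (hω : ω ∈ R.good t) (β : ℝ) (ρ : Alloc N K) :
    |I.f t ρ (R.θbar t ω) - I.f t ρ I.θs| ≤
      I.Lr * I.Lμ / I.kappa * (β + I.kappa * I.D * √lam0) * I.bonus lam0 t (fun s => R.π s ω) ρ
        + R.scoreExcess β t ω * (N / √lam0) := by
  have hκ := I.kappa_pos'
  have h1 := I.kappa_mul_sqrt_quad_le hd ht.le hlam hmin hω
  have h2 := I.abs_f_sub_f_le_bonus hlam t (fun s => R.π s ω) ρ (R.θbar t ω) I.θs
  have hb := I.bonus_le hlam ht (fun s => R.π s ω) ρ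
  have hb0 := I.bonus_nonneg lam0 t (fun s => R.π s ω) ρ
  have hX := R.scoreExcess_nonneg β t ω
  have hL : (0 : ℝ) ≤ I.Lr * I.Lμ / I.kappa := by positivity
  have h3 : I.Lr * I.Lμ * √(quad (lam0 • 1 + I.gram t fun s => R.π s ω) (R.θbar t ω - I.θs)) ≤
      I.Lr * I.Lμ / I.kappa * (β + I.kappa * I.D * √lam0) + R.scoreExcess β t ω := by
    have h4 : √(invQuad (R.V lam0 t ω) (R.S t ω)) ≤
      β + max (√(invQuad (R.V lam0 t ω) (R.S t ω)) - β) 0 := by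
      linarith [le_max_left (√(invQuad (R.V lam0 t ω) (R.S t ω)) - β) 0]
    calc _ = I.Lr * I.Lμ / I.kappa *
          (I.kappa * √(quad (lam0 • 1 + I.gram t fun s => R.π s ω) (R.θbar t ω - I.θs))) := by
          field_simp
      _ ≤ I.Lr * I.Lμ / I.kappa * ((β + max (√(invQuad (R.V lam0 t ω) (R.S t ω)) - β) 0) +
            I.kappa * (√lam0 * I.D)) := by
          refine mul_le_mul_of_nonneg_left (h1.trans ?_) hL
          exact add_le_add_left h4 _
      _ = _ := by rw [scoreExcess]; ring
  calc _ ≤ _ := h2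
    _ ≤ (I.Lr * I.Lμ / I.kappa * (β + I.kappa * I.D * √lam0) + R.scoreExcess β t ω) *
        I.bonus lam0 t (fun s => R.π s ω) ρ := by gcongr
    _ ≤ _ := by
      rw [add_mul]
      gcongr

/-- On the good event the optimal value exceeds its estimate by at most a multiple of the expected
positive part of the gain. -/
theorem iSup_f_sub_iSup_f_le (hN : 0 < N) (hK : 0 < K) (hd : 0 < d) (hlam : 0 < lam0) {t : ℕ}
    (ht : t < T) {ω : Ω} (hω : ω ∈ R.good t) {c x : ℝ} (ha : c ^ 2 * N * I.Lμ ≤ a ^ 2)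
    (hf : ∀ ρ, |I.f t ρ (R.θbar t ω) - I.f t ρ I.θs| ≤
      c * I.bonus lam0 t (fun s => R.π s ω) ρ + x) :
    (⨆ ρ : Alloc N K, I.f t ρ I.θs) - (⨆ ρ : Alloc N K, I.f t ρ (R.θbar t ω)) ≤
      x + 100 / 11 * ∫ e, max (I.gain t (R.θbar t ω) e) 0 ∂(R.law t ω) := by
  have hH := R.posDef_H hN hd hlam ht hω
  obtain ⟨ρ, hρ⟩ := I.exists_iSup_f_eq hK t I.θs
  set b := I.bonus lam0 t (fun s => R.π s ω) ρ with hb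
  have hs : (c * b) ^ 2 ≤
      a ^ 2 * ∑ i, invQuad (I.H lam0 t (fun s => R.π s ω) (R.θbar t ω)) (I.φ t i (ρ i)) := by
    have h1 := I.bonus_sq_le hlam t (fun s => R.π s ω) ρ
    have h3 : ∑ i, invQuad (lam0 • 1 + I.gram t fun s => R.π s ω) (I.φ t i (ρ i)) ≤
        I.Lμ * ∑ i, invQuad (I.H lam0 t (fun s => R.π s ω) (R.θbar t ω)) (I.φ t i (ρ i)) := by
      rw [Finset.mul_sum]
      exact Finset.sum_le_sum fun i _ => I.invQuad_le_Lμ_mul_invQuad_H hN hd hlam ht.le hω _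
    have h4 : 0 ≤ ∑ i, invQuad (I.H lam0 t (fun s => R.π s ω) (R.θbar t ω)) (I.φ t i (ρ i)) :=
      Finset.sum_nonneg fun i _ => hH.invQuad_nonneg _
    calc (c * b) ^ 2 = c ^ 2 * b ^ 2 := by ring
      _ ≤ c ^ 2 * (N * (I.Lμ *
          ∑ i, invQuad (I.H lam0 t (fun s => R.π s ω) (R.θbar t ω)) (I.φ t i (ρ i)))) := by
        refine mul_le_mul_of_nonneg_left (h1.trans ?_) (sq_nonneg c)
        gcongr
      _ = c ^ 2 * N * I.Lμ *
          ∑ i, invQuad (I.H lam0 t (fun s => R.π s ω) (R.θbar t ω)) (I.φ t i (ρ i)) := by ring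
      _ ≤ _ := by gcongr
  have h5 := I.f_add_sub_iSup_le hK t (R.θbar t ω) hH (sq_nonneg a) ρ hs
  have h6 := (abs_le.1 (hf ρ)).1
  rw [← hρ]
  linarith

theorem measurable_bonus (hK : 0 < K) {t : ℕ} (ht : t < T) :
    Measurable fun ω => I.bonus lam0 t (fun s => R.π s ω) (R.π t ω) := by
  refine Finset.measurable_sum _ fun i _ => ?_
  exact (I.measurable_invQuad_gram hK (fun s hs => R.measurable_π s (hs.trans ht)) lam0
    ((measurable_of_finite fun ρ : Alloc N K => I.φ t i (ρ i)).comp (R.measurable_π t ht))).sqrt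

variable [IsProbabilityMeasure P]

theorem integrable_scoreExcess (hK : 0 < K) (hd : 0 < d) (hlam : 0 < lam0) {δ β : ℝ} (hδ : 0 < δ)
    (hδ' : δ < 3 / 40) {t : ℕ} (ht : t ≤ T)
    (hβ : β = I.σ * √(d * Real.log (1 + N * T / (d * lam0)) + 2 * Real.log (1 / δ))) :
    Integrable (R.scoreExcess β t) P ∧
      ∫ ω, R.scoreExcess β t ω ∂P ≤ I.Lr * I.Lμ / I.kappa * (β * δ) := by
  have hκ := I.kappa_pos'
  have hβ0 : 0 ≤ β := by rw [hβ]; positivity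
  have hL : (0 : ℝ) ≤ I.Lr * I.Lμ / I.kappa := by positivity
  have hnn : 0 ≤ᵐ[P] R.scoreExcess β t := Filter.Eventually.of_forall (R.scoreExcess_nonneg β t)
  have hmeas := (R.measurable_scoreExcess hK β ht).aestronglyMeasurable (μ := P)
  have hl : ∫⁻ ω, ENNReal.ofReal (R.scoreExcess β t ω) ∂P ≤
      ENNReal.ofReal (I.Lr * I.Lμ / I.kappa * (β * δ)) := by
    have h1 : ∀ ω, ENNReal.ofReal (R.scoreExcess β t ω) = ENNReal.ofReal (I.Lr * I.Lμ / I.kappa) *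
        ENNReal.ofReal (√(invQuad (R.V lam0 t ω) (R.S t ω)) - β) := by
      intro ω
      rw [scoreExcess, ENNReal.ofReal_mul hL]
      congr 1
      rcases le_total (√(invQuad (R.V lam0 t ω) (R.S t ω)) - β) 0 with h | h
      · rw [max_eq_right h, ENNReal.ofReal_zero, ENNReal.ofReal_of_nonpos h]
      · rw [max_eq_left h]
    simp_rw [h1]
    rw [lintegral_const_mul' _ _ ENNReal.ofReal_ne_top, ENNReal.ofReal_mul hL]
    gcongr
    exact R.lintegral_sqrt_invQuad_sub_le hd hlam hδ hδ' ht hβ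
  refine ⟨⟨hmeas, ?_⟩, ?_⟩
  · rw [hasFiniteIntegral_iff_ofReal hnn]
    exact hl.trans_lt ENNReal.ofReal_lt_top
  · rw [integral_eq_lintegral_of_nonneg_ae hnn hmeas]
    exact ENNReal.toReal_le_of_le_ofReal (by positivity) hl

theorem integrable_bonus (hK : 0 < K) (hlam : 0 < lam0) {t : ℕ} (ht : t < T) :
    Integrable (fun ω => I.bonus lam0 t (fun s => R.π s ω) (R.π t ω)) P := by
  refine Integrable.of_bound (R.measurable_bonus hK ht).aestronglyMeasurable (N / √lam0)
    (Filter.Eventually.of_forall fun ω => ?_)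
  rw [Real.norm_of_nonneg (I.bonus_nonneg _ _ _ _)]
  exact I.bonus_le hlam ht _ _

/-- The expected positive part of the gain and the nonnegativity of its expectation, for the
perturbation that is actually drawn. -/
theorem integrable_indicator_gain (hN : 0 < N) (hK : 0 < K) (hd : 0 < d) (hlam : 0 < lam0) {t : ℕ}
    (ht : t < T) :
    Integrable ((R.good t).indicator fun ω => I.gain t (R.θbar t ω) (R.ε t ω)) P ∧
    0 ≤ ∫ ω, (R.good t).indicator (fun ω => I.gain t (R.θbar t ω) (R.ε t ω)) ω ∂P ∧
    Integrable ((R.good t).indicator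
      fun ω => ∫ e, max (I.gain t (R.θbar t ω) e) 0 ∂(R.law t ω)) P ∧
    ∫ ω, (R.good t).indicator
      (fun ω => ∫ e, max (I.gain t (R.θbar t ω) e) 0 ∂(R.law t ω)) ω ∂P =
    ∫ ω, max ((R.good t).indicator (fun ω => I.gain t (R.θbar t ω) (R.ε t ω)) ω) 0 ∂P := by
  have hκ := I.kappa_pos'
  have hexc := (R.integrable_indicator_excess hN hK hd hlam ht (τ := √(a ^ 2 * I.kappa⁻¹)) (u := 1)
    (Real.sqrt_nonneg _) one_pos (Real.sq_sqrt (by positivity)).ge).1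
  have hτ0 : 0 ≤ √(a ^ 2 * I.kappa⁻¹) * 1 := by positivity
  generalize √(a ^ 2 * I.kappa⁻¹) * 1 = c at hexc hτ0
  obtain ⟨Y, hY⟩ : ∃ Y : Ω → (Fin N → Feat d) → ℝ, Y = fun ω e =>
    (R.good t).indicator (fun ω => I.gain t (R.θbar t ω) e) ω := ⟨_, rfl⟩
  have hYin : ∀ ω ∈ R.good t, ∀ e, Y ω e = I.gain t (R.θbar t ω) e := fun ω hω e => by
    rw [hY]; exact Set.indicator_of_mem hω _
  have hYout : ∀ ω ∉ R.good t, ∀ e, Y ω e = 0 := fun ω hω e => by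
    rw [hY]; exact Set.indicator_of_notMem hω _
  have hYm := I.measurable_indicator_gain (R.measurableSet_good ht) (R.measurable_θbar t ht) t
  have hYm' : @Measurable (Ω × (Fin N → Feat d)) ℝ (@Prod.instMeasurableSpace Ω _ (R.past t) _) _
      (Function.uncurry Y) := by rw [hY]; exact hYm
  have hYε : ((R.good t).indicator fun ω => I.gain t (R.θbar t ω) (R.ε t ω)) =
      fun ω => Y ω (R.ε t ω) := by
    funext ω
    by_cases hω : ω ∈ R.good t
    · rw [hYin ω hω, Set.indicator_of_mem hω]
    · rw [hYout ω hω, Set.indicator_of_notMem hω]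
  clear hY hYm
  have hm := R.past_le ht.le
  have hmX : @Measurable Ω (Ω × (Fin N → Feat d)) mΩ (@Prod.instMeasurableSpace Ω _ (R.past t) _)
      (fun ω => (ω, R.ε t ω)) := Measurable.prodMk (measurable_id'' hm) (R.measurable_ε t ht)
  have hYmeas : Measurable fun ω => Y ω (R.ε t ω) := hYm'.comp hmX
  have hYint : Integrable (fun ω => Y ω (R.ε t ω)) P := by
    refine (hexc.add (integrable_const (N * (K * (c * (1 / √lam0)))))).mono'
      hYmeas.aestronglyMeasurable (Filter.Eventually.of_forall fun ω => ?_)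
    by_cases hω : ω ∈ R.good t
    · rw [hYin ω hω, Pi.add_apply, Set.indicator_of_mem hω, Real.norm_eq_abs]
      exact (I.abs_gain_le hK t _ _).trans (I.sum_sum_abs_inner_le_excess_add hlam hτ0 ht _ _)
    · rw [hYout ω hω, Pi.add_apply, Set.indicator_of_notMem hω, norm_zero, zero_add]
      positivity
  have e1 := (R.law_ε t ht).integral_eq hm (R.measurable_ε t ht) (g := Y) hYm' hYint
  have e2 := (R.law_ε t ht).integral_eq hm (R.measurable_ε t ht) (g := fun ω e => max (Y ω e) 0)
    (hYm'.max measurable_const) hYint.pos_part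
  have hJ : (fun ω => ∫ e, max (Y ω e) 0 ∂(R.law t ω)) = (R.good t).indicator
      (fun ω => ∫ e, max (I.gain t (R.θbar t ω) e) 0 ∂(R.law t ω)) := by
    funext ω
    by_cases hω : ω ∈ R.good t
    · simp only [hYin ω hω, Set.indicator_of_mem hω]
    · simp only [hYout ω hω, Set.indicator_of_notMem hω, max_self, integral_zero]
  rw [hJ] at e2
  rw [hYε]
  refine ⟨hYint, ?_, e2.1, e2.2.2.symm⟩
  refine le_of_le_of_eq (integral_nonneg fun ω => ?_) e1.2.2.symm
  by_cases hω : ω ∈ R.good t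
  · simp only [hYin ω hω, Pi.zero_apply]
    exact I.integral_gain_nonneg hK t _ (R.posDef_H hN hd hlam ht hω) (sq_nonneg a)
  · simp only [hYout ω hω, integral_zero, Pi.zero_apply, le_refl]

end CABTSRun

/-! ### The expected regret of a round -/

namespace CABTSRun
variable {N K d T : ℕ} {I : CAB N K d T} {lam0 a : ℝ} {Ω : Type*} [mΩ : MeasurableSpace Ω]
  {P : Measure Ω} (R : CABTSRun I lam0 a P)

/-- The regret of round `t` against the best allocation. -/
noncomputable def roundRegret (t : ℕ) (ω : Ω) : ℝ :=
  (⨆ ρ : Alloc N K, I.f t ρ I.θs) - I.f t (R.π t ω) I.θs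

theorem roundRegret_nonneg (t : ℕ) (ω : Ω) : 0 ≤ R.roundRegret t ω :=
  sub_nonneg.2 (I.f_le_iSup t _ _)

theorem roundRegret_le (hK : 0 < K) (t : ℕ) (ω : Ω) : R.roundRegret t ω ≤ N * I.M := by
  obtain ⟨ρ, hρ⟩ := I.exists_iSup_f_eq hK t I.θs
  rw [roundRegret, ← hρ]
  exact I.f_sub_f_le t _ _ _

theorem measurable_roundRegret {t : ℕ} (ht : t < T) : Measurable (R.roundRegret t) :=
  (measurable_of_finite fun ρ : Alloc N K => (⨆ ρ : Alloc N K, I.f t ρ I.θs) - I.f t ρ I.θs).comp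
    (R.measurable_π t ht)

theorem regret_le_sum_roundRegret {α : ℝ} (hα : α ≤ 1) (ω : Ω) :
    R.regret α ω ≤ ∑ t ∈ Finset.range T, R.roundRegret t ω := by
  unfold CABTSRun.regret CAB.regret roundRegret
  refine Finset.sum_le_sum fun t _ => sub_le_sub_right ?_ _
  exact mul_le_of_le_one_left ((I.f_nonneg t (R.π t ω) I.θs).trans (I.f_le_iSup t _ _)) hα

/-- The regret of a round on the good event, pointwise: the error of the estimates, the shortfall of
the estimated optimal value, and the price of the perturbation. -/
theorem roundRegret_le_of_good (hN : 0 < N) (hK : 0 < K) (hd : 0 < d) (hlam : 0 < lam0) {t : ℕ}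
    (ht : t < T) {ω : Ω} (hω : ω ∈ R.good t)
    (hmin : ∀ θ : Feat d,
      I.regNLL t (fun s => R.π s ω) (fun s => R.y s ω) (I.kappa * lam0) (R.θbar t ω) ≤
      I.regNLL t (fun s => R.π s ω) (fun s => R.y s ω) (I.kappa * lam0) θ)
    (hmax : ∀ ρ : Alloc N K, I.f t ρ (R.θbar t ω) + I.h t ρ (R.ε t ω) ≤
      I.f t (R.π t ω) (R.θbar t ω) + I.h t (R.π t ω) (R.ε t ω)) {c β : ℝ}
    (hc : c = I.Lr * I.Lμ / I.kappa * (β + I.kappa * I.D * √lam0))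
    (ha : c ^ 2 * N * I.Lμ ≤ a ^ 2) :
    R.roundRegret t ω ≤ 2 * (N / √lam0) * R.scoreExcess β t ω +
      c * I.bonus lam0 t (fun s => R.π s ω) (R.π t ω) +
      100 / 11 * ∫ e, max (I.gain t (R.θbar t ω) e) 0 ∂(R.law t ω) +
      ∑ i, |(inner ℝ (I.φ t i (R.π t ω i)) (R.ε t ω i) : ℝ)| - I.gain t (R.θbar t ω) (R.ε t ω) := by
  have hf := R.abs_f_sub_f_le_of_good hd hlam ht hmin hω β
  rw [← hc] at hf
  have h1 := R.iSup_f_sub_iSup_f_le hN hK hd hlam ht hω ha hf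
  have h2 := (abs_le.1 (hf (R.π t ω))).2
  have h3 := I.gain_le_h hK t hmax
  have h4 := (le_abs_self _).trans (I.abs_h_le t (R.π t ω) (R.ε t ω))
  rw [roundRegret]
  linarith

variable [IsProbabilityMeasure P]

theorem integrable_regret (α : ℝ) : Integrable (R.regret α) P := by
  unfold CABTSRun.regret CAB.regret
  refine integrable_finsetSum _ fun t ht => (integrable_const _).sub ?_
  have hm : Measurable fun ω => I.f t (R.π t ω) I.θs :=
    (measurable_of_finite fun ρ : Alloc N K => I.f t ρ I.θs).comp
      (R.measurable_π t (Finset.mem_range.1 ht))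
  exact Integrable.of_bound hm.aestronglyMeasurable (K * I.M)
    (Filter.Eventually.of_forall fun ω => I.abs_f_le t _ _)

theorem integrable_roundRegret (hK : 0 < K) {t : ℕ} (ht : t < T) : Integrable (R.roundRegret t) P := by
  refine Integrable.of_bound (R.measurable_roundRegret ht).aestronglyMeasurable (N * I.M)
    (Filter.Eventually.of_forall fun ω => ?_)
  rw [Real.norm_of_nonneg (R.roundRegret_nonneg t ω)]
  exact R.roundRegret_le hK t ω

/-- The expected regret of a round. -/
theorem integral_roundRegret_le (hN : 0 < N) (hK : 0 < K) (hd : 0 < d) {δ : ℝ} (hδ : 0 < δ)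
    (hδT : δ < 1 / T) (hδ' : δ < 3 / 40) (hlam : I.lamMin δ ≤ lam0) {t : ℕ} (ht : t < T)
    {a : ℝ} (R : CABTSRun I lam0 a P) {β c τ u : ℝ}
    (hβ : β = I.σ * √(d * Real.log (1 + N * T / (d * lam0)) + 2 * Real.log (1 / δ)))
    (hc : c = I.Lr * I.Lμ / I.kappa * (β + I.kappa * I.D * √lam0))
    (ha : c ^ 2 * N * I.Lμ ≤ a ^ 2) (hτ : 0 ≤ τ) (hu : 0 < u) (haτ : a ^ 2 * I.kappa⁻¹ ≤ τ ^ 2) :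
    ∫ ω, R.roundRegret t ω ∂P ≤
      (c + 111 / 11 * (τ * u)) * ∫ ω, I.bonus lam0 t (fun s => R.π s ω) (R.π t ω) ∂P +
      111 / 11 * (N * (K * (2 * (τ * (1 / √lam0)) / u * Real.exp (-(u ^ 2 / 2))))) +
      2 * (N / √lam0) * (c * δ) + 4 * δ * I.M := by
  have hκ := I.kappa_pos'
  have hD := I.D_pos
  have hM := I.M_nonneg
  have hN' : (0 : ℝ) < N := by exact_mod_cast hN
  have hlam0 : 0 < lam0 := (I.lamMin_pos (Nat.zero_lt_of_lt ht) hδ hδT).trans_le hlam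
  have hGm : MeasurableSet (R.good t) := R.past_le ht.le _ (R.measurableSet_good ht)
  have hβ0 : 0 ≤ β := by rw [hβ]; positivity
  have hc0 : 0 ≤ c := by rw [hc]; positivity
  obtain ⟨hXi, hX⟩ := R.integrable_scoreExcess hK hd hlam0 hδ hδ' ht.le hβ
  have hXc : ∫ ω, R.scoreExcess β t ω ∂P ≤ c * δ := by
    refine hX.trans ?_
    rw [← mul_assoc, hc]
    have : 0 ≤ I.kappa * I.D * √lam0 := by positivity
    gcongr
    linarith
  obtain ⟨hEi, hE⟩ := R.integrable_indicator_excess hN hK hd hlam0 ht hτ hu haτ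
  obtain ⟨hYi, hY0, hJi, hJ⟩ := R.integrable_indicator_gain hN hK hd hlam0 ht
  have hbi := R.integrable_bonus hK hlam0 ht
  have hb0 : ∀ ω, 0 ≤ I.bonus lam0 t (fun s => R.π s ω) (R.π t ω) := fun ω => I.bonus_nonneg _ _ _ _
  have hX0 := R.scoreExcess_nonneg β t
  have hbad := R.measure_compl_good_le hN hd hδ hδT hδ' hlam ht
  have hCi : Integrable ((R.good t)ᶜ.indicator fun _ : Ω => N * I.M) P :=
    (integrable_const _).indicator hGm.compl
  have hC : ∫ ω, (R.good t)ᶜ.indicator (fun _ : Ω => N * I.M) ω ∂P ≤ 4 * δ * I.M := by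
    rw [integral_indicator_const _ hGm.compl, smul_eq_mul, measureReal_def]
    calc _ ≤ 4 * δ / N * (N * I.M) :=
          mul_le_mul_of_nonneg_right (ENNReal.toReal_le_of_le_ofReal (by positivity) hbad) (by positivity)
      _ = _ := by field_simp
  generalize hXdef : R.scoreExcess β t = X at hXi hXc hX0
  generalize hEdef : (R.good t).indicator (fun ω => I.excess lam0 (τ * u) t (fun s => R.π s ω)
    (R.ε t ω)) = E at hEi hE
  generalize hYdef : (R.good t).indicator (fun ω => I.gain t (R.θbar t ω) (R.ε t ω)) = Y at hYi hY0 hJ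
  generalize hJdef : (R.good t).indicator (fun ω => ∫ e, max (I.gain t (R.θbar t ω) e) 0 ∂(R.law t ω))
    = J at hJi hJ
  generalize hbdef : (fun ω => I.bonus lam0 t (fun s => R.π s ω) (R.π t ω)) = b at hbi hb0 ⊢
  have hbω : ∀ ω, I.bonus lam0 t (fun s => R.π s ω) (R.π t ω) = b ω := fun ω => congrFun hbdef ω
  simp only [hbω] at hb0
  generalize hCdef : (R.good t)ᶜ.indicator (fun _ : Ω => N * I.M) = F at hCi hC
  have hpt : ∀ᵐ ω ∂P, R.roundRegret t ω ≤ 2 * (N / √lam0) * X ω + c * b ω + 100 / 11 * J ω +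
      (τ * u * b ω + E ω) - Y ω + F ω := by
    filter_upwards [R.isMin_θbar t ht, R.isMax_π t ht] with ω hmin hmax
    rw [← hXdef, ← hEdef, ← hYdef, ← hJdef, ← hCdef]
    by_cases hω : ω ∈ R.good t
    · rw [Set.indicator_of_mem hω, Set.indicator_of_mem hω, Set.indicator_of_mem hω,
        Set.indicator_of_notMem (by simpa using hω)]
      have h1 := R.roundRegret_le_of_good hN hK hd hlam0 ht hω hmin hmax hc ha
      have h2 := I.sum_abs_inner_le_bonus_add_excess lam0 (τ * u) t (fun s => R.π s ω) (R.π t ω)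
        (R.ε t ω)
      rw [hbω] at h1 h2
      linarith
    · rw [Set.indicator_of_notMem hω, Set.indicator_of_notMem hω, Set.indicator_of_notMem hω,
        Set.indicator_of_mem (by simpa using hω)]
      have h1 := R.roundRegret_le hK t ω
      have h2 : 0 ≤ 2 * (N / √lam0) * R.scoreExcess β t ω :=
        mul_nonneg (by positivity) (R.scoreExcess_nonneg β t ω)
      have h3 : 0 ≤ c * b ω := mul_nonneg hc0 (hb0 ω)
      have h4 : 0 ≤ τ * u * b ω := mul_nonneg (by positivity) (hb0 ω)
      linarith
  have hJE : ∫ ω, J ω ∂P ≤ ∫ ω, (τ * u * b ω + E ω) ∂P := by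
    rw [hJ]
    refine integral_mono_ae hYi.pos_part ((hbi.const_mul _).add hEi) ?_
    filter_upwards [R.isMax_π t ht] with ω hmax
    rw [← hYdef, ← hEdef]
    by_cases hω : ω ∈ R.good t
    · rw [Set.indicator_of_mem hω, Set.indicator_of_mem hω]
      have h1 := I.sum_abs_inner_le_bonus_add_excess lam0 (τ * u) t (fun s => R.π s ω) (R.π t ω)
        (R.ε t ω)
      have h2 := I.gain_le_h hK t hmax
      have h3 := (le_abs_self _).trans (I.abs_h_le t (R.π t ω) (R.ε t ω))
      have h4 := I.f_le_iSup t (R.π t ω) (R.θbar t ω)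
      rw [hbω] at h1
      refine max_le (by linarith) ?_
      exact le_trans (Finset.sum_nonneg fun i _ => abs_nonneg _) h1
    · rw [Set.indicator_of_notMem hω, Set.indicator_of_notMem hω, max_self]
      exact add_nonneg (mul_nonneg (by positivity) (hb0 ω)) le_rfl
  have i1 : Integrable (fun ω => 2 * (N / √lam0) * X ω) P := hXi.const_mul _
  have i2 : Integrable (fun ω => c * b ω) P := hbi.const_mul _
  have i3 : Integrable (fun ω => 100 / 11 * J ω) P := hJi.const_mul _
  have i4 : Integrable (fun ω => τ * u * b ω) P := hbi.const_mul _
  have i12 : Integrable (fun ω => 2 * (N / √lam0) * X ω + c * b ω) P := i1.add i2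
  have i123 : Integrable (fun ω => 2 * (N / √lam0) * X ω + c * b ω + 100 / 11 * J ω) P := i12.add i3
  have i4E : Integrable (fun ω => τ * u * b ω + E ω) P := i4.add hEi
  have i5 : Integrable (fun ω => 2 * (N / √lam0) * X ω + c * b ω + 100 / 11 * J ω +
      (τ * u * b ω + E ω)) P := i123.add i4E
  have i6 : Integrable (fun ω => 2 * (N / √lam0) * X ω + c * b ω + 100 / 11 * J ω +
      (τ * u * b ω + E ω) - Y ω) P := i5.sub hYi
  have i7 : Integrable (fun ω => 2 * (N / √lam0) * X ω + c * b ω + 100 / 11 * J ω +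
      (τ * u * b ω + E ω) - Y ω + F ω) P := i6.add hCi
  refine (integral_mono_ae (R.integrable_roundRegret hK ht) i7 hpt).trans ?_
  rw [integral_add i4 hEi, integral_const_mul] at hJE
  rw [integral_add i6 hCi, integral_sub i5 hYi, integral_add i123 i4E, integral_add i12 i3,
    integral_add i1 i2, integral_add i4 hEi, integral_const_mul, integral_const_mul,
    integral_const_mul, integral_const_mul]
  have h1 : 2 * (N / √lam0) * ∫ ω, X ω ∂P ≤ 2 * (N / √lam0) * (c * δ) := by gcongr
  linarith

end CABTSRun

/-! ### The explicit regret bound -/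

theorem five_le_two_mul_log {x : ℝ} (hx : 40 / 3 ≤ x) : 5 ≤ 2 * Real.log x := by
  have h1 : Real.exp 5 ≤ x ^ 2 := by
    have h2 : Real.exp 5 = Real.exp 1 ^ 5 := by rw [← Real.exp_nat_mul]; norm_num
    have h3 : Real.exp 1 ^ 5 ≤ 2.7182818286 ^ 5 :=
      pow_le_pow_left₀ (Real.exp_pos 1).le Real.exp_one_lt_d9.le 5
    rw [h2]
    exact h3.trans (le_trans (by norm_num) (pow_le_pow_left₀ (by norm_num) hx 2))
  have h4 := Real.log_le_log (Real.exp_pos 5) h1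
  rw [Real.log_exp, Real.log_pow] at h4
  exact_mod_cast h4

namespace CAB
variable {N K d T : ℕ} (I : CAB N K d T)

/-- The upper bound on the cumulative bonuses, with `γ` the regularization. -/
noncomputable def potential (N d T : ℕ) (γ : ℝ) : ℝ :=
  √(2 * d * N * T * Real.log (1 + N * T / (d * γ)))
    + 2 * d * N / √γ * Real.log (1 + N * T / (d * γ))

end CAB

namespace CABTSRun
variable {N K d T : ℕ} {I : CAB N K d T} {Ω : Type*} [mΩ : MeasurableSpace Ω]
  {P : Measure Ω} [IsProbabilityMeasure P]

theorem sum_integral_bonus_le (hK : 0 < K) (hd : 0 < d) {lam0 a : ℝ} (hlam : 0 < lam0)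
    (R : CABTSRun I lam0 a P) :
    ∑ t ∈ Finset.range T, ∫ ω, I.bonus lam0 t (fun s => R.π s ω) (R.π t ω) ∂P ≤
      CAB.potential N d T lam0 := by
  have hi : ∀ t ∈ Finset.range T, Integrable (fun ω => I.bonus lam0 t (fun s => R.π s ω) (R.π t ω)) P :=
    fun t ht => R.integrable_bonus hK hlam (Finset.mem_range.1 ht)
  rw [← integral_finsetSum _ hi]
  calc _ ≤ ∫ _ : Ω, CAB.potential N d T lam0 ∂P :=
        integral_mono (integrable_finsetSum _ hi) (integrable_const _)
          fun ω => I.sum_bonus_le hd hlam fun s => R.π s ω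
    _ = _ := by simp

/-- The explicit regret bound. -/
theorem integral_regret_le (hN : 0 < N) (hK : 0 < K) (hd : 0 < d) (hT : 0 < T) {lam0 δ α : ℝ}
    (hδ : 0 < δ) (hδT : δ < 1 / T) (hδ' : δ < 3 / 40) (hα : α ≤ 1) (hlam : I.lamMin δ ≤ lam0)
    (R : CABTSRun I lam0 (I.expl lam0 δ) P) :
    ∫ ω, R.regret α ω ∂P ≤
      (I.c₁ lam0 δ + I.c₂ lam0 δ) * (1 + 2 / (0.15 - 2 * δ)) * CAB.potential N d T lam0
        + 4 * δ * I.M * T := by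
  have hκ := I.kappa_pos'
  have hN' : (1 : ℝ) ≤ N := by exact_mod_cast hN
  have hK' : (1 : ℝ) ≤ K := by exact_mod_cast hK
  have hT' : (1 : ℝ) ≤ T := by exact_mod_cast hT
  have hlam0 : 0 < lam0 := (I.lamMin_pos hT hδ hδT).trans_le hlam
  have hsq : 0 < √lam0 := Real.sqrt_pos.2 hlam0
  have hTδ : T * δ ≤ 1 := by
    rw [lt_div_iff₀ (by linarith)] at hδT
    linarith
  set c := I.c₁ lam0 δ with hc
  have hc0 : 0 ≤ c := I.c₁_nonneg
  set g := K * N / δ with hg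
  have hgpos : 0 < g := by positivity
  have hu5 : 5 ≤ 2 * Real.log g := by
    refine five_le_two_mul_log ?_
    rw [hg, le_div_iff₀ hδ]
    have : (1 : ℝ) ≤ K * N := by nlinarith
    linarith
  set u := √(2 * Real.log g) with hu
  have hu2 : u ^ 2 = 2 * Real.log g := Real.sq_sqrt (by linarith)
  have hu0 : 0 < u := Real.sqrt_pos.2 (by linarith)
  set τ := c * √(I.kappa⁻¹ * I.Lμ * N) with hτ
  have hτ0 : 0 ≤ τ := by positivity
  have hc2 : I.c₂ lam0 δ = τ * u := by
    rw [CAB.c₂, hτ, hu, mul_assoc c, ← Real.sqrt_mul (by positivity), ← hc]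
    congr 2
    ring
  have hexp : (I.expl lam0 δ) ^ 2 = c ^ 2 * N * I.Lμ := by
    rw [CAB.expl, mul_pow, Real.sq_sqrt (by positivity)]; ring
  have hexpτ : (I.expl lam0 δ) ^ 2 * I.kappa⁻¹ ≤ τ ^ 2 := by
    rw [hexp, hτ, mul_pow, Real.sq_sqrt (by positivity)]
    exact le_of_eq (by ring)
  set Ψ := CAB.potential N d T lam0 with hΨ
  have hΨN : N / √lam0 ≤ Ψ := CAB.div_sqrt_le_potential hd hT hlam0
  have hΨ0 : 0 ≤ Ψ := le_trans (by positivity) hΨN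
  have hround : ∀ t ∈ Finset.range T, ∫ ω, R.roundRegret t ω ∂P ≤
      (c + 111 / 11 * (τ * u)) * ∫ ω, I.bonus lam0 t (fun s => R.π s ω) (R.π t ω) ∂P +
      (111 / 11 * (2 / 5 * (τ * u) * Ψ * δ) + 2 * Ψ * (c * δ) + 4 * δ * I.M) := by
    intro t ht
    have h := integral_roundRegret_le hN hK hd hδ hδT hδ' hlam (Finset.mem_range.1 ht) R rfl
      (c := c) rfl hexp.ge hτ0 hu0 hexpτ
    have h1 : (N * (K * (2 * (τ * (1 / √lam0)) / u * Real.exp (-(u ^ 2 / 2)))) : ℝ) ≤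
        2 / 5 * (τ * u) * Ψ * δ := by
      have e1 : Real.exp (-(u ^ 2 / 2)) = δ / (K * N) := by
        rw [hu2, mul_div_cancel_left₀ _ two_ne_zero, Real.exp_neg, Real.exp_log hgpos, hg, inv_div]
      have e2 : (N * (K * (2 * (τ * (1 / √lam0)) / u * (δ / (K * N)))) : ℝ) =
          2 * (τ * u) * (1 / √lam0) * δ / u ^ 2 := by
        field_simp
      have h2 : 1 / √lam0 ≤ Ψ := le_trans (by gcongr) hΨN
      rw [e1, e2, div_le_iff₀ (by positivity)]
      calc 2 * (τ * u) * (1 / √lam0) * δ ≤ 2 * (τ * u) * Ψ * δ := by gcongr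
        _ = 2 / 5 * (τ * u) * Ψ * δ * 5 := by ring
        _ ≤ _ := by
          rw [hu2]
          gcongr
    have h2 : 2 * (N / √lam0) * (c * δ) ≤ 2 * Ψ * (c * δ) := by gcongr
    linarith
  have hsum : ∫ ω, R.regret α ω ∂P ≤ ∑ t ∈ Finset.range T, ∫ ω, R.roundRegret t ω ∂P := by
    have hi : ∀ t ∈ Finset.range T, Integrable (R.roundRegret t) P :=
      fun t ht => R.integrable_roundRegret hK (Finset.mem_range.1 ht)
    rw [← integral_finsetSum _ hi]
    exact integral_mono (R.integrable_regret α) (integrable_finsetSum _ hi)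
      fun ω => R.regret_le_sum_roundRegret hα ω
  refine (hsum.trans (Finset.sum_le_sum hround)).trans ?_
  rw [Finset.sum_add_distrib, ← Finset.mul_sum, Finset.sum_const, Finset.card_range, nsmul_eq_mul]
  have h1 : (c + 111 / 11 * (τ * u)) *
      ∑ t ∈ Finset.range T, ∫ ω, I.bonus lam0 t (fun s => R.π s ω) (R.π t ω) ∂P ≤
      (c + 111 / 11 * (τ * u)) * Ψ :=
    mul_le_mul_of_nonneg_left (R.sum_integral_bonus_le hK hd hlam0) (by positivity)
  have h2 : (T : ℝ) * (111 / 11 * (2 / 5 * (τ * u) * Ψ * δ) + 2 * Ψ * (c * δ) + 4 * δ * I.M) ≤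
      111 / 11 * (2 / 5 * (τ * u) * Ψ) + 2 * Ψ * c + 4 * δ * I.M * T := by
    calc _ = (T * δ) * (111 / 11 * (2 / 5 * (τ * u) * Ψ) + 2 * Ψ * c) + 4 * δ * I.M * T := by ring
      _ ≤ 1 * (111 / 11 * (2 / 5 * (τ * u) * Ψ) + 2 * Ψ * c) + 4 * δ * I.M * T := by gcongr
      _ = _ := by ring
  -- the optimism argument costs `(111 / 11) (7 / 5) < 43 / 3 = 1 + 2 / 0.15`
  have h3 : (43 / 3 : ℝ) ≤ 1 + 2 / (0.15 - 2 * δ) := by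
    have : (40 / 3 : ℝ) ≤ 2 / (0.15 - 2 * δ) := by
      rw [le_div_iff₀ (by norm_num; linarith)]
      norm_num
      linarith
    linarith
  rw [hc2]
  have h4 : (c + τ * u) * (43 / 3) * Ψ ≤ (c + τ * u) * (1 + 2 / (0.15 - 2 * δ)) * Ψ := by gcongr
  have h5 : 0 ≤ c * Ψ := by positivity
  have h6 : 0 ≤ τ * u * Ψ := by positivity
  linarith

end CABTSRun

/-! ### The rate for the smallest regularization -/

theorem log_one_add_mul_le {a x : ℝ} (ha : 1 ≤ a) (hx : 0 ≤ x) :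
    Real.log (1 + a * x) ≤ a * Real.log (1 + x) := by
  have h : 1 + a * x ≤ (1 + x) ^ a := one_add_mul_self_le_rpow_one_add (by linarith) ha
  have h1 := Real.log_le_log (by positivity) h
  rwa [Real.log_rpow (by linarith)] at h1

theorem sqrt_le_self_of_one_le {x : ℝ} (hx : 1 ≤ x) : √x ≤ x :=
  Real.sqrt_le_iff.2 ⟨by linarith, by rw [sq]; exact le_mul_of_one_le_left (by linarith) hx⟩

theorem sqrt_mul_le_mul {c x : ℝ} (hc : 1 ≤ c) (hx : 1 ≤ x) : √(c * x) ≤ c * x :=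
  sqrt_le_self_of_one_le (one_le_mul_of_one_le_of_one_le hc hx)

/-- The product of the exploration constants `c` and `c₂` with the two parts of the potential; the
first part is paired with the bound on `c` of order `√d`, the second with the one of order `s`. -/
theorem add_mul_potential_le {A B b L c c₂ s ℓ κ d n T : ℝ} (hA : 0 ≤ A) (hB : 0 < B) (hb : 1 ≤ b)
    (hL : 1 ≤ L) (hd : 1 ≤ d) (hn : 1 ≤ n) (hT : 1 ≤ T) (hs : 0 < s) (hκB : κ ≤ B ^ 2) (hc : 0 ≤ c)
    (hℓ : 0 ≤ ℓ) (hℓL : ℓ ≤ b * L) (hcs : c ≤ A * κ * (b * B + 1) * s)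
    (hκs : κ * s ≤ B * (√d * (3 * L))) (hc₂ : c₂ ≤ c * (√n * ((1 + 2 * B) * L))) :
    (c + c₂) * (√(2 * d * n * T * ℓ) + 2 * d * n / s * ℓ) ≤
      (b * B + 1) * (2 + 2 * B) * (2 * b) * (3 * B + B ^ 2) *
        (A * (d * n * √T + d * (n * √n))) * L ^ 3 := by
  have hsn : 1 ≤ √n := Real.one_le_sqrt.2 hn
  have hL23 : L ^ 2 ≤ L ^ 3 := pow_le_pow_right₀ hL (by norm_num)
  have hc12 : c + c₂ ≤ c * (√n * ((2 + 2 * B) * L)) := by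
    have : c ≤ c * (√n * L) :=
      le_mul_of_one_le_right hc (one_le_mul_of_one_le_of_one_le hsn hL)
    linarith
  have hfirst : c * (√n * ((2 + 2 * B) * L)) * √(2 * d * n * T * ℓ) ≤
      (b * B + 1) * (2 + 2 * B) * (2 * b) * (3 * B) * (A * (d * n * √T)) * L ^ 3 := by
    have e1 : √(2 * d * n * T * ℓ) ≤ √d * √n * √T * (2 * b * L) := by
      have : 2 * d * n * T * ℓ ≤ d * n * T * (2 * b * L) := by
        calc 2 * d * n * T * ℓ ≤ 2 * d * n * T * (b * L) := by gcongr
          _ = _ := by ring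
      refine (Real.sqrt_le_sqrt this).trans ?_
      rw [Real.sqrt_mul (by positivity), Real.sqrt_mul (by positivity), Real.sqrt_mul (by positivity)]
      gcongr
      exact sqrt_mul_le_mul (by linarith) hL
    have e2 : c ≤ A * (b * B + 1) * (B * (√d * (3 * L))) := by
      calc c ≤ A * κ * (b * B + 1) * s := hcs
        _ = A * (b * B + 1) * (κ * s) := by ring
        _ ≤ _ := by gcongr
    calc _ ≤ A * (b * B + 1) * (B * (√d * (3 * L))) * (√n * ((2 + 2 * B) * L)) *
          (√d * √n * √T * (2 * b * L)) := by gcongr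
      _ = (b * B + 1) * (2 + 2 * B) * (2 * b) * (3 * B) * (A * ((√d * √d) * (√n * √n) * √T)) * L ^ 3 := by
          ring
      _ = _ := by rw [Real.mul_self_sqrt (by positivity), Real.mul_self_sqrt (by positivity)]
  have hsecond : c * (√n * ((2 + 2 * B) * L)) * (2 * d * n / s * ℓ) ≤
      (b * B + 1) * (2 + 2 * B) * (2 * b) * B ^ 2 * (A * (d * (n * √n))) * L ^ 3 := by
    have e1 : c ≤ A * B ^ 2 * (b * B + 1) * s := hcs.trans (by gcongr)
    calc _ ≤ A * B ^ 2 * (b * B + 1) * s * (√n * ((2 + 2 * B) * L)) * (2 * d * n / s * (b * L)) := by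
          gcongr
      _ = (b * B + 1) * (2 + 2 * B) * (2 * b) * B ^ 2 * (A * (d * (n * √n))) * L ^ 2 := by
          field_simp
      _ ≤ _ := by gcongr
  have hZ : 0 ≤ (b * B + 1) * (2 + 2 * B) * (2 * b) := by positivity
  generalize (b * B + 1) * (2 + 2 * B) * (2 * b) = Z at *
  have hx : 0 ≤ Z * B ^ 2 * (A * (d * n * √T)) * L ^ 3 := by positivity
  have hz : 0 ≤ Z * (3 * B) * (A * (d * (n * √n))) * L ^ 3 := by positivity
  calc (c + c₂) * (√(2 * d * n * T * ℓ) + 2 * d * n / s * ℓ)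
      ≤ c * (√n * ((2 + 2 * B) * L)) * (√(2 * d * n * T * ℓ) + 2 * d * n / s * ℓ) := by gcongr
    _ ≤ Z * (3 * B) * (A * (d * n * √T)) * L ^ 3 + Z * B ^ 2 * (A * (d * (n * √n))) * L ^ 3 := by
        rw [mul_add]; exact add_le_add hfirst hsecond
    _ ≤ _ := by linarith

namespace CAB
variable {N K d T : ℕ} (I : CAB N K d T)

/-- For the smallest admissible regularization, `c₁` is of the order of `√λ₀`, because `λ₀` is not
small and both logarithms are comparable. -/
theorem rate_bounds (hN : 0 < N) (hK : 0 < K) (hd : 0 < d) (hT : 0 < T) {δ B : ℝ}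
    (hδ : 0 < δ) (hδT : δ < 1 / T) (hδ' : δ ≤ 1 / 20) (hσB : I.σ ≤ B) (hD : 1 ≤ B * I.D) :
    Real.log (1 + N * T / (d * I.lamMin δ)) ≤ (1 + B ^ 2) * (1 + Real.log (K * N * T / δ)) ∧
    I.c₁ (I.lamMin δ) δ ≤ (I.kappa⁻¹ * I.Lr * I.Lμ * I.D) * I.kappa * ((1 + B ^ 2) * B + 1) *
      √(I.lamMin δ) ∧
    I.kappa * √(I.lamMin δ) ≤ B * (√d * (3 * (1 + Real.log (K * N * T / δ)))) := by
  have hκ := I.kappa_pos'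
  have hDpos := I.D_pos
  have hσ : (0 : ℝ) < I.σ := I.σ_pos
  have hB : 0 < B := hσ.trans_le hσB
  have hN' : (1 : ℝ) ≤ N := by exact_mod_cast hN
  have hK' : (1 : ℝ) ≤ K := by exact_mod_cast hK
  have hd' : (1 : ℝ) ≤ d := by exact_mod_cast hd
  have hT' : (1 : ℝ) ≤ T := by exact_mod_cast hT
  have hlam0 := I.lamMin_pos hT hδ hδT
  set lam := I.lamMin δ with hlam
  set L := 1 + Real.log (K * N * T / δ) with hL
  set y : ℝ := N * T / d with hy
  have hy0 : 0 ≤ y := by positivity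
  have hNT : (1 : ℝ) ≤ N * T := by nlinarith
  have hKNT : (N * T : ℝ) ≤ K * N * T := by
    rw [mul_assoc]; exact le_mul_of_one_le_left (by positivity) hK'
  have hlogy : Real.log (1 + y) ≤ L := by
    have h1 : 1 + y ≤ K * N * T / δ := by
      have h2 : y ≤ N * T := div_le_self (by positivity) hd'
      rw [le_div_iff₀ hδ]
      nlinarith
    have := Real.log_le_log (by linarith) h1
    linarith
  have hlogδ : Real.log (1 / δ) ≤ L := by
    have h1 : 1 / δ ≤ K * N * T / δ := by gcongr; linarith
    have := Real.log_le_log (by positivity) h1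
    linarith
  have hlogδ1 : 1 ≤ 2 * Real.log (1 / δ) := by
    have h1 := five_le_two_mul_log (x := 1 / δ) (by rw [le_div_iff₀ hδ]; linarith)
    linarith
  have hlogy0 : 0 ≤ Real.log (1 + y) := Real.log_nonneg (by linarith)
  set L' := d * Real.log (1 + y) + 2 * Real.log (1 / δ) with hL'
  have hL'1 : 1 ≤ L' := by
    have : 0 ≤ d * Real.log (1 + y) := by positivity
    linarith
  have hlamL : I.kappa ^ 2 * lam = (I.σ : ℝ) ^ 2 * L' := by
    rw [hlam, lamMin, ← hy, ← hL']; field_simp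
  have hκσ := I.kappa_le_σ_sq hN hK hd hT
  have hσB2 : (I.σ : ℝ) ^ 2 ≤ B ^ 2 := pow_le_pow_left₀ hσ.le hσB 2
  -- `λ₀ ≥ σ² / κ² ≥ 1 / κ ≥ 1 / B²`
  have hlamB : 1 ≤ lam * B ^ 2 := by
    have h1 : I.kappa ≤ I.kappa ^ 2 * lam := by
      rw [hlamL]
      exact hκσ.trans (le_mul_of_one_le_right (by positivity) hL'1)
    have h2 : 1 ≤ I.kappa * lam := by
      refine le_of_mul_le_mul_left ?_ hκ
      linarith [h1, sq I.kappa, mul_assoc I.kappa I.kappa lam]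
    calc 1 ≤ I.kappa * lam := h2
      _ ≤ B ^ 2 * lam := by gcongr; exact hκσ.trans hσB2
      _ = _ := mul_comm _ _
  set ℓ := Real.log (1 + N * T / (d * lam)) with hℓ
  have hℓy : ℓ ≤ (1 + B ^ 2) * Real.log (1 + y) := by
    refine le_trans ?_ (log_one_add_mul_le (by nlinarith [sq_nonneg B]) hy0)
    refine Real.log_le_log (by positivity) ?_
    have h1 : N * T / (d * lam) = y / lam := by rw [hy, div_div]
    rw [h1]
    have h2 : y / lam ≤ (1 + B ^ 2) * y := by
      rw [div_le_iff₀ hlam0]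
      calc y = 1 * y := (one_mul y).symm
        _ ≤ (lam * B ^ 2) * y := by gcongr
        _ ≤ (1 + B ^ 2) * y * lam := by nlinarith [mul_nonneg hlam0.le hy0]
    linarith
  have hsqlam : I.kappa * √lam = I.σ * √L' := by
    have h1 : √(I.kappa ^ 2 * lam) = √((I.σ : ℝ) ^ 2 * L') := by rw [hlamL]
    rwa [Real.sqrt_mul (by positivity), Real.sqrt_mul (by positivity), Real.sqrt_sq hκ.le,
      Real.sqrt_sq hσ.le] at h1
  have hb1 : (1 : ℝ) ≤ 1 + B ^ 2 := by nlinarith [sq_nonneg B]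
  refine ⟨hℓy.trans (by gcongr), ?_, ?_⟩
  · have h1 : d * ℓ + 2 * Real.log (1 / δ) ≤ (1 + B ^ 2) * L' := by
      rw [hL', mul_add]
      refine add_le_add ?_ (le_mul_of_one_le_left (by linarith) hb1)
      calc d * ℓ ≤ d * ((1 + B ^ 2) * Real.log (1 + y)) := by gcongr
        _ = _ := by ring
    have h2 : √(d * ℓ + 2 * Real.log (1 / δ)) ≤ (1 + B ^ 2) * √L' := by
      refine (Real.sqrt_le_sqrt h1).trans ?_
      rw [Real.sqrt_mul (by positivity)]
      gcongr
      exact sqrt_le_self_of_one_le hb1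
    have h3 : I.σ * √(d * ℓ + 2 * Real.log (1 / δ)) ≤ (1 + B ^ 2) * B * (I.D * I.kappa * √lam) := by
      calc _ ≤ I.σ * ((1 + B ^ 2) * √L') := by gcongr
        _ = (1 + B ^ 2) * (I.kappa * √lam) * 1 := by rw [hsqlam]; ring
        _ ≤ (1 + B ^ 2) * (I.kappa * √lam) * (B * I.D) := by gcongr
        _ = _ := by ring
    rw [c₁]
    calc _ ≤ I.Lr * I.Lμ / I.kappa * ((1 + B ^ 2) * B * (I.D * I.kappa * √lam) +
          I.kappa * I.D * √lam) := by gcongr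
      _ = _ := by rw [div_eq_mul_inv]; ring
  · rw [hsqlam]
    have h1 : L' ≤ d * (3 * L) := by
      have h2 : 2 * L ≤ 2 * (d * L) := by
        have : L ≤ d * L := le_mul_of_one_le_left (by linarith) hd'
        linarith
      have h3 : d * Real.log (1 + y) ≤ d * L := by gcongr
      linarith
    have hL1 : 1 ≤ L := by linarith [Real.log_nonneg (show 1 ≤ K * N * T / δ by
      rw [le_div_iff₀ hδ]; linarith)]
    have h2 : √L' ≤ √d * (3 * L) := by
      refine (Real.sqrt_le_sqrt h1).trans ?_
      rw [Real.sqrt_mul (by positivity)]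
      gcongr
      exact sqrt_mul_le_mul (by norm_num) hL1
    gcongr

theorem rpow_three_halves (N : ℕ) : (N : ℝ) ^ (3 / 2 : ℝ) = N * √N := by
  rcases Nat.eq_zero_or_pos N with rfl | h
  · norm_num
  · have hN : (0 : ℝ) < N := by exact_mod_cast h
    rw [Real.sqrt_eq_rpow, show (3 / 2 : ℝ) = 1 + 1 / 2 by norm_num, Real.rpow_add hN, Real.rpow_one]

/-- The constant of the regret rate. -/
noncomputable def rateConst (B : ℝ) : ℝ :=
  41 * (((1 + B ^ 2) * B + 1) * (2 + 2 * B) * (2 * (1 + B ^ 2)) * (3 * B + B ^ 2)) + 20 * B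

theorem explicit_bound_le_rate (hN : 0 < N) (hK : 0 < K) (hd : 0 < d) (hT : 0 < T) {δ B : ℝ}
    (hδ : 0 < δ) (hδT : δ < 1 / T) (hδ' : δ ≤ 1 / 20) (hσB : I.σ ≤ B) (hLB : I.Lμ ≤ B * I.kappa)
    (hD : 1 ≤ B * I.D) (hM : I.M ≤ B * (I.kappa⁻¹ * I.Lr * I.Lμ * I.D)) :
    (I.c₁ (I.lamMin δ) δ + I.c₂ (I.lamMin δ) δ) * (1 + 2 / (0.15 - 2 * δ)) *
        potential N d T (I.lamMin δ) + 4 * δ * I.M * T ≤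
      rateConst B * (I.kappa⁻¹ * I.Lr * I.Lμ * I.D * (d * N * √T + d * (N : ℝ) ^ (3 / 2 : ℝ))) *
        (1 + Real.log (K * N * T / δ)) ^ 3 := by
  obtain ⟨h1, h2, h3⟩ := I.rate_bounds hN hK hd hT hδ hδT hδ' hσB hD
  have hκ := I.kappa_pos'
  have hDpos := I.D_pos
  have hσ : (0 : ℝ) < I.σ := I.σ_pos
  have hB : 0 < B := hσ.trans_le hσB
  have hN' : (1 : ℝ) ≤ N := by exact_mod_cast hN
  have hK' : (1 : ℝ) ≤ K := by exact_mod_cast hK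
  have hd' : (1 : ℝ) ≤ d := by exact_mod_cast hd
  have hT' : (1 : ℝ) ≤ T := by exact_mod_cast hT
  have hlam0 := I.lamMin_pos hT hδ hδT
  have hM0 := I.M_nonneg
  have hκB : I.kappa ≤ B ^ 2 :=
    (I.kappa_le_σ_sq hN hK hd hT).trans (pow_le_pow_left₀ hσ.le hσB 2)
  have hc20 : 0 ≤ I.c₂ (I.lamMin δ) δ := I.c₂_nonneg
  have hc10 : 0 ≤ I.c₁ (I.lamMin δ) δ := I.c₁_nonneg
  have hTδ : δ * T ≤ 1 := by
    rw [lt_div_iff₀ (by linarith)] at hδT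
    linarith
  rw [rpow_three_halves, potential, rateConst]
  have hlogKN : Real.log (K * N / δ) ≤ 1 + Real.log (K * N * T / δ) := by
    have : (K * N : ℝ) / δ ≤ K * N * T / δ := by
      refine div_le_div_of_nonneg_right ?_ hδ.le
      exact le_mul_of_one_le_right (by positivity) hT'
    have := Real.log_le_log (by positivity) this
    linarith
  have hNT : (1 : ℝ) ≤ N * T := by nlinarith
  have hL1 : 1 ≤ 1 + Real.log (K * N * T / δ) := by
    have := Real.log_nonneg (show 1 ≤ K * N * T / δ by
      rw [le_div_iff₀ hδ, mul_assoc]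
      nlinarith)
    linarith
  have hc2 : I.c₂ (I.lamMin δ) δ ≤
      I.c₁ (I.lamMin δ) δ * (√N * ((1 + 2 * B) * (1 + Real.log (K * N * T / δ)))) := by
    rw [c₂]
    refine mul_le_mul_of_nonneg_left ?_ hc10
    have h4 : 2 * I.kappa⁻¹ * I.Lμ * N * Real.log (K * N / δ) ≤
        N * ((1 + 2 * B) * (1 + Real.log (K * N * T / δ))) := by
      have h5 : I.kappa⁻¹ * I.Lμ ≤ B := by
        rw [inv_mul_eq_div, div_le_iff₀ hκ]; exact hLB
      calc _ = N * (2 * (I.kappa⁻¹ * I.Lμ) * Real.log (K * N / δ)) := by ring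
        _ ≤ N * (2 * (I.kappa⁻¹ * I.Lμ) * (1 + Real.log (K * N * T / δ))) := by gcongr
        _ ≤ N * ((1 + 2 * B) * (1 + Real.log (K * N * T / δ))) := by
          gcongr
          linarith
    refine (Real.sqrt_le_sqrt h4).trans ?_
    rw [Real.sqrt_mul (by positivity)]
    gcongr
    exact sqrt_mul_le_mul (by linarith) hL1
  have hℓ0 : 0 ≤ Real.log (1 + N * T / (d * I.lamMin δ)) :=
    Real.log_nonneg (one_le_one_add_mul_div N T d hlam0)
  have hfac : 1 + 2 / (0.15 - 2 * δ) ≤ 41 := by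
    have : 2 / (0.15 - 2 * δ) ≤ 40 := by
      rw [div_le_iff₀ (by norm_num; linarith)]
      norm_num
      linarith
    linarith
  set L := 1 + Real.log (K * N * T / δ) with hL
  set A := I.kappa⁻¹ * I.Lr * I.Lμ * I.D with hA
  have hA0 : 0 ≤ A := by positivity
  set c := I.c₁ (I.lamMin δ) δ
  set ℓ := Real.log (1 + N * T / (d * I.lamMin δ))
  have hmain := add_mul_potential_le hA0 hB (by nlinarith [sq_nonneg B] : 1 ≤ 1 + B ^ 2) hL1 hd' hN' hT'
    (Real.sqrt_pos.2 hlam0) hκB hc10 hℓ0 h1 h2 h3 hc2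
  set W := √(2 * d * N * T * ℓ) + 2 * d * N / √(I.lamMin δ) * ℓ
  have hW : 0 ≤ W := by positivity
  have hlast : 4 * δ * I.M * T ≤ 20 * B * (A * (d * N * √T + d * (N * √N))) * L ^ 3 := by
    have hsT : 1 ≤ √(T : ℝ) := Real.one_le_sqrt.2 hT'
    have h5 : 1 ≤ d * N * √T + d * (N * √N) :=
      le_add_of_le_of_nonneg (one_le_mul_of_one_le_of_one_le
        (one_le_mul_of_one_le_of_one_le hd' hN') hsT) (by positivity)
    calc 4 * δ * I.M * T = 4 * I.M * (δ * T) := by ring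
      _ ≤ 4 * (B * A) * 1 := by gcongr
      _ = 4 * B * (A * 1) * 1 := by ring
      _ ≤ 20 * B * (A * (d * N * √T + d * (N * √N))) * L ^ 3 := by
        gcongr
        · norm_num
        · exact one_le_pow₀ hL1
  calc _ ≤ 41 * ((c + I.c₂ (I.lamMin δ) δ) * W) + 4 * δ * I.M * T := by
        have : (c + I.c₂ (I.lamMin δ) δ) * (1 + 2 / (0.15 - 2 * δ)) * W ≤
          (c + I.c₂ (I.lamMin δ) δ) * 41 * W := by gcongr
        linarith
    _ ≤ 41 * ((1 + B ^ 2) * B + 1) * (2 + 2 * B) * (2 * (1 + B ^ 2)) * (3 * B + B ^ 2) *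
        (A * (d * N * √T + d * (N * √N))) * L ^ 3 +
        20 * B * (A * (d * N * √T + d * (N * √N))) * L ^ 3 := by linarith
    _ = _ := by ring

end CAB

namespace CABTSRun
variable {N K d T : ℕ} {I : CAB N K d T} {Ω : Type*} [mΩ : MeasurableSpace Ω]
  {P : Measure Ω} [IsProbabilityMeasure P]

/-- If `δ` is bounded away from zero then the horizon is bounded, and the regret of a round is at
most `N M`. -/
theorem integral_regret_le_rate_of_lt (hN : 0 < N) (hK : 0 < K) (hd : 0 < d) (hT : 0 < T)
    {lam0 a δ α B : ℝ} (R : CABTSRun I lam0 a P) (hδT : δ < 1 / T) (hδ' : 1 / 20 < δ) (hα : α ≤ 1)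
    (hσB : I.σ ≤ B) (hM : I.M ≤ B * (I.kappa⁻¹ * I.Lr * I.Lμ * I.D)) :
    ∫ ω, R.regret α ω ∂P ≤
      CAB.rateConst B * (I.kappa⁻¹ * I.Lr * I.Lμ * I.D * (d * N * √T + d * (N : ℝ) ^ (3 / 2 : ℝ))) *
        (1 + Real.log (K * N * T / δ)) ^ 3 := by
  have hσ : (0 : ℝ) < I.σ := I.σ_pos
  have hB : 0 < B := hσ.trans_le hσB
  have hκ := I.kappa_pos'
  have hD := I.D_pos
  have hδ : 0 < δ := by linarith
  have hN' : (1 : ℝ) ≤ N := by exact_mod_cast hN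
  have hK' : (1 : ℝ) ≤ K := by exact_mod_cast hK
  have hd' : (1 : ℝ) ≤ d := by exact_mod_cast hd
  have hT' : (1 : ℝ) ≤ T := by exact_mod_cast hT
  have hT20 : (T : ℝ) ≤ 20 := by
    rw [lt_div_iff₀ (by linarith)] at hδT
    nlinarith
  have hM0 := I.M_nonneg
  have h1 : ∫ ω, R.regret α ω ∂P ≤ T * (N * I.M) := by
    calc _ ≤ ∫ _ : Ω, T * (N * I.M) ∂P := by
          refine integral_mono (R.integrable_regret α) (integrable_const _) fun ω => ?_
          refine (R.regret_le_sum_roundRegret hα ω).trans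
            ((Finset.sum_le_sum fun t _ => R.roundRegret_le hK t ω).trans (le_of_eq ?_))
          simp
      _ = _ := by simp
  have hL : 1 ≤ 1 + Real.log (K * N * T / δ) := by
    have h2 : (1 : ℝ) ≤ K * N * T :=
      one_le_mul_of_one_le_of_one_le (one_le_mul_of_one_le_of_one_le hK' hN') hT'
    have h3 : δ ≤ 1 := hδT.le.trans ((div_le_one (by linarith)).2 hT')
    have := Real.log_nonneg (show 1 ≤ K * N * T / δ by rw [le_div_iff₀ hδ]; linarith)
    linarith
  have hA : 0 ≤ I.kappa⁻¹ * I.Lr * I.Lμ * I.D := by positivity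
  generalize I.kappa⁻¹ * I.Lr * I.Lμ * I.D = A at hA hM ⊢
  have hC : 20 * B ≤ CAB.rateConst B := by
    have : 0 ≤ 41 * (((1 + B ^ 2) * B + 1) * (2 + 2 * B) * (2 * (1 + B ^ 2)) * (3 * B + B ^ 2)) := by
      positivity
    rw [CAB.rateConst]
    linarith
  have hNle : (N : ℝ) ≤ d * N * √T + d * (N : ℝ) ^ (3 / 2 : ℝ) := by
    have h4 : (N : ℝ) ≤ d * N * √T := by
      calc (N : ℝ) = 1 * N * 1 := by ring
        _ ≤ d * N * √T := by
          gcongr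
          exact Real.one_le_sqrt.2 hT'
    have : 0 ≤ d * (N : ℝ) ^ (3 / 2 : ℝ) := by positivity
    linarith
  calc _ ≤ T * (N * I.M) := h1
    _ ≤ 20 * (N * (B * A)) := by gcongr
    _ = 20 * B * (A * N) * 1 := by ring
    _ ≤ _ := by
      have : 0 ≤ CAB.rateConst B := le_trans (by positivity) hC
      gcongr
      exact one_le_pow₀ hL

end CABTSRun

theorem mainTheorem2 :
    -- explicit bound
    (∀ (N K d T : ℕ), 0 < N → 0 < K → 0 < d → 0 < T →
      ∀ (I : CAB N K d T) (lam0 δ α : ℝ), 0 < δ → δ < 1 / T → δ < 3 / 40 → 0 < α → α ≤ 1 →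
      I.lamMin δ ≤ lam0 →
      ∀ (Ω : Type*) [MeasurableSpace Ω] (P : Measure Ω) [IsProbabilityMeasure P]
        (R : CABTSRun I lam0 (I.expl lam0 δ) P),
        Integrable (R.regret α) P ∧
        ∫ ω, R.regret α ω ∂P ≤
          (I.c₁ lam0 δ + I.c₂ lam0 δ) * (1 + 2 / (0.15 - 2 * δ)) *
            (√(2 * d * N * T * Real.log (1 + N * T / (d * lam0)))
              + 2 * d * N / √lam0 * Real.log (1 + N * T / (d * lam0)))
          + 4 * δ * I.M * T) ∧
    -- resulting rate, for the smallest admissible regularization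
    (∃ p : ℕ, ∀ B : ℝ, ∃ C : ℝ,
      ∀ (N K d T : ℕ), 0 < N → 0 < K → 0 < d → 0 < T →
      ∀ (I : CAB N K d T) (δ α : ℝ), 0 < δ → δ < 1 / T → 0 < α → α ≤ 1 →
      I.σ ≤ B → I.Lμ ≤ B * I.kappa → 1 ≤ B * I.D →
      I.M ≤ B * (I.kappa⁻¹ * I.Lr * I.Lμ * I.D) →
      ∀ (Ω : Type*) [MeasurableSpace Ω] (P : Measure Ω) [IsProbabilityMeasure P]
        (R : CABTSRun I (I.lamMin δ) (I.expl (I.lamMin δ) δ) P),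
        ∫ ω, R.regret α ω ∂P ≤
          C * (I.kappa⁻¹ * I.Lr * I.Lμ * I.D * (d * N * √T + d * (N : ℝ) ^ (3 / 2 : ℝ))) *
            (1 + Real.log (K * N * T / δ)) ^ p) := by
  refine ⟨?_, 3, fun B => ⟨CAB.rateConst B, ?_⟩⟩
  · intro N K d T hN hK hd hT I lam0 δ α hδ hδT hδ' _ hα hlam Ω _ P _ R
    exact ⟨R.integrable_regret α,
      CABTSRun.integral_regret_le hN hK hd hT hδ hδT hδ' hα hlam R⟩
  · intro N K d T hN hK hd hT I δ α hδ hδT _ hα hσB hLB hD hM Ω _ P _ R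
    rcases le_or_gt δ (1 / 20) with hδ' | hδ'
    · exact (CABTSRun.integral_regret_le hN hK hd hT hδ hδT (by linarith) hα le_rfl R).trans
        (I.explicit_bound_le_rate hN hK hd hT hδ hδT hδ' hσB hLB hD hM)
    · exact R.integral_regret_le_rate_of_lt hN hK hd hT hδT hδ' hα hσB hM
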